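/- **Setting.** Let $p\ge 0$, $q\ge 1$, let $\xi\sim P$, $\zeta\sim Q$ be random elements of measurable spaces, and let $F(x,y;\xi)$, $G(x,y;\zeta)$ be real functions of $(x,y)\in\mathbb R^p\times\mathbb R^q$, measurable in $\xi$, resp. $\zeta$, with finite expectations $f(x,y)=\mathbb E_\xi F(x,y;\xi)$ and $g(x,y)=\mathbb E_\zeta G(x,y;\zeta)$. Put $y^*(x)=\arg\min_{y\in\mathbb R^q} g(x,y)$ and $\Phi(x)=f(x,y^*(x))$. Norms are Euclidean on vectors (on $\mathbb R^p\times\mathbb R^q$: of the concatenated vector) and spectral on matrices; $\nabla_x\nabla_y h$ is the Jacobian of $\nabla_x h$ with respect to $y$. Assume, with constants $\mu>0$, $C_f,L_f,L_g,L_{gxy},L_{gyy}\ge 0$ and $\sigma_f,\sigma_g,\sigma_{gxy},\sigma_{gyy}$: 1. $f$ and every $F(\cdot;\xi)$ are $C^1$; $g$ and every $G(\cdot;\zeta)$ are $C^2$; $g(x,\cdot)$ and $G(x,\cdot;\zeta)$ are $\mu$-strongly convex for all $x,\zeta$; $\inf_x\Phi(x)>-\infty$. 2. $f$ is $C_f$-Lipschitz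 and $\nabla f$ is $L_f$-Lipschitz; $\nabla g$, $\nabla_x\nabla_y g$, $\nabla_y^2 g$ are Lipschitz with constants $L_g$, $L_{gxy}$, $L_{gyy}$, all with respect to $(x,y)$. 3. At every $(x,y)$, $\nabla F(x,y;\xi)$, $\nabla G(x,y;\zeta)$, $\nabla_x\nabla_yG(x,y;\zeta)$, $\nabla_y^2G(x,y;\zeta)$ are integrable with means $\nabla f$, $\nabla g$, $\nabla_x\nabla_yg$, $\nabla_y^2g$, and their mean squared deviations from these means are at most $\sigma_f^2$, $\sigma_g^2$, $\sigma_{gxy}^2$, $\sigma_{gyy}^2$, respectively. 4. For all $\xi,\zeta$, the functions $F(\cdot;\xi)$ and $G(\cdot;\zeta)$ satisfy the conditions that 2 imposes on $f$ and $g$. Fix $M\ge C_f/\mu$. Put $L_{gg}=\max\{L_{gxy},L_{gyy}\}$, $C_y=\frac{L_g}{\mu}$, $C_v=\big(\frac{L_f}{\mu}+\frac{C_fL_{gg}}{\mu^2}\big)\big(1+\frac{L_g}{\mu}\big)$, $\bar M_1=4L_f^2+4M^2L_{gg}^2$ and $$L_\Phi=L_f+\frac{2L_fL_{gg}+C_f^2L_{gg}}{\mu}+\frac{L_fL_g^2+2C_fL_gL_{gg}}{\mu^2}+\frac{C_fL_g^2L_{gg}}{\mu^3},$$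 and assume $L_\Phi>0$ (this is automatic if $\Phi$ is not convex). **Algorithm (ALS-SPIDER, $\tau^x=\tau^y=\tau^v=0$).** For functions $f,g$ let $D_y=\nabla_yg(x,y)$, $D_v=\nabla_y^2g(x,y)v-\nabla_yf(x,y)$, $D_x=\nabla_xf(x,y)-\nabla_x\nabla_yg(x,y)v$. For a batch $\mathcal S$ of samples $(\xi_i,\delta_i)$, where $\xi_i\sim P$, $\delta_i\sim Q$ ($D_y$ uses only the $\delta_i$), $D_\bullet(\cdot;\mathcal S)$ is the average over the batch of $D_\bullet$ with $f,g$ replaced by $F(\cdot;\xi_i),G(\cdot;\delta_i)$. All samples drawn are mutually independent. Given integers $T,J,q_1,S_1,S_2\ge1$, numbers $\lambda_1,\lambda_2,\alpha,\beta,\eta$ and $x_0\in\mathbb R^p$, $y_0\in\mathbb R^q$, $v_0\in\mathbb R^q$ with $\|v_0\|\le M$, for $k=0,1,2,\dots$: * If $q_1\mid k$, draw three batches $\mathcal S_{1,x},\mathcal S_{1,y},\mathcal S_{1,v}$ of size $S_1$ and set $D_k^x=D_x(x_k,y_k,v_k;\mathcal S_{1,x})$, $D_k^y=D_y(x_k,y_k;\mathcal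 S_{1,y})$, $D_k^v=D_v(x_k,y_k,v_k;\mathcal S_{1,v})$; otherwise $D_k^x=D_{k-1,J-1}^x$, $D_k^y=D_{k-1,T-1}^y$, $D_k^v=D_{k-1,J-1}^v$. * Set $x_{k+1}=x_k-\alpha D_k^x$. * Start from $(\bar x_{k,-1},\bar y_{k,-1},D_{k,-1}^y)=(x_k,y_k,D_k^y)$ and let $\bar x_{k,t}=x_{k+1}$ for $t\ge0$. For $t=0,\dots,T-1$ set $\bar y_{k,t}=\bar y_{k,t-1}-\lambda_1\beta D_{k,t-1}^y$, draw a batch $\mathcal S$ of size $S_2$ and set $D_{k,t}^y=D_y(\bar x_{k,t},\bar y_{k,t};\mathcal S)+D_{k,t-1}^y-D_y(\bar x_{k,t-1},\bar y_{k,t-1};\mathcal S)$. Set $y_{k+1}=\bar y_{k,T-1}$. * Start from $u_{k,-1}=(x_k,y_k,v_k)$, $D_{k,-1}^x=D_k^x$, $D_{k,-1}^v=D_k^v$. For $j=0,\dots,J-1$ let $v_{k,j}$ be the projection of $v_{k,j-1}-\lambda_2\eta D_{k,j-1}^v$ onto $\{v:\|v\|\le M\}$, put $u_{k,j}=(x_{k+1},y_{k+1},v_{k,j})$,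 draw two batches $\mathcal S_x,\mathcal S_v$ of size $S_2$ and set $D_{k,j}^x=D_x(u_{k,j};\mathcal S_x)+D_{k,j-1}^x-D_x(u_{k,j-1};\mathcal S_x)$, $D_{k,j}^v=D_v(u_{k,j};\mathcal S_v)+D_{k,j-1}^v-D_v(u_{k,j-1};\mathcal S_v)$. Set $v_{k+1}=v_{k,J-1}$. **Theorem.** Let $S_2=q_1$, $r=S_2/q_1$ $(=1)$, $0<\beta<1$, $0<\eta<1$, $C_3=J^2+J^2M^2+2T^2$, $$\lambda_1=\min\Big\{\tfrac1{2L_g+2\mu},\tfrac{(1/2)^{2T+5}\mu r}{TL_g^2\beta^2C_3}\Big\},\quad \lambda_2=\min\Big\{\tfrac1{2L_g+2\mu},\tfrac{\mu^2\lambda_1\beta}{128\bar M_1J\eta},\tfrac{(1/2)^{2(T+J)+6}\mu r}{J(L_g^2\eta^2+T\bar M_1\beta\eta)}\Big\},$$ $C_4=192\lambda_1\beta L_g^2(1+r^{-1}C_3)$, $C_5=192\lambda_2\eta\bar M_1(1+C_y^2+r^{-1}J)$ and $$\alpha=\min\Big\{\tfrac{\mu\lambda_1\beta}{96C_y^2+8\bar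 M_1},\tfrac{\mu\lambda_2\eta}{48(L_g^2+C_v^2)},\tfrac1{6L_\Phi},\tfrac{\sqrt r}{12\sqrt{\bar M_1}},\tfrac{\mu}{C_4},\tfrac{\mu}{C_5},\tfrac{(1/2)^{2(T+J)+3}r}{\bar M_1T\beta+L_g^2\eta}\Big\}.$$ Then $\Phi$ is differentiable and, for any fixed positive integers $T$ and $J$, there is a constant $C$ that does not depend on $K$, $S_1$, $S_2=q_1$ or the realization of the samples such that for all positive integers $K$, $S_1$, $q_1$ the expectations below are finite and $$\frac1K\sum_{k=0}^{K-1}\mathbb E\|\nabla\Phi(x_k)\|^2\le C\Big(\frac1K+\frac1{S_1}\Big).$$ -/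

import Mathlib

open MeasureTheory ProbabilityTheory
open scoped NNReal

namespace ALSSpider

/-- `ℝⁿ` with its Euclidean norm. -/
abbrev Vec (n : ℕ) := EuclideanSpace ℝ (Fin n)

/-- `ℝ^p × ℝ^q` with the Euclidean norm of the concatenated vector `(x, y)`. -/
abbrev Joint (p q : ℕ) := WithLp 2 (Vec p × Vec q)

/-- The point `(x, y)` of `ℝ^p × ℝ^q`. -/
def pt {p q : ℕ} (x : Vec p) (y : Vec q) : Joint p q := WithLp.toLp 2 (x, y)

noncomputable section

/-! ### Partial derivatives -/

section Derivatives

variable {p q : ℕ}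

/-- `∇ₓ h`, the `x`-block of the full gradient. -/
def gradX (h : Joint p q → ℝ) (z : Joint p q) : Vec p := (gradient h z).fst

/-- `∇_y h`, the `y`-block of the full gradient. -/
def gradY (h : Joint p q → ℝ) (z : Joint p q) : Vec q := (gradient h z).snd

/-- `∇ₓ∇_y h`, the Jacobian of `∇ₓ h` with respect to `y` (a `p × q` matrix, as an operator). -/
def hessXY (h : Joint p q → ℝ) (z : Joint p q) : Vec q →L[ℝ] Vec p :=
  fderiv ℝ (fun y => gradX h (pt z.fst y)) z.snd

/-- `∇_y² h`, the Hessian of `h` with respect to `y`. -/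
def hessYY (h : Joint p q → ℝ) (z : Joint p q) : Vec q →L[ℝ] Vec q :=
  fderiv ℝ (fun y => gradY h (pt z.fst y)) z.snd

/-- `D_y(x, y) = ∇_y g(x, y)`; with `g` replaced by `G(·; δ)` this is the stochastic version. -/
def dirY (g : Joint p q → ℝ) (x : Vec p) (y : Vec q) : Vec q := gradY g (pt x y)

/-- `D_v(x, y, v) = ∇_y² g(x, y) v - ∇_y f(x, y)`; with `f`, `g` replaced by `F(·; ξ)`, `G(·; δ)`
this is the stochastic version. -/
def dirV (f g : Joint p q → ℝ) (x : Vec p) (y v : Vec q) : Vec q :=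
  hessYY g (pt x y) v - gradY f (pt x y)

/-- `D_x(x, y, v) = ∇ₓ f(x, y) - ∇ₓ∇_y g(x, y) v`; with `f`, `g` replaced by `F(·; ξ)`, `G(·; δ)`
this is the stochastic version. -/
def dirX (f g : Joint p q → ℝ) (x : Vec p) (y v : Vec q) : Vec p :=
  gradX f (pt x y) - hessXY g (pt x y) v

end Derivatives

/-! ### The bilevel problem -/

section Problem

variable {p q : ℕ}

/-- The expected function `z ↦ 𝔼[H(z; ξ)]`. -/
def expected {Ξ : Type*} [MeasurableSpace Ξ] (P : Measure Ξ) (H : Ξ → Joint p q → ℝ)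
    (z : Joint p q) : ℝ := ∫ ξ, H ξ z ∂P

/-- `y*(x)`, a minimizer of `g(x, ·)` (it exists and is unique if `g(x, ·)` is continuous and
strongly convex). -/
def lowerSol (g : Joint p q → ℝ) (x : Vec p) : Vec q :=
  Classical.epsilon fun y => ∀ y', g (pt x y) ≤ g (pt x y')

/-- The upper-level value function `Φ(x) = f(x, y*(x))`. -/
def valueFun (f g : Joint p q → ℝ) (x : Vec p) : ℝ := f (pt x (lowerSol g x))

/-- The constants of the problem: strong convexity, Lipschitz and variance constants, and the
radius `M` of the ball `{v | ‖v‖ ≤ M}`. -/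
structure Constants where
  μ : ℝ
  Cf : ℝ≥0
  Lf : ℝ≥0
  Lg : ℝ≥0
  Lgxy : ℝ≥0
  Lgyy : ℝ≥0
  σf : ℝ
  σg : ℝ
  σgxy : ℝ
  σgyy : ℝ
  M : ℝ

/-- `f` and `∇f` are Lipschitz continuous with constants `C_f` and `L_f`. -/
structure UpperLipschitz (c : Constants) (f : Joint p q → ℝ) : Prop where
  lip : LipschitzWith c.Cf f
  lip_grad : LipschitzWith c.Lf (gradient f)

/-- `∇g`, `∇ₓ∇_y g` and `∇_y² g` are Lipschitz continuous with constants `L_g`, `L_gxy`, `L_gyy`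
(operator norm on matrices). -/
structure LowerLipschitz (c : Constants) (g : Joint p q → ℝ) : Prop where
  lip_grad : LipschitzWith c.Lg (gradient g)
  lip_hessXY : LipschitzWith c.Lgxy (hessXY g)
  lip_hessYY : LipschitzWith c.Lgyy (hessYY g)

/-- `X` is an unbiased estimate of `m`: it is integrable with mean `m`. -/
def Unbiased {Ξ V : Type*} [MeasurableSpace Ξ] [NormedAddCommGroup V] [NormedSpace ℝ V]
    (P : Measure Ξ) (X : Ξ → V) (m : V) : Prop :=
  Integrable X P ∧ ∫ ξ, X ξ ∂P = m

/-- `𝔼‖X - m‖² ≤ σ²`, the expectation being finite. -/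
def VarianceLe {Ξ V : Type*} [MeasurableSpace Ξ] [NormedAddCommGroup V]
    (P : Measure Ξ) (X : Ξ → V) (m : V) (σ : ℝ) : Prop :=
  Integrable (fun ξ => ‖X ξ - m‖ ^ 2) P ∧ ∫ ξ, ‖X ξ - m‖ ^ 2 ∂P ≤ σ ^ 2

/-- The standing assumptions on the stochastic bilevel problem
`min_x f(x, y*(x))`, `y*(x) = argmin_y g(x, y)`, `f = 𝔼 F(·; ξ)`, `g = 𝔼 G(·; ζ)`,
with `ξ ∼ P` and `ζ ∼ Q`. -/
structure Assumptions {Ξ Z : Type*} [MeasurableSpace Ξ] [MeasurableSpace Z]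
    (P : Measure Ξ) (Q : Measure Z) (F : Ξ → Joint p q → ℝ) (G : Z → Joint p q → ℝ)
    (c : Constants) : Prop where
  -- the expectations defining `f` and `g` make sense
  meas_F : ∀ z, Measurable fun ξ => F ξ z
  meas_G : ∀ z, Measurable fun ζ => G ζ z
  int_F : ∀ z, Integrable (fun ξ => F ξ z) P
  int_G : ∀ z, Integrable (fun ζ => G ζ z) Q
  -- smoothness, strong convexity in `y`, lower boundedness of `Φ`
  smooth_f : ContDiff ℝ 1 (expected P F)
  smooth_F : ∀ ξ, ContDiff ℝ 1 (F ξ)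
  smooth_g : ContDiff ℝ 2 (expected Q G)
  smooth_G : ∀ ζ, ContDiff ℝ 2 (G ζ)
  μ_pos : 0 < c.μ
  strong_g : ∀ x, StrongConvexOn Set.univ c.μ fun y => expected Q G (pt x y)
  strong_G : ∀ x ζ, StrongConvexOn Set.univ c.μ fun y => G ζ (pt x y)
  bddBelow : BddBelow (Set.range (valueFun (expected P F) (expected Q G)))
  -- Lipschitz conditions on the objectives
  lip_f : UpperLipschitz c (expected P F)
  lip_g : LowerLipschitz c (expected Q G)
  -- unbiasedness
  unbiased_F : ∀ z, Unbiased P (fun ξ => gradient (F ξ) z) (gradient (expected P F) z)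
  unbiased_G : ∀ z, Unbiased Q (fun ζ => gradient (G ζ) z) (gradient (expected Q G) z)
  unbiased_Gxy : ∀ z, Unbiased Q (fun ζ => hessXY (G ζ) z) (hessXY (expected Q G) z)
  unbiased_Gyy : ∀ z, Unbiased Q (fun ζ => hessYY (G ζ) z) (hessYY (expected Q G) z)
  -- bounded variance
  var_F : ∀ z, VarianceLe P (fun ξ => gradient (F ξ) z) (gradient (expected P F) z) c.σf
  var_G : ∀ z, VarianceLe Q (fun ζ => gradient (G ζ) z) (gradient (expected Q G) z) c.σg
  var_Gxy : ∀ z, VarianceLe Q (fun ζ => hessXY (G ζ) z) (hessXY (expected Q G) z) c.σgxy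
  var_Gyy : ∀ z, VarianceLe Q (fun ζ => hessYY (G ζ) z) (hessYY (expected Q G) z) c.σgyy
  -- Lipschitz conditions on the stochastic components
  lip_F : ∀ ξ, UpperLipschitz c (F ξ)
  lip_G : ∀ ζ, LowerLipschitz c (G ζ)
  -- radius of the ball containing the auxiliary variable
  radius : c.Cf / c.μ ≤ c.M

end Problem

/-! ### Derived constants and step sizes -/

namespace Constants

variable (c : Constants)

/-- `L_gg = max {L_gxy, L_gyy}`. -/
def Lgg : ℝ := max (c.Lgxy : ℝ) (c.Lgyy : ℝ)

/-- The Lipschitz constant `L_Φ` of `∇Φ`. -/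
def LPhi : ℝ :=
  c.Lf + (2 * c.Lf * c.Lgg + c.Cf ^ 2 * c.Lgg) / c.μ
    + (c.Lf * c.Lg ^ 2 + 2 * c.Cf * c.Lg * c.Lgg) / c.μ ^ 2
    + c.Cf * c.Lg ^ 2 * c.Lgg / c.μ ^ 3

/-- The Lipschitz constant `C_y` of `y*`. -/
def Cy : ℝ := c.Lg / c.μ

/-- The Lipschitz constant `C_v` of `v*`. -/
def Cv : ℝ := (c.Lf / c.μ + c.Cf * c.Lgg / c.μ ^ 2) * (1 + c.Lg / c.μ)

/-- `M̄₁ = 4 L_f² + 4 M² L_gg²`. -/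
def M1 : ℝ := 4 * (c.Lf : ℝ) ^ 2 + 4 * c.M ^ 2 * c.Lgg ^ 2

/-- `C₃ = J² + J² M² + 2 T²`. -/
def C3 (T J : ℕ) : ℝ := (J : ℝ) ^ 2 + (J : ℝ) ^ 2 * c.M ^ 2 + 2 * (T : ℝ) ^ 2

/-- The step size `λ₁`, with `r = S₂ / q₁`. -/
def lam1 (T J : ℕ) (β r : ℝ) : ℝ :=
  min (1 / (2 * c.Lg + 2 * c.μ))
    ((1 / 2) ^ (2 * T + 5) * c.μ * r / (T * (c.Lg : ℝ) ^ 2 * β ^ 2 * c.C3 T J))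

/-- The step size `λ₂`, with `r = S₂ / q₁`. -/
def lam2 (T J : ℕ) (β η r : ℝ) : ℝ :=
  min (1 / (2 * c.Lg + 2 * c.μ))
    (min (c.μ ^ 2 * c.lam1 T J β r * β / (128 * c.M1 * J * η))
      ((1 / 2) ^ (2 * (T + J) + 6) * c.μ * r
        / (J * ((c.Lg : ℝ) ^ 2 * η ^ 2 + T * c.M1 * β * η))))

/-- `C₄ = 192 λ₁ β L_g² (1 + r⁻¹ C₃)`. -/
def C4 (T J : ℕ) (β r : ℝ) : ℝ :=
  192 * c.lam1 T J β r * β * (c.Lg : ℝ) ^ 2 * (1 + r⁻¹ * c.C3 T J)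

/-- `C₅ = 192 λ₂ η M̄₁ (1 + C_y² + r⁻¹ J)`. -/
def C5 (T J : ℕ) (β η r : ℝ) : ℝ :=
  192 * c.lam2 T J β η r * η * c.M1 * (1 + c.Cy ^ 2 + r⁻¹ * J)

/-- The step size `α`, with `r = S₂ / q₁`. -/
def alpha (T J : ℕ) (β η r : ℝ) : ℝ :=
  min (c.μ * c.lam1 T J β r * β / (96 * c.Cy ^ 2 + 8 * c.M1))
    (min (c.μ * c.lam2 T J β η r * η / (48 * ((c.Lg : ℝ) ^ 2 + c.Cv ^ 2)))
    (min (1 / (6 * c.LPhi))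
    (min (Real.sqrt r / (12 * Real.sqrt c.M1))
    (min (c.μ / c.C4 T J β r)
    (min (c.μ / c.C5 T J β η r)
      ((1 / 2) ^ (2 * (T + J) + 3) * r / (c.M1 * T * β + (c.Lg : ℝ) ^ 2 * η)))))))

end Constants

/-! ### The algorithm -/

/-- The labels of all samples that the algorithm may draw. `x1 k i`, `y1 k i`, `v1 k i` is the
`i`-th sample of the large batches `𝒮₁` in outer iteration `k`; `y2 k t i` is the `i`-th sample of
the batch `𝒮₂` in step `t` of the lower-level loop of outer iteration `k`; `x2 k j i` and `v2 k j i`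
are those of the two batches `𝒮₂` in step `j` of the auxiliary-variable loop. -/
inductive Draw where
  | x1 (k i : ℕ)
  | y1 (k i : ℕ)
  | v1 (k i : ℕ)
  | y2 (k t i : ℕ)
  | x2 (k j i : ℕ)
  | v2 (k j i : ℕ)

/-- The parameters of the algorithm. -/
structure Params where
  T : ℕ
  J : ℕ
  q1 : ℕ
  S1 : ℕ
  S2 : ℕ
  lam1 : ℝ
  lam2 : ℝ
  α : ℝ
  β : ℝ
  η : ℝ
  τx : ℝ
  τy : ℝ
  τv : ℝ
  M : ℝ

/-- Projection onto the ball `{v | ‖v‖ ≤ M}`. -/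
def projBall {q : ℕ} (M : ℝ) (v : Vec q) : Vec q :=
  if ‖v‖ ≤ M then v else (M / ‖v‖) • v

/-- The average of `D` over the batch `s 0, …, s (S - 1)`. -/
def batchMean {W : Type*} {n : ℕ} (S : ℕ) (s : ℕ → W) (D : W → Vec n) : Vec n :=
  (S : ℝ)⁻¹ • ∑ i ∈ Finset.range S, D (s i)

/-- The state `(x̄_{k,t}, ȳ_{k,t}, D^y_{k,t})` of the lower-level loop. -/
structure YState (p q : ℕ) where
  x : Vec p
  y : Vec q
  Dy : Vec q

/-- The state `(x_{k,j}, y_{k,j}, v_{k,j}, D^x_{k,j}, D^v_{k,j})` of the auxiliary-variable loop. -/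
structure VState (p q : ℕ) where
  x : Vec p
  y : Vec q
  v : Vec q
  Dx : Vec p
  Dv : Vec q

/-- The state of the outer loop: `x_k, y_k, v_k` and the estimates returned by the inner loops of
the previous outer iteration. -/
structure State (p q : ℕ) where
  x : Vec p
  y : Vec q
  v : Vec q
  Dx : Vec p
  Dy : Vec q
  Dv : Vec q

section Algorithm

variable {p q : ℕ} {Ξ Z : Type*} (a : Params) (F : Ξ → Joint p q → ℝ) (G : Z → Joint p q → ℝ)
  (s : Draw → Ξ × Z)

/-- The lower-level loop of outer iteration `k`, started at `init` (the state with index `-1`),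
at the new upper-level point `xnew`. The value at `t + 1` is the state with index `t`. -/
def yLoop (k : ℕ) (init : YState p q) (xnew : Vec p) : ℕ → YState p q
  | 0 => init
  | t + 1 =>
    let u := yLoop k init xnew t
    let ynew := u.y - (a.lam1 * a.β) • u.Dy
    let D := fun (x : Vec p) (y : Vec q) =>
      batchMean a.S2 (fun i => s (.y2 k t i)) fun w => dirY (G w.2) x y
    { x := xnew
      y := ynew
      Dy := D xnew ynew + (1 - a.τy) • (u.Dy - D u.x u.y) }

/-- The auxiliary-variable loop of outer iteration `k`, started at `init` (the state with index
`-1`), at the new points `xnew`, `ynew`. The value at `j + 1` is the state with index `j`. -/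
def vLoop (k : ℕ) (init : VState p q) (xnew : Vec p) (ynew : Vec q) : ℕ → VState p q
  | 0 => init
  | j + 1 =>
    let u := vLoop k init xnew ynew j
    let vnew := projBall a.M (u.v - (a.lam2 * a.η) • u.Dv)
    let DX := fun (x : Vec p) (y v : Vec q) =>
      batchMean a.S2 (fun i => s (.x2 k j i)) fun w => dirX (F w.1) (G w.2) x y v
    let DV := fun (x : Vec p) (y v : Vec q) =>
      batchMean a.S2 (fun i => s (.v2 k j i)) fun w => dirV (F w.1) (G w.2) x y v
    { x := xnew
      y := ynew
      v := vnew
      Dx := DX xnew ynew vnew + (1 - a.τx) • (u.Dx - DX u.x u.y u.v)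
      Dv := DV xnew ynew vnew + (1 - a.τv) • (u.Dv - DV u.x u.y u.v) }

/-- The estimates `D_k^x, D_k^y, D_k^v`: renewed from large batches if `q₁ ∣ k`, otherwise those
returned by the inner loops of the previous outer iteration. -/
def refresh (k : ℕ) (u : State p q) : State p q :=
  if k % a.q1 = 0 then
    { u with
      Dx := batchMean a.S1 (fun i => s (.x1 k i)) fun w => dirX (F w.1) (G w.2) u.x u.y u.v
      Dy := batchMean a.S1 (fun i => s (.y1 k i)) fun w => dirY (G w.2) u.x u.y
      Dv := batchMean a.S1 (fun i => s (.v1 k i)) fun w => dirV (F w.1) (G w.2) u.x u.y u.v }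
  else u

/-- Outer iteration `k`. -/
def outerStep (k : ℕ) (u₀ : State p q) : State p q :=
  let u := refresh a F G s k u₀
  let xnew := u.x - a.α • u.Dx
  let yOut := yLoop a G s k { x := u.x, y := u.y, Dy := u.Dy } xnew a.T
  let vOut := vLoop a F G s k { x := u.x, y := u.y, v := u.v, Dx := u.Dx, Dv := u.Dv }
    xnew yOut.y a.J
  { x := xnew, y := yOut.y, v := vOut.v, Dx := vOut.Dx, Dy := yOut.Dy, Dv := vOut.Dv }

/-- The iterates of the algorithm for the realization `s` of the samples. The initial values of the
estimates are never used, because they are renewed in iteration `0`. -/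
def run (x₀ : Vec p) (y₀ v₀ : Vec q) : ℕ → State p q
  | 0 => { x := x₀, y := y₀, v := v₀, Dx := 0, Dy := 0, Dv := 0 }
  | k + 1 => outerStep a F G s k (run x₀ y₀ v₀ k)

end Algorithm

/-- The samples `smp d = (ξ_d, δ_d)` are mutually independent over `d`, with `ξ_d ∼ P` and
`δ_d ∼ Q`. The two components of one sample may be dependent. (The samples for `y` only use `δ_d`.) -/
structure IsSampling {Ξ Z Ω : Type*} [MeasurableSpace Ξ] [MeasurableSpace Z] [MeasurableSpace Ω]
    (P : Measure Ξ) (Q : Measure Z) (Pr : Measure Ω) (smp : Draw → Ω → Ξ × Z) : Prop where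
  meas : ∀ d, Measurable (smp d)
  law_fst : ∀ d, Pr.map (fun ω => (smp d ω).1) = P
  law_snd : ∀ d, Pr.map (fun ω => (smp d ω).2) = Q
  indep : iIndepFun smp Pr

/-- The parameters of ALS-SPIDER: `τ^x = τ^y = τ^v = 0` and the prescribed step sizes. -/
def spiderParams (c : Constants) (T J q1 S1 S2 : ℕ) (β η : ℝ) : Params where
  T := T
  J := J
  q1 := q1
  S1 := S1
  S2 := S2
  lam1 := c.lam1 T J β (S2 / q1)
  lam2 := c.lam2 T J β η (S2 / q1)
  α := c.alpha T J β η (S2 / q1)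
  β := β
  η := η
  τx := 0
  τy := 0
  τv := 0
  M := c.M

end

end ALSSpider

/-! Write y* for the lower-level solution (`lowerSol`) and v* for the solution of ∇_y²g·v = ∇_y f at
(x, y*(x)) (`auxSol`). The gradient of Φ at x is D_x(x, y*(x), v*(x))
(`Regular.hasGradientAt_valueFun`). So a step along the estimate of D_x(x_k, y_k, v_k) is an inexact
gradient step for Φ, whose error comes from the distances of y_k and v_k to y*(x_k) and v*(x_k) and
from the noise of the estimate.

The proof is a Lyapunov argument for Ψ_k = 𝔼Φ(x_k) + (1-ρ)𝔼‖y_k - y*(x_k)‖² + 𝔼‖v_k - v*(x_k)‖² with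
ρ = 8λ₂ηJM̄₁/μ. Descent: `meanPhi_succ_le` yields -α/2 of the squared gradient and -α/3 of
𝔼‖D_k^x‖², at the price of both squared distances and the error of D_k^x. Tracking: each inner loop
contracts its distance (`sq_norm_step_le`, summed in `yPath_summary` and `vPath_summary`). It pays
for the drift of its target, which is Lipschitz in x and hence of order α²𝔼‖D_k^x‖², and for its
estimation error; it gains a negative multiple of the squared inner directions. Noise: a SPIDER step
adds an independent centered term to the error, so by orthogonality the mean squared error grows by
at most the Lipschitz-weighted squared movement divided by S₂ (`IsOracle.integral_sq_spider_le`). A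
large batch resets the error to O(1/S₁) (`IsOracle.integral_sq_batchMean_le`).

Let R_k/S₂ bound the error growth in iteration k. Resets occur every q₁ = S₂ iterations, so each
R_k/S₂ is counted at most q₁ times and the errors sum to at most K·O(1/S₁) + ∑R_k
(`sum_periodic_reset_le`). The R_k are combinations of exactly those squared directions that appear
with negative sign above, and the step sizes are small enough for these to absorb them
(`IsBalanced`, `isBalanced_spiderParams`). Telescoping Ψ_k and bounding Φ below gives the rate. -/

namespace ALSSpider

open Filter Topology
open scoped RealInnerProductSpace

/-! ### Smoothness and strong convexity inequalities -/

section Abstract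

variable {E : Type*} [NormedAddCommGroup E] [InnerProductSpace ℝ E] [CompleteSpace E]

theorem hasDerivAt_line_of_hasGradientAt {h : E → ℝ} {h' x d : E} {t : ℝ}
    (hd : HasGradientAt h h' (x + t • d)) :
    HasDerivAt (fun t : ℝ => h (x + t • d)) ⟪h', d⟫ t := by
  have h1 : HasDerivAt (fun t : ℝ => x + t • d) d t := by
    simpa using ((hasDerivAt_id t).smul_const d).const_add x
  have h2 := hd.hasFDerivAt.comp_hasDerivAt t h1
  exact h2

/-- The descent lemma. -/
theorem descent_of_lipschitz_gradient {h : E → ℝ} {h' : E → E}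
    (hd : ∀ x, HasGradientAt h (h' x) x) {L : ℝ}
    (hL : ∀ x y, ‖h' x - h' y‖ ≤ L * ‖x - y‖) (x d : E) :
    h (x + d) ≤ h x + ⟪h' x, d⟫ + L / 2 * ‖d‖ ^ 2 := by
  -- The Lipschitz bound makes the derivative of `φ` nonpositive on [0, 1]; comparing `φ 1` with `φ
  -- 0` is the claim.
  set φ : ℝ → ℝ := fun t => h (x + t • d) - t * ⟪h' x, d⟫ - L / 2 * ‖d‖ ^ 2 * t ^ 2 with hφ
  have hder : ∀ t, HasDerivAt φ (⟪h' (x + t • d), d⟫ - ⟪h' x, d⟫ - L / 2 * ‖d‖ ^ 2 * (2 * t)) t := by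
    intro t
    have h1 := hasDerivAt_line_of_hasGradientAt (x := x) (d := d) (t := t) (hd _)
    have h2 : HasDerivAt (fun t : ℝ => t * ⟪h' x, d⟫) ⟪h' x, d⟫ t := by
      simpa using (hasDerivAt_id t).mul_const ⟪h' x, d⟫
    have h3 : HasDerivAt (fun t : ℝ => L / 2 * ‖d‖ ^ 2 * t ^ 2) (L / 2 * ‖d‖ ^ 2 * (2 * t)) t := by
      simpa using (hasDerivAt_pow 2 t).const_mul (L / 2 * ‖d‖ ^ 2)
    exact (h1.sub h2).sub h3
  have hanti : AntitoneOn φ (Set.Icc 0 1) := by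
    refine antitoneOn_of_deriv_nonpos (convex_Icc 0 1)
      (fun t _ => (hder t).continuousAt.continuousWithinAt)
      (fun t _ => (hder t).differentiableAt.differentiableWithinAt) fun t ht => ?_
    rw [interior_Icc] at ht
    rw [(hder t).deriv, ← inner_sub_left]
    have h1 := real_inner_le_norm (h' (x + t • d) - h' x) d
    have h2 := hL (x + t • d) x
    rw [add_sub_cancel_left, norm_smul, Real.norm_of_nonneg ht.1.le] at h2
    nlinarith [norm_nonneg d, mul_le_mul_of_nonneg_right h2 (norm_nonneg d)]
  have := hanti (Set.left_mem_Icc.2 zero_le_one) (Set.right_mem_Icc.2 zero_le_one) zero_le_one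
  simp [hφ] at this
  linarith

/-- Strong convexity on the segment from `x` to `y` bounds the slope at parameter t; let t ↓ 0. -/
theorem strongConvexOn_add_inner_add_le {h : E → ℝ} {μ : ℝ} (hc : StrongConvexOn Set.univ μ h)
    {x h' : E} (hd : HasGradientAt h h' x) (y : E) :
    h x + ⟪h', y - x⟫ + μ / 2 * ‖y - x‖ ^ 2 ≤ h y := by
  have hder : HasDerivAt (fun t : ℝ => h (x + t • (y - x))) ⟪h', y - x⟫ 0 :=
    hasDerivAt_line_of_hasGradientAt (by simpa using hd)
  have hlim := (hasDerivAt_iff_tendsto_slope_zero.1 hder).mono_left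
    (nhdsWithin_mono 0 (show Set.Ioi (0 : ℝ) ⊆ {0}ᶜ from fun t ht => ne_of_gt ht))
  have hlim2 : Tendsto (fun t : ℝ => h y - h x - (1 - t) * (μ / 2 * ‖y - x‖ ^ 2)) (𝓝[>] 0)
      (𝓝 (h y - h x - (1 - 0) * (μ / 2 * ‖y - x‖ ^ 2))) := by
    refine Tendsto.mono_left (Continuous.tendsto ?_ _) nhdsWithin_le_nhds
    fun_prop
  have := le_of_tendsto_of_tendsto hlim hlim2 (by
    filter_upwards [Ioo_mem_nhdsGT (zero_lt_one' ℝ)] with t ht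
    have h1 := hc.2 (Set.mem_univ x) (Set.mem_univ y) (sub_nonneg.2 ht.2.le) ht.1.le (by ring)
    have h2 : (1 - t) • x + t • y = x + t • (y - x) := by module
    rw [h2, norm_sub_rev] at h1
    simp only [zero_add, zero_smul, add_zero, smul_eq_mul] at h1 ⊢
    rw [inv_mul_le_iff₀ ht.1]
    nlinarith)
  linarith

end Abstract

/-! ### Block coordinates on ℝ^p × ℝ^q -/

section Blocks

variable {p q : ℕ}

@[simp] theorem pt_fst (x : Vec p) (y : Vec q) : (pt x y).fst = x := rfl
@[simp] theorem pt_snd (x : Vec p) (y : Vec q) : (pt x y).snd = y := rfl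
theorem pt_sub (x x' : Vec p) (y y' : Vec q) : pt x y - pt x' y' = pt (x - x') (y - y') := rfl
theorem pt_add (x x' : Vec p) (y y' : Vec q) : pt x y + pt x' y' = pt (x + x') (y + y') := rfl
theorem pt_fst_snd (z : Joint p q) : pt z.fst z.snd = z := rfl

theorem norm_pt_sq (x : Vec p) (y : Vec q) : ‖pt x y‖ ^ 2 = ‖x‖ ^ 2 + ‖y‖ ^ 2 :=
  WithLp.prod_norm_sq_eq_of_L2 _

theorem norm_fst_le (z : Joint p q) : ‖z.fst‖ ≤ ‖z‖ := by
  have := WithLp.prod_norm_sq_eq_of_L2 z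
  exact (sq_le_sq₀ (norm_nonneg _) (norm_nonneg _)).1 (by nlinarith [sq_nonneg ‖z.snd‖])

theorem norm_snd_le (z : Joint p q) : ‖z.snd‖ ≤ ‖z‖ := by
  have := WithLp.prod_norm_sq_eq_of_L2 z
  exact (sq_le_sq₀ (norm_nonneg _) (norm_nonneg _)).1 (by nlinarith [sq_nonneg ‖z.fst‖])

theorem norm_pt_zero_left (y : Vec q) : ‖pt (0 : Vec p) y‖ = ‖y‖ := WithLp.norm_toLp_snd _ _ _ y

theorem norm_pt_le (x : Vec p) (y : Vec q) : ‖pt x y‖ ≤ ‖x‖ + ‖y‖ := by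
  refine (sq_le_sq₀ (norm_nonneg _) (by positivity)).1 ?_
  rw [norm_pt_sq]
  nlinarith [norm_nonneg x, norm_nonneg y]

theorem inner_pt_right (z : Joint p q) (x : Vec p) (y : Vec q) :
    ⟪z, pt x y⟫ = ⟪z.fst, x⟫ + ⟪z.snd, y⟫ := WithLp.prod_inner_apply _ _

theorem inner_pt_left (z : Joint p q) (x : Vec p) (y : Vec q) :
    ⟪pt x y, z⟫ = ⟪x, z.fst⟫ + ⟪y, z.snd⟫ := WithLp.prod_inner_apply _ _

/-- The embedding `y ↦ (0, y)`. -/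
noncomputable def inrL : Vec q →L[ℝ] Joint p q :=
  (WithLp.prodContinuousLinearEquiv 2 ℝ (Vec p) (Vec q)).symm.toContinuousLinearMap.comp
    (ContinuousLinearMap.inr ℝ (Vec p) (Vec q))

theorem inrL_apply (y : Vec q) : (inrL y : Joint p q) = pt 0 y := rfl

theorem continuous_pt : Continuous fun u : Vec p × Vec q => pt u.1 u.2 :=
  (WithLp.prodContinuousLinearEquiv 2 ℝ (Vec p) (Vec q)).symm.continuous

theorem hasFDerivAt_pt_right (x : Vec p) (y : Vec q) :
    HasFDerivAt (fun y : Vec q => pt x y) (inrL : Vec q →L[ℝ] Joint p q) y := by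
  have : (fun y : Vec q => pt x y) = fun y => inrL y + pt x 0 := by
    ext1 y
    rw [inrL_apply, pt_add, zero_add, add_zero]
  rw [this]
  exact (inrL (p := p) (q := q)).hasFDerivAt.add_const _

theorem hasGradientAt_pt_right {h : Joint p q → ℝ} {z' : Joint p q} {x : Vec p} {y : Vec q}
    (hd : HasGradientAt h z' (pt x y)) : HasGradientAt (fun y => h (pt x y)) z'.snd y := by
  rw [hasGradientAt_iff_hasFDerivAt]
  refine (hd.hasFDerivAt.comp y (hasFDerivAt_pt_right x y)).congr_fderiv ?_
  ext1 w
  simp [inrL_apply]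

end Blocks

/-! ### Gradients and symmetry of the second derivative -/

section Gradient

variable {E : Type*} [NormedAddCommGroup E] [InnerProductSpace ℝ E] [CompleteSpace E]

/-- The inverse Riesz isomorphism as an `ℝ`-linear map. -/
noncomputable def rieszSymm : StrongDual ℝ E →L[ℝ] E :=
  LinearMap.mkContinuous
    { toFun := (InnerProductSpace.toDual ℝ E).symm
      map_add' := map_add _
      map_smul' := fun t x => by simp } 1 fun x => by simp

theorem contDiff_gradient {h : E → ℝ} {n m : ℕ} (hh : ContDiff ℝ n h) (hm : m + 1 ≤ n) :
    ContDiff ℝ m (gradient h) :=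
  (rieszSymm (E := E)).contDiff.comp (hh.fderiv_right (by exact_mod_cast hm))

theorem inner_fderiv_gradient {h : E → ℝ} (hh : ContDiff ℝ 2 h) (z a b : E) :
    ⟪fderiv ℝ (gradient h) z a, b⟫ = fderiv ℝ (fderiv ℝ h) z a b := by
  have h1 : DifferentiableAt ℝ (fderiv ℝ h) z :=
    (hh.fderiv_right (m := 1) (by norm_num)).differentiable (by norm_num) z
  have h2 : fderiv ℝ (gradient h) z = (rieszSymm (E := E)).comp (fderiv ℝ (fderiv ℝ h) z) :=
    ((rieszSymm (E := E)).hasFDerivAt.comp z h1.hasFDerivAt).fderiv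
  rw [h2]
  exact InnerProductSpace.toDual_symm_apply

theorem inner_fderiv_gradient_comm {h : E → ℝ} (hh : ContDiff ℝ 2 h) (z a b : E) :
    ⟪fderiv ℝ (gradient h) z a, b⟫ = ⟪fderiv ℝ (gradient h) z b, a⟫ := by
  rw [inner_fderiv_gradient hh, inner_fderiv_gradient hh]
  exact (hh.contDiffAt.isSymmSndFDerivAt (by simp)).eq a b

theorem hasGradientAt_of_contDiff {h : E → ℝ} (hh : ContDiff ℝ 1 h) (z : E) :
    HasGradientAt h (gradient h z) z :=
  (hh.differentiable (by norm_num) z).hasGradientAt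

theorem norm_gradient_le {h : E → ℝ} {C : ℝ≥0} (hh : LipschitzWith C h) (z : E) :
    ‖gradient h z‖ ≤ C := by
  rw [gradient, LinearIsometryEquiv.norm_map]
  exact norm_fderiv_le_of_lipschitz ℝ hh

end Gradient

/-! ### Blocks of the Hessian -/

section Hessian

variable {p q : ℕ} {g : Joint p q → ℝ}

theorem hasFDerivAt_gradient (hg : ContDiff ℝ 2 g) (z : Joint p q) :
    HasFDerivAt (gradient g) (fderiv ℝ (gradient g) z) z :=
  ((contDiff_gradient (n := 2) (m := 1) hg (by norm_num)).differentiable (by norm_num) z).hasFDerivAt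

/-- Relating the partial Jacobians to the full second derivative makes its symmetry and its operator
norm bound available for the blocks. -/
theorem hessXY_apply (hg : ContDiff ℝ 2 g) (z : Joint p q) (v : Vec q) :
    hessXY g z v = (fderiv ℝ (gradient g) z (pt 0 v)).fst := by
  have h1 : HasFDerivAt (fun y => gradient g (pt z.fst y))
      ((fderiv ℝ (gradient g) z).comp inrL) z.snd :=
    HasFDerivAt.comp (g := gradient g) z.snd (hasFDerivAt_gradient hg z)
      (hasFDerivAt_pt_right z.fst z.snd)
  have h2 := (WithLp.fstL 2 ℝ (Vec p) (Vec q)).hasFDerivAt.comp z.snd h1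
  exact congrArg (fun A => A v) h2.fderiv

theorem hessYY_apply (hg : ContDiff ℝ 2 g) (z : Joint p q) (v : Vec q) :
    hessYY g z v = (fderiv ℝ (gradient g) z (pt 0 v)).snd := by
  have h1 : HasFDerivAt (fun y => gradient g (pt z.fst y))
      ((fderiv ℝ (gradient g) z).comp inrL) z.snd :=
    HasFDerivAt.comp (g := gradient g) z.snd (hasFDerivAt_gradient hg z)
      (hasFDerivAt_pt_right z.fst z.snd)
  have h2 := (WithLp.sndL 2 ℝ (Vec p) (Vec q)).hasFDerivAt.comp z.snd h1
  exact congrArg (fun A => A v) h2.fderiv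

theorem hasFDerivAt_gradY (hg : ContDiff ℝ 2 g) (x : Vec p) (y : Vec q) :
    HasFDerivAt (fun y => gradY g (pt x y)) (hessYY g (pt x y)) y := by
  have h1 : HasFDerivAt (fun y => gradient g (pt x y))
      ((fderiv ℝ (gradient g) (pt x y)).comp inrL) y :=
    HasFDerivAt.comp (g := gradient g) y (hasFDerivAt_gradient hg (pt x y))
      (hasFDerivAt_pt_right x y)
  have h2 := (WithLp.sndL 2 ℝ (Vec p) (Vec q)).hasFDerivAt.comp y h1
  exact h2.differentiableAt.hasFDerivAt

theorem hasFDerivAt_gradX (hg : ContDiff ℝ 2 g) (x : Vec p) (y : Vec q) :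
    HasFDerivAt (fun y => gradX g (pt x y)) (hessXY g (pt x y)) y := by
  have h1 : HasFDerivAt (fun y => gradient g (pt x y))
      ((fderiv ℝ (gradient g) (pt x y)).comp inrL) y :=
    HasFDerivAt.comp (g := gradient g) y (hasFDerivAt_gradient hg (pt x y))
      (hasFDerivAt_pt_right x y)
  have h2 := (WithLp.fstL 2 ℝ (Vec p) (Vec q)).hasFDerivAt.comp y h1
  exact h2.differentiableAt.hasFDerivAt

end Hessian

/-! ### Deterministic theory of the bilevel problem -/

/-- The deterministic part of the standing assumptions, satisfied by the expected objectives and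
by every pair of realizations. -/
structure Regular {p q : ℕ} (c : Constants) (f g : Joint p q → ℝ) : Prop where
  smooth_f : ContDiff ℝ 1 f
  smooth_g : ContDiff ℝ 2 g
  μ_pos : 0 < c.μ
  strong : ∀ x, StrongConvexOn Set.univ c.μ fun y => g (pt x y)
  lip_f : UpperLipschitz c f
  lip_g : LowerLipschitz c g
  radius : c.Cf / c.μ ≤ c.M

/-- A solution `v` of `∇_y² g(x, y*(x)) v = ∇_y f(x, y*(x))`. -/
noncomputable def auxSol {p q : ℕ} (f g : Joint p q → ℝ) (x : Vec p) : Vec q :=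
  Classical.epsilon fun v => dirV f g x (lowerSol g x) v = 0

theorem Constants.Lgg_nonneg (c : Constants) : 0 ≤ c.Lgg := le_max_of_le_left c.Lgxy.2

namespace Regular

variable {p q : ℕ} {c : Constants} {f g : Joint p q → ℝ} (h : Regular c f g)
include h

theorem M_nonneg : 0 ≤ c.M := (div_nonneg c.Cf.2 h.μ_pos.le).trans h.radius

theorem norm_gradY_le (z : Joint p q) : ‖gradY f z‖ ≤ c.Cf :=
  (norm_snd_le _).trans (norm_gradient_le h.lip_f.lip z)

theorem norm_gradX_sub_le (z z' : Joint p q) : ‖gradX f z - gradX f z'‖ ≤ c.Lf * ‖z - z'‖ :=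
  (norm_fst_le (gradient f z - gradient f z')).trans (h.lip_f.lip_grad.norm_sub_le z z')

theorem norm_gradY_sub_le (z z' : Joint p q) : ‖gradY f z - gradY f z'‖ ≤ c.Lf * ‖z - z'‖ :=
  (norm_snd_le (gradient f z - gradient f z')).trans (h.lip_f.lip_grad.norm_sub_le z z')

theorem norm_dirY_sub_le (x x' : Vec p) (y y' : Vec q) :
    ‖dirY g x y - dirY g x' y'‖ ≤ c.Lg * ‖pt (x - x') (y - y')‖ :=
  (norm_snd_le (gradient g (pt x y) - gradient g (pt x' y'))).trans
    (h.lip_g.lip_grad.norm_sub_le _ _)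

theorem norm_fderiv_gradient_le (z w : Joint p q) : ‖fderiv ℝ (gradient g) z w‖ ≤ c.Lg * ‖w‖ :=
  (ContinuousLinearMap.le_opNorm _ _).trans
    (mul_le_mul_of_nonneg_right (norm_fderiv_le_of_lipschitz ℝ h.lip_g.lip_grad) (norm_nonneg _))

theorem norm_hessXY_apply_le (z : Joint p q) (v : Vec q) : ‖hessXY g z v‖ ≤ c.Lg * ‖v‖ := by
  rw [hessXY_apply h.smooth_g, ← norm_pt_zero_left (p := p) v]
  exact (norm_fst_le _).trans (h.norm_fderiv_gradient_le _ _)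

theorem norm_hessYY_apply_le (z : Joint p q) (v : Vec q) : ‖hessYY g z v‖ ≤ c.Lg * ‖v‖ := by
  rw [hessYY_apply h.smooth_g, ← norm_pt_zero_left (p := p) v]
  exact (norm_snd_le _).trans (h.norm_fderiv_gradient_le _ _)

theorem norm_hessXY_sub_apply_le (z z' : Joint p q) (v : Vec q) :
    ‖hessXY g z v - hessXY g z' v‖ ≤ c.Lgg * ‖z - z'‖ * ‖v‖ := by
  have h1 := (hessXY g z - hessXY g z').le_opNorm v
  have h2 := h.lip_g.lip_hessXY.norm_sub_le z z'
  have h3 : (c.Lgxy : ℝ) ≤ c.Lgg := le_max_left _ _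
  exact h1.trans (mul_le_mul_of_nonneg_right (h2.trans (by gcongr)) (norm_nonneg _))

theorem norm_hessYY_sub_apply_le (z z' : Joint p q) (v : Vec q) :
    ‖hessYY g z v - hessYY g z' v‖ ≤ c.Lgg * ‖z - z'‖ * ‖v‖ := by
  have h1 := (hessYY g z - hessYY g z').le_opNorm v
  have h2 := h.lip_g.lip_hessYY.norm_sub_le z z'
  have h3 : (c.Lgyy : ℝ) ≤ c.Lgg := le_max_right _ _
  exact h1.trans (mul_le_mul_of_nonneg_right (h2.trans (by gcongr)) (norm_nonneg _))

/-- The change is split so that the difference of Hessians acts on `v` alone, while `v - v'` meets a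
Hessian of norm at most L_g. Hence only one of the two points has to lie in the ball of radius M. -/
theorem norm_dirV_sub_le (x x' : Vec p) (y y' v v' : Vec q) :
    ‖dirV f g x y v - dirV f g x' y' v'‖ ≤
      (c.Lf + c.Lgg * ‖v‖) * ‖pt (x - x') (y - y')‖ + c.Lg * ‖v - v'‖ := by
  have h1 := h.norm_hessYY_sub_apply_le (pt x y) (pt x' y') v
  have h2 := h.norm_hessYY_apply_le (pt x' y') (v - v')
  have h3 := h.norm_gradY_sub_le (pt x y) (pt x' y')
  have e : dirV f g x y v - dirV f g x' y' v' = (hessYY g (pt x y) v - hessYY g (pt x' y') v)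
      + hessYY g (pt x' y') (v - v') - (gradY f (pt x y) - gradY f (pt x' y')) := by
    simp only [dirV, map_sub]; abel
  rw [e, ← pt_sub]
  refine (norm_sub_le _ _).trans ?_
  have h4 := norm_add_le (hessYY g (pt x y) v - hessYY g (pt x' y') v)
    (hessYY g (pt x' y') (v - v'))
  nlinarith

theorem norm_dirX_sub_le (x x' : Vec p) (y y' v v' : Vec q) :
    ‖dirX f g x y v - dirX f g x' y' v'‖ ≤
      (c.Lf + c.Lgg * ‖v‖) * ‖pt (x - x') (y - y')‖ + c.Lg * ‖v - v'‖ := by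
  have h1 := h.norm_hessXY_sub_apply_le (pt x y) (pt x' y') v
  have h2 := h.norm_hessXY_apply_le (pt x' y') (v - v')
  have h3 := h.norm_gradX_sub_le (pt x y) (pt x' y')
  have e : dirX f g x y v - dirX f g x' y' v' = (gradX f (pt x y) - gradX f (pt x' y'))
      - ((hessXY g (pt x y) v - hessXY g (pt x' y') v) + hessXY g (pt x' y') (v - v')) := by
    simp only [dirX, map_sub]; abel
  rw [e, ← pt_sub]
  refine (norm_sub_le _ _).trans ?_
  have h4 := norm_add_le (hessXY g (pt x y) v - hessXY g (pt x' y') v)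
    (hessXY g (pt x' y') (v - v'))
  nlinarith

-- (s + t)² ≤ 2s² + 2t² is used twice, once between the two summands and once inside (L_f + M
-- L_gg)²; this is where M̄₁ comes from.
omit h in
theorem sq_le_of_le_lipschitz {a b d n : ℝ} (ha : 0 ≤ a) (hb : 0 ≤ b)
    (hn : n ≤ c.M) (hn0 : 0 ≤ n) (h : a ≤ (c.Lf + c.Lgg * n) * b + c.Lg * d) :
    a ^ 2 ≤ c.M1 * b ^ 2 + 2 * (c.Lg : ℝ) ^ 2 * d ^ 2 := by
  have hg := c.Lgg_nonneg
  have hM : 0 ≤ c.M := hn0.trans hn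
  have h1 : a ≤ (c.Lf + c.Lgg * c.M) * b + c.Lg * d := h.trans (by gcongr)
  have h2 : a ^ 2 ≤ ((c.Lf + c.Lgg * c.M) * b + c.Lg * d) ^ 2 := by gcongr
  rw [Constants.M1]
  nlinarith [sq_nonneg ((c.Lf + c.Lgg * c.M) * b - c.Lg * d),
    mul_nonneg (sq_nonneg ((c.Lf : ℝ) - c.Lgg * c.M)) (sq_nonneg b)]

theorem sq_norm_dirV_sub_le (x x' : Vec p) (y y' v v' : Vec q) (hv : ‖v‖ ≤ c.M) :
    ‖dirV f g x y v - dirV f g x' y' v'‖ ^ 2 ≤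
      c.M1 * (‖x - x'‖ ^ 2 + ‖y - y'‖ ^ 2) + 2 * (c.Lg : ℝ) ^ 2 * ‖v - v'‖ ^ 2 := by
  rw [← norm_pt_sq]
  exact sq_le_of_le_lipschitz (norm_nonneg _) (norm_nonneg _) hv (norm_nonneg _)
    (h.norm_dirV_sub_le x x' y y' v v')

theorem sq_norm_dirX_sub_le (x x' : Vec p) (y y' v v' : Vec q) (hv : ‖v‖ ≤ c.M) :
    ‖dirX f g x y v - dirX f g x' y' v'‖ ^ 2 ≤
      c.M1 * (‖x - x'‖ ^ 2 + ‖y - y'‖ ^ 2) + 2 * (c.Lg : ℝ) ^ 2 * ‖v - v'‖ ^ 2 := by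
  rw [← norm_pt_sq]
  exact sq_le_of_le_lipschitz (norm_nonneg _) (norm_nonneg _) hv (norm_nonneg _)
    (h.norm_dirX_sub_le x x' y y' v v')

theorem sq_norm_dirY_sub_le (x x' : Vec p) (y y' : Vec q) :
    ‖dirY g x y - dirY g x' y'‖ ^ 2 ≤ (c.Lg : ℝ) ^ 2 * (‖x - x'‖ ^ 2 + ‖y - y'‖ ^ 2) := by
  rw [← norm_pt_sq, ← mul_pow]
  have := h.norm_dirY_sub_le x x' y y'
  gcongr

/-! ### The lower-level problem -/

theorem hasGradientAt_lower (x : Vec p) (y : Vec q) :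
    HasGradientAt (fun y => g (pt x y)) (dirY g x y) y :=
  hasGradientAt_pt_right (hasGradientAt_of_contDiff (h.smooth_g.of_le (by norm_num)) _)

theorem lower_add_inner_le (x : Vec p) (y y' : Vec q) :
    g (pt x y) + ⟪dirY g x y, y' - y⟫ + c.μ / 2 * ‖y' - y‖ ^ 2 ≤ g (pt x y') :=
  strongConvexOn_add_inner_add_le (h.strong x) (h.hasGradientAt_lower x y) y'

theorem lower_strong_mono (x : Vec p) (y y' : Vec q) :
    c.μ * ‖y - y'‖ ^ 2 ≤ ⟪dirY g x y - dirY g x y', y - y'⟫ := by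
  have h1 := h.lower_add_inner_le x y y'
  have h2 := h.lower_add_inner_le x y' y
  rw [← neg_sub y y', inner_neg_right, norm_neg] at h1
  rw [inner_sub_left]
  linarith

theorem lower_norm_mono (x : Vec p) (y y' : Vec q) :
    c.μ * ‖y - y'‖ ≤ ‖dirY g x y - dirY g x y'‖ := by
  rcases (norm_nonneg (y - y')).eq_or_lt with h0 | h0
  · rw [← h0, mul_zero]; exact norm_nonneg _
  · have h1 := (h.lower_strong_mono x y y').trans (real_inner_le_norm _ _)
    exact le_of_mul_le_mul_right (by linarith) h0

/-- A unit vector exists because `q` is positive; on it strong monotonicity and the Lipschitz bound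
can be compared. -/
theorem μ_le_Lg (hq : 0 < q) : c.μ ≤ c.Lg := by
  have h1 := h.lower_norm_mono 0 (EuclideanSpace.single ⟨0, hq⟩ 1) 0
  have h2 := h.norm_dirY_sub_le 0 0 (EuclideanSpace.single ⟨0, hq⟩ 1) 0
  rw [sub_self, norm_pt_zero_left] at h2
  simpa using h1.trans h2

/-- Strong convexity at 0 gives a quadratic minorant, so the function is coercive. -/
theorem exists_lower_min (x : Vec p) : ∃ y, ∀ y', g (pt x y) ≤ g (pt x y') := by
  have hc : Continuous fun y => g (pt x y) :=
    h.smooth_g.continuous.comp (continuous_pt.comp (Continuous.prodMk_right x))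
  refine hc.exists_forall_le ?_
  have h1 : ∀ y, g (pt x 0) + ‖y‖ * (c.μ / 2 * ‖y‖ - ‖dirY g x 0‖) ≤ g (pt x y) := by
    intro y
    have h2 := h.lower_add_inner_le x 0 y
    have h3 := abs_le.1 (abs_real_inner_le_norm (dirY g x 0) y)
    rw [sub_zero] at h2
    nlinarith [h3.1]
  refine tendsto_atTop_mono h1 (tendsto_atTop_add_const_left _ _ ?_)
  have h4 : Tendsto (fun y : Vec q => ‖y‖) (cocompact _) atTop := tendsto_norm_cocompact_atTop
  refine h4.atTop_mul_atTop₀ (tendsto_atTop_add_const_right _ _ (h4.const_mul_atTop ?_))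
  exact half_pos h.μ_pos

theorem lowerSol_le (x : Vec p) (y : Vec q) : g (pt x (lowerSol g x)) ≤ g (pt x y) :=
  Classical.epsilon_spec (h.exists_lower_min x) y

theorem dirY_lowerSol (x : Vec p) : dirY g x (lowerSol g x) = 0 := by
  have h1 : IsLocalMin (fun y => g (pt x y)) (lowerSol g x) :=
    Eventually.of_forall fun y => h.lowerSol_le x y
  have h2 := h1.hasFDerivAt_eq_zero (h.hasGradientAt_lower x _).hasFDerivAt
  simpa using h2

/-- Strong monotonicity at `x` bounds the distance by ‖D_y(x, y*(x'))‖/μ, and D_y vanishes at (x',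
y*(x')). -/
theorem norm_lowerSol_sub_le (x x' : Vec p) :
    ‖lowerSol g x - lowerSol g x'‖ ≤ c.Cy * ‖x - x'‖ := by
  have h1 := h.lower_norm_mono x (lowerSol g x) (lowerSol g x')
  have h2 := h.norm_dirY_sub_le x x' (lowerSol g x') (lowerSol g x')
  have h3 : ‖pt (x - x') (0 : Vec q)‖ = ‖x - x'‖ := WithLp.norm_toLp_fst _ _ _ _
  rw [h.dirY_lowerSol, sub_self, h3] at h2
  rw [h.dirY_lowerSol, zero_sub, norm_neg] at h1
  rw [Constants.Cy, div_mul_eq_mul_div, le_div_iff₀ h.μ_pos]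
  rw [sub_zero] at h2
  linarith

/-- Strong convexity gives the first term. The second is the decrease achieved by a gradient step of
length 1/L_g from `y`, which cannot fall below the minimum. That term later produces the negative
multiple of the squared direction which pays for the growth of the SPIDER errors. -/
theorem lower_coercive (x : Vec p) (y : Vec q) (hL : 0 < (c.Lg : ℝ)) :
    c.μ / 2 * ‖y - lowerSol g x‖ ^ 2 + 1 / (2 * c.Lg) * ‖dirY g x y‖ ^ 2 ≤
      ⟪dirY g x y, y - lowerSol g x⟫ := by
  have h1 := h.lower_add_inner_le x y (lowerSol g x)
  have h2 := descent_of_lipschitz_gradient (h.hasGradientAt_lower x) (L := c.Lg)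
    (fun y y' => by simpa [norm_pt_zero_left] using h.norm_dirY_sub_le x x y y') y
    (-((1 / (c.Lg : ℝ)) • dirY g x y))
  have h3 := h.lowerSol_le x (y + -((1 / (c.Lg : ℝ)) • dirY g x y))
  rw [inner_neg_right, inner_smul_right, real_inner_self_eq_norm_sq, norm_neg, norm_smul,
    Real.norm_of_nonneg (by positivity)] at h2
  rw [← neg_sub y, inner_neg_right, norm_neg] at h1
  have h4 : (c.Lg : ℝ) / 2 * (1 / c.Lg * ‖dirY g x y‖) ^ 2 = 1 / (2 * c.Lg) * ‖dirY g x y‖ ^ 2 := by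
    field_simp
  have h5 : 1 / (c.Lg : ℝ) * ‖dirY g x y‖ ^ 2 = 2 * (1 / (2 * c.Lg) * ‖dirY g x y‖ ^ 2) := by
    field_simp
  linarith

/-! ### The Hessian of the lower-level problem -/

theorem hessYY_symm (z : Joint p q) (v w : Vec q) : ⟪hessYY g z v, w⟫ = ⟪hessYY g z w, v⟫ := by
  have := inner_fderiv_gradient_comm h.smooth_g z (pt 0 v) (pt 0 w)
  simpa [inner_pt_right, ← hessYY_apply h.smooth_g] using this

/-- Strong monotonicity between `z.snd` and `z.snd + t • w`, divided by t², in the limit t → 0. -/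
theorem hessYY_strong (z : Joint p q) (w : Vec q) : c.μ * ‖w‖ ^ 2 ≤ ⟪hessYY g z w, w⟫ := by
  have h1 : HasDerivAt (fun t : ℝ => dirY g z.fst (z.snd + t • w)) (hessYY g z w) 0 := by
    have h2 : HasDerivAt (fun t : ℝ => z.snd + t • w) w 0 := by
      simpa using ((hasDerivAt_id (0 : ℝ)).smul_const w).const_add z.snd
    have h3 := hasFDerivAt_gradY h.smooth_g z.fst z.snd
    rw [pt_fst_snd] at h3
    exact HasFDerivAt.comp_hasDerivAt (0 : ℝ) (by simpa using h3) h2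
  have h4 := (hasDerivAt_iff_tendsto_slope_zero.1 h1).inner (𝕜 := ℝ) (tendsto_const_nhds (x := w))
  refine ge_of_tendsto h4 ?_
  filter_upwards [self_mem_nhdsWithin] with t ht
  have ht : t ≠ 0 := ht
  have h5 := h.lower_strong_mono z.fst (z.snd + t • w) z.snd
  rw [add_sub_cancel_left, norm_smul, inner_smul_right, mul_pow, Real.norm_eq_abs, sq_abs] at h5
  simp only [zero_add, zero_smul, add_zero]
  rw [real_inner_smul_left]
  have h6 : 0 < t ^ 2 := by positivity
  have h7 : t⁻¹ * ⟪dirY g z.fst (z.snd + t • w) - dirY g z.fst z.snd, w⟫ =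
      (t * ⟪dirY g z.fst (z.snd + t • w) - dirY g z.fst z.snd, w⟫) / t ^ 2 := by
    field_simp
  rw [h7, le_div_iff₀ h6]
  linarith

theorem hessYY_norm_mono (z : Joint p q) (w : Vec q) : c.μ * ‖w‖ ≤ ‖hessYY g z w‖ := by
  rcases (norm_nonneg w).eq_or_lt with h0 | h0
  · rw [← h0, mul_zero]; exact norm_nonneg _
  · have h1 := (h.hessYY_strong z w).trans (real_inner_le_norm _ _)
    exact le_of_mul_le_mul_right (by linarith) h0

/-- Analogue of `lower_coercive` for the quadratic problem solved by v. Writing H for the Hessian,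
half of ⟪Hw, w⟫ controls μ/2‖w‖²; the other half controls ‖Hw‖², by positivity of H at w - Hw/L_g
and ‖H‖ ≤ L_g. -/
theorem hessYY_coercive (z : Joint p q) (w : Vec q) (hL : 0 < (c.Lg : ℝ)) :
    c.μ / 2 * ‖w‖ ^ 2 + 1 / (2 * c.Lg) * ‖hessYY g z w‖ ^ 2 ≤ ⟪hessYY g z w, w⟫ := by
  have h1 := h.hessYY_strong z w
  have h2 := h.hessYY_strong z (w - (1 / (c.Lg : ℝ)) • hessYY g z w)
  have h3 := (real_inner_le_norm _ _).trans (mul_le_mul_of_nonneg_right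
    (h.norm_hessYY_apply_le z (hessYY g z w)) (norm_nonneg (hessYY g z w)))
  have h4 := h.hessYY_symm z (hessYY g z w) w
  have h5 : 0 ≤ ⟪hessYY g z (w - (1 / (c.Lg : ℝ)) • hessYY g z w),
      w - (1 / (c.Lg : ℝ)) • hessYY g z w⟫ :=
    le_trans (mul_nonneg h.μ_pos.le (sq_nonneg _)) h2
  rw [map_sub, map_smul, inner_sub_left, inner_sub_right, inner_sub_right, inner_smul_right,
    real_inner_smul_left, real_inner_smul_left, inner_smul_right, h4,
    real_inner_self_eq_norm_sq] at h5
  have h6 : 1 / (c.Lg : ℝ) * (1 / c.Lg * ⟪hessYY g z (hessYY g z w), hessYY g z w⟫) ≤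
      1 / c.Lg * ‖hessYY g z w‖ ^ 2 := by
    have : 1 / (c.Lg : ℝ) * ⟪hessYY g z (hessYY g z w), hessYY g z w⟫ ≤ ‖hessYY g z w‖ ^ 2 := by
      rw [one_div, inv_mul_le_iff₀ hL]
      linarith
    gcongr
  have h7 : 1 / (c.Lg : ℝ) * ‖hessYY g z w‖ ^ 2 = 2 * (1 / (2 * c.Lg) * ‖hessYY g z w‖ ^ 2) := by
    field_simp
  linarith

/-! ### The auxiliary variable -/

/-- The Hessian in y is injective by strong convexity, hence surjective in finite dimension, so the
linear system has a solution. -/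
theorem dirV_auxSol (x : Vec p) : dirV f g x (lowerSol g x) (auxSol f g x) = 0 := by
  refine Classical.epsilon_spec (p := fun v => dirV f g x (lowerSol g x) v = 0) ?_
  set H : Vec q →ₗ[ℝ] Vec q := (hessYY g (pt x (lowerSol g x))).toLinearMap with hH
  have hinj : Function.Injective H := by
    refine (injective_iff_map_eq_zero H).2 fun w hw => ?_
    have h1 := h.hessYY_norm_mono (pt x (lowerSol g x)) w
    have hw : hessYY g (pt x (lowerSol g x)) w = 0 := hw
    rw [hw, norm_zero] at h1
    have := h.μ_pos
    exact norm_le_zero_iff.1 (by nlinarith)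
  obtain ⟨v, hv⟩ := (LinearMap.injective_iff_surjective.1 hinj) (gradY f (pt x (lowerSol g x)))
  exact ⟨v, sub_eq_zero.2 hv⟩

theorem hessYY_auxSol (x : Vec p) :
    hessYY g (pt x (lowerSol g x)) (auxSol f g x) = gradY f (pt x (lowerSol g x)) :=
  sub_eq_zero.1 (h.dirV_auxSol x)

theorem norm_auxSol_le_div (x : Vec p) : ‖auxSol f g x‖ ≤ c.Cf / c.μ := by
  have h1 := h.hessYY_norm_mono (pt x (lowerSol g x)) (auxSol f g x)
  rw [h.hessYY_auxSol] at h1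
  rw [le_div_iff₀ h.μ_pos]
  linarith [h.norm_gradY_le (pt x (lowerSol g x))]

/-- This is the purpose of M ≥ C_f/μ: projecting onto the ball does not move an iterate away from
v*. -/
theorem norm_auxSol_le (x : Vec p) : ‖auxSol f g x‖ ≤ c.M :=
  (h.norm_auxSol_le_div x).trans h.radius

theorem norm_pt_lowerSol_sub_le (x x' : Vec p) :
    ‖pt (x - x') (lowerSol g x - lowerSol g x')‖ ≤ (1 + c.Lg / c.μ) * ‖x - x'‖ := by
  have := h.norm_lowerSol_sub_le x x'
  rw [Constants.Cy] at this
  linarith [norm_pt_le (x - x') (lowerSol g x - lowerSol g x')]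

/-- Evaluated at v*(x'), the direction D_v vanishes at (x', y*(x')) and equals -H(v*(x) - v*(x')) at
(x, y*(x)), where H is the Hessian there. So μ‖v*(x) - v*(x')‖ is at most the change of D_v with v
held fixed. -/
theorem norm_auxSol_sub_le (x x' : Vec p) :
    ‖auxSol f g x - auxSol f g x'‖ ≤ c.Cv * ‖x - x'‖ := by
  have hg := c.Lgg_nonneg
  have hμ := h.μ_pos
  have h1 := h.hessYY_norm_mono (pt x (lowerSol g x)) (auxSol f g x - auxSol f g x')
  have h2 := h.norm_dirV_sub_le x' x (lowerSol g x') (lowerSol g x) (auxSol f g x') (auxSol f g x')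
  have h3 : dirV f g x (lowerSol g x) (auxSol f g x') =
      - hessYY g (pt x (lowerSol g x)) (auxSol f g x - auxSol f g x') := by
    rw [dirV, ← h.hessYY_auxSol, map_sub, neg_sub]
  rw [h.dirV_auxSol, h3, sub_neg_eq_add, zero_add, sub_self, norm_zero, mul_zero, add_zero] at h2
  have h4 := h.norm_pt_lowerSol_sub_le x' x
  have h5 := h.norm_auxSol_le_div x'
  have h6 : (c.Lf + c.Lgg * ‖auxSol f g x'‖) *
      ‖pt (x' - x) (lowerSol g x' - lowerSol g x)‖ ≤
      (c.Lf + c.Lgg * (c.Cf / c.μ)) * ((1 + c.Lg / c.μ) * ‖x - x'‖) := by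
    rw [norm_sub_rev x]
    gcongr
  have h7 : c.Cv * ‖x - x'‖ =
      ((c.Lf + c.Lgg * (c.Cf / c.μ)) * ((1 + c.Lg / c.μ) * ‖x - x'‖)) / c.μ := by
    rw [Constants.Cv]; field_simp
  rw [h7, le_div_iff₀ hμ]
  linarith

/-! ### The value function -/

/-- The gradient of the value function. -/
theorem hasGradientAt_valueFun (x : Vec p) :
    HasGradientAt (valueFun f g) (dirX f g x (lowerSol g x) (auxSol f g x)) x := by
  set y := lowerSol g x with hy
  set v := auxSol f g x with hv
  -- No derivative of y* is needed: since y* is Lipschitz, remainders that are small relative to the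
  -- movement of (x', y*(x')) are small relative to x' - x.
  have hz : (fun x' => pt x' (lowerSol g x') - pt x y) =O[𝓝 x] fun x' => x' - x := by
    refine Asymptotics.IsBigO.of_bound (1 + c.Lg / c.μ) (Eventually.of_forall fun x' => ?_)
    rw [pt_sub]
    exact h.norm_pt_lowerSol_sub_le x' x
  have hlim : Tendsto (fun x' => pt x' (lowerSol g x')) (𝓝 x) (𝓝 (pt x y)) := by
    rw [← tendsto_sub_nhds_zero_iff]
    refine hz.trans_tendsto ?_
    rw [tendsto_sub_nhds_zero_iff]
    exact tendsto_id
  have hf := (hasGradientAt_of_contDiff h.smooth_f (pt x y)).hasFDerivAt.isLittleO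
  have hg := (hasFDerivAt_gradient h.smooth_g (pt x y)).isLittleO
  have hf' := (hf.comp_tendsto hlim).trans_isBigO hz
  have hg' := (hg.comp_tendsto hlim).trans_isBigO hz
  have hg'' : (fun x' => ⟪pt (0 : Vec p) v, gradient g (pt x' (lowerSol g x')) - gradient g (pt x y)
      - fderiv ℝ (gradient g) (pt x y) (pt x' (lowerSol g x') - pt x y)⟫) =o[𝓝 x]
      fun x' => x' - x := by
    refine Asymptotics.IsBigO.trans_isLittleO ?_ hg'
    exact Asymptotics.IsBigO.of_bound ‖pt (0 : Vec p) v‖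
      (Eventually.of_forall fun x' => norm_inner_le_norm _ _)
  rw [hasGradientAt_iff_isLittleO]
  refine (hf'.sub hg'').congr_left fun x' => ?_
  have h1 := inner_fderiv_gradient_comm h.smooth_g (pt x y)
    (pt x' (lowerSol g x') - pt x y) (pt 0 v)
  have h2 : (gradient g (pt x' (lowerSol g x'))).snd = 0 := h.dirY_lowerSol x'
  have h3 : (gradient g (pt x y)).snd = 0 := h.dirY_lowerSol x
  have h4 : hessYY g (pt x y) v = (gradient f (pt x y)).snd := h.hessYY_auxSol x
  -- Adjoint argument: ∇_y g vanishes at both points, so pairing the expansion of ∇g with (0, v)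
  -- leaves only the linear term. By symmetry this is the Hessian applied to (0, v), whose y-block
  -- is ∇_y f and cancels the unknown movement of y* in the expansion of f.
  have h5 : ⟪pt (0 : Vec p) v, gradient g (pt x' (lowerSol g x')) - gradient g (pt x y)
      - fderiv ℝ (gradient g) (pt x y) (pt x' (lowerSol g x') - pt x y)⟫ =
      -⟪fderiv ℝ (gradient g) (pt x y) (pt 0 v), pt x' (lowerSol g x') - pt x y⟫ := by
    rw [← h1, inner_sub_right, inner_pt_left, WithLp.sub_snd, h2, h3,
      real_inner_comm (fderiv ℝ (gradient g) (pt x y) (pt x' (lowerSol g x') - pt x y))]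
    simp
  simp only [Function.comp_apply, InnerProductSpace.toDual_apply_apply]
  rw [h5, pt_sub, inner_pt_right, inner_pt_right, ← hessXY_apply h.smooth_g,
    ← hessYY_apply h.smooth_g, h4, dirX, inner_sub_left]
  simp only [valueFun, gradX, ← hy]
  ring

theorem differentiable_valueFun : Differentiable ℝ (valueFun f g) :=
  fun x => (h.hasGradientAt_valueFun x).differentiableAt

theorem gradient_valueFun (x : Vec p) :
    gradient (valueFun f g) x = dirX f g x (lowerSol g x) (auxSol f g x) :=
  (h.hasGradientAt_valueFun x).gradient

/-- Composing the Lipschitz bounds gives (L_f + C_f L_gg/μ)(1 + L_g/μ)², which L_Φ need not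
dominate. Twice L_Φ does, because L_g ≥ μ, and α ≤ 1/(6L_Φ) leaves room for the factor 2. -/
theorem norm_gradient_valueFun_sub_le (hq : 0 < q) (x x' : Vec p) :
    ‖gradient (valueFun f g) x - gradient (valueFun f g) x'‖ ≤ 2 * c.LPhi * ‖x - x'‖ := by
  rw [h.gradient_valueFun, h.gradient_valueFun]
  have hg := c.Lgg_nonneg
  have hμ := h.μ_pos
  have h1 := h.norm_dirX_sub_le x x' (lowerSol g x) (lowerSol g x') (auxSol f g x) (auxSol f g x')
  have h2 := h.norm_pt_lowerSol_sub_le x x'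
  have h3 := h.norm_auxSol_sub_le x x'
  have h4 := h.norm_auxSol_le_div x
  have h5 : (c.Lf + c.Lgg * ‖auxSol f g x‖) * ‖pt (x - x') (lowerSol g x - lowerSol g x')‖
      + c.Lg * ‖auxSol f g x - auxSol f g x'‖ ≤
      (c.Lf + c.Lgg * (c.Cf / c.μ)) * ((1 + c.Lg / c.μ) * ‖x - x'‖)
        + c.Lg * (c.Cv * ‖x - x'‖) := by
    gcongr
  refine h1.trans (h5.trans ?_)
  have ha : 1 ≤ (c.Lg : ℝ) / c.μ := (one_le_div hμ).2 (h.μ_le_Lg hq)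
  set a : ℝ := c.Lg / c.μ with ha'
  have h6 : c.Lg * c.Cv = (c.Lf + c.Lgg * (c.Cf / c.μ)) * (1 + a) * a := by
    rw [Constants.Cv, ha']; field_simp
  have h7 : c.LPhi = c.Lf * (1 + a ^ 2) + c.Lgg * (c.Cf / c.μ) * (2 * a + a ^ 2)
      + (2 * c.Lf * c.Lgg + c.Cf ^ 2 * c.Lgg) / c.μ := by
    rw [Constants.LPhi, ha']; field_simp; ring
  have h8 : 0 ≤ (2 * c.Lf * c.Lgg + c.Cf ^ 2 * c.Lgg) / c.μ := by positivity
  have h9 : 0 ≤ c.Lgg * (c.Cf / c.μ) := by positivity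
  have h10 : (c.Lf + c.Lgg * (c.Cf / c.μ)) * (1 + a) + c.Lg * c.Cv ≤ 2 * c.LPhi := by
    rw [h6, h7]
    have e1 := mul_nonneg c.Lf.2 (sq_nonneg (1 - a))
    have e2 : 0 ≤ c.Lgg * (c.Cf / c.μ) * (a ^ 2 + 2 * a - 1) := mul_nonneg h9 (by nlinarith)
    change 0 ≤ (c.Lf : ℝ) * _ at e1
    linarith
  calc _ = ((c.Lf + c.Lgg * (c.Cf / c.μ)) * (1 + a) + c.Lg * c.Cv) * ‖x - x'‖ := by ring
    _ ≤ _ := by gcongr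

theorem valueFun_descent (hq : 0 < q) (x d : Vec p) :
    valueFun f g (x + d) ≤ valueFun f g x + ⟪gradient (valueFun f g) x, d⟫ + c.LPhi * ‖d‖ ^ 2 := by
  have := descent_of_lipschitz_gradient (L := 2 * c.LPhi)
    (fun x => (h.differentiable_valueFun x).hasGradientAt)
    (h.norm_gradient_valueFun_sub_le hq) x d
  linarith

end Regular

/-! ### Stochastic oracles and transfer of moments -/

/-- The arguments `(x, y, v)` of the search directions. -/
abbrev Args (p q : ℕ) := Vec p × Vec q × Vec q

/-- `D w` is an unbiased stochastic estimate of `Dbar` under `ν`, with variance at most `V` and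
Lipschitz in mean square for every realization, on the ball `‖v‖ ≤ M`. -/
structure IsOracle {p q n : ℕ} {W : Type*} [MeasurableSpace W] (ν : Measure W) (M A B V : ℝ)
    (D : W → Args p q → Vec n) (Dbar : Args p q → Vec n) : Prop where
  meas : Measurable (Function.uncurry D)
  meas_bar : Measurable Dbar
  lip : ∀ w u u', ‖u.2.2‖ ≤ M → ‖D w u - D w u'‖ ^ 2 ≤
    A * (‖u.1 - u'.1‖ ^ 2 + ‖u.2.1 - u'.2.1‖ ^ 2) + B * ‖u.2.2 - u'.2.2‖ ^ 2
  lip_bar : ∀ u u', ‖u.2.2‖ ≤ M → ‖Dbar u - Dbar u'‖ ^ 2 ≤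
    A * (‖u.1 - u'.1‖ ^ 2 + ‖u.2.1 - u'.2.1‖ ^ 2) + B * ‖u.2.2 - u'.2.2‖ ^ 2
  memLp : ∀ u, MemLp (fun w => D w u) 2 ν
  mean : ∀ u, ∫ w, D w u ∂ν = Dbar u
  var : ∀ u, ‖u.2.2‖ ≤ M → ∫ w, ‖D w u - Dbar u‖ ^ 2 ∂ν ≤ V

section Estimates

variable {Ξ W V E : Type*} [MeasurableSpace Ξ] [MeasurableSpace W]
  [NormedAddCommGroup V] [NormedSpace ℝ V] [NormedAddCommGroup E] [NormedSpace ℝ E]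
  {P : Measure Ξ} [IsProbabilityMeasure P] {ν : Measure W} {pr : W → Ξ}
  {X : Ξ → V} {m : V} {σ : ℝ}

theorem VarianceLe.memLp (hX : Unbiased P X m) (hσ : VarianceLe P X m σ) : MemLp X 2 P := by
  have h1 : MemLp (fun ξ => X ξ - m) 2 P :=
    (memLp_two_iff_integrable_sq_norm (hX.1.aestronglyMeasurable.sub aestronglyMeasurable_const)).2
      hσ.1
  simpa [Pi.add_def] using h1.add (memLp_const m)

theorem VarianceLe.memLp_comp (hX : Unbiased P X m) (hσ : VarianceLe P X m σ)
    (hpr : MeasurePreserving pr ν P) (T : V →L[ℝ] E) : MemLp (fun w => T (X (pr w))) 2 ν :=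
  T.comp_memLp' ((VarianceLe.memLp hX hσ).comp_measurePreserving hpr)

omit [IsProbabilityMeasure P] in
theorem Unbiased.integral_comp [CompleteSpace V] [CompleteSpace E] (hX : Unbiased P X m)
    (hpr : MeasurePreserving pr ν P) (T : V →L[ℝ] E) : ∫ w, T (X (pr w)) ∂ν = T m := by
  have h1 := integral_map hpr.measurable.aemeasurable
    (f := fun ξ => T (X ξ)) (hpr.map_eq ▸ (T.integrable_comp hX.1).aestronglyMeasurable)
  rw [← h1, hpr.map_eq, T.integral_comp_comm hX.1, hX.2]

omit [IsProbabilityMeasure P] [NormedSpace ℝ V] in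
theorem VarianceLe.comp (hσ : VarianceLe P X m σ)
    (hpr : MeasurePreserving pr ν P) : VarianceLe ν (fun w => X (pr w)) m σ := by
  refine ⟨(hpr.integrable_comp hσ.1.aestronglyMeasurable).2 hσ.1, ?_⟩
  have h1 := integral_map hpr.measurable.aemeasurable
    (f := fun ξ => ‖X ξ - m‖ ^ 2) (hpr.map_eq ▸ hσ.1.aestronglyMeasurable)
  rw [← h1, hpr.map_eq]
  exact hσ.2

-- The derivative is the pointwise limit of difference quotients along the steps 1/(n+1), each of
-- which is measurable.
omit [IsProbabilityMeasure P] in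
theorem measurable_of_hasDerivAt [MeasurableSpace V] [BorelSpace V] {φ : Ξ → ℝ → V} {φ' : Ξ → V}
    (hm : ∀ t, Measurable fun ξ => φ ξ t) [SecondCountableTopology V]
    (hd : ∀ ξ, HasDerivAt (φ ξ) (φ' ξ) 0) : Measurable φ' := by
  have hseq : Tendsto (fun n : ℕ => 1 / ((n : ℝ) + 1)) atTop (𝓝[≠] 0) :=
    tendsto_nhdsWithin_iff.2 ⟨tendsto_one_div_add_atTop_nhds_zero_nat,
      Eventually.of_forall fun n => (Nat.one_div_pos_of_nat (α := ℝ)).ne'⟩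
  refine measurable_of_tendsto_metrizable
    (f := fun (n : ℕ) ξ => (1 / ((n : ℝ) + 1))⁻¹ • (φ ξ (0 + 1 / ((n : ℝ) + 1)) - φ ξ 0))
    (fun n => ((hm _).sub (hm _)).const_smul _) ?_
  rw [tendsto_pi_nhds]
  exact fun ξ => (hasDerivAt_iff_tendsto_slope_zero.1 (hd ξ)).comp hseq

end Estimates

/-! ### Measurability of gradients and Hessians in the sample -/

section Measurability

variable {p q : ℕ} {Ξ : Type*} [MeasurableSpace Ξ] {H : Ξ → Joint p q → ℝ}

theorem measurable_inner_gradient (hm : ∀ z, Measurable fun ξ => H ξ z)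
    (hs : ∀ ξ, ContDiff ℝ 1 (H ξ)) (z d : Joint p q) :
    Measurable fun ξ => ⟪gradient (H ξ) z, d⟫ := by
  refine measurable_of_hasDerivAt (φ := fun ξ t => H ξ (z + t • d)) (fun t => hm _) fun ξ => ?_
  exact hasDerivAt_line_of_hasGradientAt (by
    simpa using hasGradientAt_of_contDiff (hs ξ) z)

theorem measurable_of_inner {n : ℕ} {X : Ξ → Vec n} (h : ∀ e, Measurable fun ξ => ⟪X ξ, e⟫) :
    Measurable X := by
  have h1 : X = fun ξ => ∑ i, ⟪X ξ, stdOrthonormalBasis ℝ (Vec n) i⟫ •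
      stdOrthonormalBasis ℝ (Vec n) i := by
    ext1 ξ
    rw [← (stdOrthonormalBasis ℝ (Vec n)).sum_repr' (X ξ)]
    simp only [real_inner_comm]
    rw [(stdOrthonormalBasis ℝ (Vec n)).sum_repr']
  rw [h1]
  exact Finset.measurable_sum _ fun i _ => (h _).smul_const _

theorem measurable_gradX (hm : ∀ z, Measurable fun ξ => H ξ z)
    (hs : ∀ ξ, ContDiff ℝ 1 (H ξ)) (z : Joint p q) : Measurable fun ξ => gradX (H ξ) z := by
  refine measurable_of_inner fun e => ?_
  have h1 := measurable_inner_gradient hm hs z (pt e 0)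
  simp only [inner_pt_right, inner_zero_right, add_zero] at h1
  exact h1

theorem measurable_gradY (hm : ∀ z, Measurable fun ξ => H ξ z)
    (hs : ∀ ξ, ContDiff ℝ 1 (H ξ)) (z : Joint p q) : Measurable fun ξ => gradY (H ξ) z := by
  refine measurable_of_inner fun e => ?_
  have h1 := measurable_inner_gradient hm hs z (pt 0 e)
  simp only [inner_pt_right, inner_zero_right, zero_add] at h1
  exact h1

theorem measurable_hessXY (hm : ∀ z, Measurable fun ξ => H ξ z)
    (hs : ∀ ξ, ContDiff ℝ 2 (H ξ)) (z : Joint p q) (v : Vec q) :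
    Measurable fun ξ => hessXY (H ξ) z v := by
  refine measurable_of_hasDerivAt (φ := fun ξ t => gradX (H ξ) (pt z.fst (z.snd + t • v)))
    (fun t => measurable_gradX hm (fun ξ => (hs ξ).of_le (by norm_num)) _) fun ξ => ?_
  have h2 : HasDerivAt (fun t : ℝ => z.snd + t • v) v 0 := by
    simpa using ((hasDerivAt_id (0 : ℝ)).smul_const v).const_add z.snd
  have h3 := hasFDerivAt_gradX (hs ξ) z.fst z.snd
  rw [pt_fst_snd] at h3
  exact HasFDerivAt.comp_hasDerivAt (0 : ℝ) (by simpa using h3) h2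

theorem measurable_hessYY (hm : ∀ z, Measurable fun ξ => H ξ z)
    (hs : ∀ ξ, ContDiff ℝ 2 (H ξ)) (z : Joint p q) (v : Vec q) :
    Measurable fun ξ => hessYY (H ξ) z v := by
  refine measurable_of_hasDerivAt (φ := fun ξ t => gradY (H ξ) (pt z.fst (z.snd + t • v)))
    (fun t => measurable_gradY hm (fun ξ => (hs ξ).of_le (by norm_num)) _) fun ξ => ?_
  have h2 : HasDerivAt (fun t : ℝ => z.snd + t • v) v 0 := by
    simpa using ((hasDerivAt_id (0 : ℝ)).smul_const v).const_add z.snd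
  have h3 := hasFDerivAt_gradY (hs ξ) z.fst z.snd
  rw [pt_fst_snd] at h3
  exact HasFDerivAt.comp_hasDerivAt (0 : ℝ) (by simpa using h3) h2

/-- Carathéodory functions are jointly measurable; this allows evaluation at random points. -/
theorem measurable_uncurry_swap {W : Type*} [MeasurableSpace W] {n : ℕ} {D : W → Args p q → Vec n}
    (hc : ∀ w, Continuous (D w)) (hm : ∀ u, Measurable fun w => D w u) :
    Measurable (Function.uncurry D) :=
  (measurable_uncurry_of_continuous_of_measurable (u := fun u w => D w u) hc hm).comp
    measurable_swap

end Measurability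

namespace Regular

variable {p q : ℕ} {c : Constants} {f g : Joint p q → ℝ} (h : Regular c f g)
include h

omit h in
theorem continuous_args_pt : Continuous fun u : Args p q => pt u.1 u.2.1 :=
  continuous_pt.comp (continuous_fst.prodMk (continuous_fst.comp continuous_snd))

theorem continuous_dirX : Continuous fun u : Args p q => dirX f g u.1 u.2.1 u.2.2 := by
  have h1 : Continuous (gradX f) :=
    (WithLp.fstL 2 ℝ (Vec p) (Vec q)).continuous.comp h.lip_f.lip_grad.continuous
  exact (h1.comp continuous_args_pt).sub
    ((h.lip_g.lip_hessXY.continuous.comp continuous_args_pt).clm_apply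
      (continuous_snd.comp continuous_snd))

theorem continuous_dirV : Continuous fun u : Args p q => dirV f g u.1 u.2.1 u.2.2 := by
  have h1 : Continuous (gradY f) :=
    (WithLp.sndL 2 ℝ (Vec p) (Vec q)).continuous.comp h.lip_f.lip_grad.continuous
  exact ((h.lip_g.lip_hessYY.continuous.comp continuous_args_pt).clm_apply
      (continuous_snd.comp continuous_snd)).sub (h1.comp continuous_args_pt)

theorem continuous_dirY : Continuous fun u : Args p q => dirY g u.1 u.2.1 := by
  have h1 : Continuous (gradY g) :=
    (WithLp.sndL 2 ℝ (Vec p) (Vec q)).continuous.comp h.lip_g.lip_grad.continuous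
  exact h1.comp continuous_args_pt

end Regular

/-! ### The three sampled directions are oracles -/

namespace Assumptions

variable {p q : ℕ} {Ξ Z : Type*} [MeasurableSpace Ξ] [MeasurableSpace Z]
    {P : Measure Ξ} [IsProbabilityMeasure P] {Q : Measure Z} [IsProbabilityMeasure Q]
    {F : Ξ → Joint p q → ℝ} {G : Z → Joint p q → ℝ} {c : Constants}
    (hA : Assumptions P Q F G c)
include hA

omit [IsProbabilityMeasure P] [IsProbabilityMeasure Q] in
theorem regular : Regular c (expected P F) (expected Q G) :=
  ⟨hA.smooth_f, hA.smooth_g, hA.μ_pos, hA.strong_g, hA.lip_f, hA.lip_g, hA.radius⟩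

omit [IsProbabilityMeasure P] [IsProbabilityMeasure Q] in
theorem regular_sample (ξ : Ξ) (ζ : Z) : Regular c (F ξ) (G ζ) :=
  ⟨hA.smooth_F ξ, hA.smooth_G ζ, hA.μ_pos, fun x => hA.strong_G x ζ, hA.lip_F ξ, hA.lip_G ζ,
    hA.radius⟩

variable {ν : Measure (Ξ × Z)} [IsProbabilityMeasure ν]

theorem isOracle_dirX (h1 : MeasurePreserving Prod.fst ν P) (h2 : MeasurePreserving Prod.snd ν Q) :
    IsOracle ν c.M c.M1 (2 * (c.Lg : ℝ) ^ 2) (2 * c.σf ^ 2 + 2 * c.M ^ 2 * c.σgxy ^ 2)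
      (fun w (u : Args p q) => dirX (F w.1) (G w.2) u.1 u.2.1 u.2.2)
      (fun u => dirX (expected P F) (expected Q G) u.1 u.2.1 u.2.2) where
  meas := by
    refine measurable_uncurry_swap (fun w => (hA.regular_sample w.1 w.2).continuous_dirX)
      fun u => ?_
    exact ((measurable_gradX hA.meas_F hA.smooth_F _).comp measurable_fst).sub
      ((measurable_hessXY hA.meas_G hA.smooth_G _ _).comp measurable_snd)
  meas_bar := hA.regular.continuous_dirX.measurable
  lip w u u' hu := (hA.regular_sample w.1 w.2).sq_norm_dirX_sub_le _ _ _ _ _ _ hu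
  lip_bar u u' hu := hA.regular.sq_norm_dirX_sub_le _ _ _ _ _ _ hu
  memLp u := by
    have e1 := VarianceLe.memLp_comp (hA.unbiased_F (pt u.1 u.2.1)) (hA.var_F _) h1
      (WithLp.fstL 2 ℝ (Vec p) (Vec q))
    have e2 := VarianceLe.memLp_comp (hA.unbiased_Gxy (pt u.1 u.2.1)) (hA.var_Gxy _) h2
      (ContinuousLinearMap.apply ℝ (Vec p) u.2.2)
    exact e1.sub e2
  mean u := by
    have e1 := VarianceLe.memLp_comp (hA.unbiased_F (pt u.1 u.2.1)) (hA.var_F _) h1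
      (WithLp.fstL 2 ℝ (Vec p) (Vec q))
    have e2 := VarianceLe.memLp_comp (hA.unbiased_Gxy (pt u.1 u.2.1)) (hA.var_Gxy _) h2
      (ContinuousLinearMap.apply ℝ (Vec p) u.2.2)
    have i1 := Unbiased.integral_comp (hA.unbiased_F (pt u.1 u.2.1)) h1
      (WithLp.fstL 2 ℝ (Vec p) (Vec q))
    have i2 := Unbiased.integral_comp (hA.unbiased_Gxy (pt u.1 u.2.1)) h2
      (ContinuousLinearMap.apply ℝ (Vec p) u.2.2)
    exact (integral_sub (e1.integrable one_le_two) (e2.integrable one_le_two)).trans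
      (congrArg₂ _ i1 i2)
  var u hu := by
    obtain ⟨a1, a2⟩ := VarianceLe.comp (hA.var_F (pt u.1 u.2.1)) h1
    obtain ⟨b1, b2⟩ := VarianceLe.comp (hA.var_Gxy (pt u.1 u.2.1)) h2
    -- The two components of a sample may be dependent, so the cross term need not vanish; it is
    -- absorbed by the factors 2.
    have e : ∀ w : Ξ × Z, ‖dirX (F w.1) (G w.2) u.1 u.2.1 u.2.2
        - dirX (expected P F) (expected Q G) u.1 u.2.1 u.2.2‖ ^ 2 ≤
        2 * ‖gradient (F w.1) (pt u.1 u.2.1) - gradient (expected P F) (pt u.1 u.2.1)‖ ^ 2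
        + 2 * c.M ^ 2 * ‖hessXY (G w.2) (pt u.1 u.2.1) - hessXY (expected Q G) (pt u.1 u.2.1)‖ ^ 2 :=
        fun w => by
      have k1 := norm_fst_le (gradient (F w.1) (pt u.1 u.2.1) - gradient (expected P F) (pt u.1 u.2.1))
      have k2 := ((hessXY (G w.2) (pt u.1 u.2.1)
        - hessXY (expected Q G) (pt u.1 u.2.1)).le_opNorm u.2.2).trans
          (mul_le_mul_of_nonneg_left hu (norm_nonneg _))
      have k3 : dirX (F w.1) (G w.2) u.1 u.2.1 u.2.2
        - dirX (expected P F) (expected Q G) u.1 u.2.1 u.2.2 =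
        (gradient (F w.1) (pt u.1 u.2.1) - gradient (expected P F) (pt u.1 u.2.1)).fst
        - (hessXY (G w.2) (pt u.1 u.2.1) - hessXY (expected Q G) (pt u.1 u.2.1)) u.2.2 := by
        simp only [dirX, gradX, WithLp.sub_fst, sub_apply]; abel
      rw [k3]
      have k4 := (norm_sub_le _ _).trans (add_le_add k1 k2)
      refine (pow_le_pow_left₀ (norm_nonneg _) k4 2).trans ?_
      refine (add_sq_le).trans_eq ?_
      ring
    refine (integral_mono_of_nonneg (Eventually.of_forall fun w => by positivity)
      ((a1.const_mul 2).add (b1.const_mul (2 * c.M ^ 2))) (Eventually.of_forall e)).trans ?_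
    refine (integral_add (a1.const_mul 2) (b1.const_mul (2 * c.M ^ 2))).trans_le ?_
    rw [integral_const_mul, integral_const_mul]
    gcongr

theorem isOracle_dirV (h1 : MeasurePreserving Prod.fst ν P) (h2 : MeasurePreserving Prod.snd ν Q) :
    IsOracle ν c.M c.M1 (2 * (c.Lg : ℝ) ^ 2) (2 * c.σf ^ 2 + 2 * c.M ^ 2 * c.σgyy ^ 2)
      (fun w (u : Args p q) => dirV (F w.1) (G w.2) u.1 u.2.1 u.2.2)
      (fun u => dirV (expected P F) (expected Q G) u.1 u.2.1 u.2.2) where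
  meas := by
    refine measurable_uncurry_swap (fun w => (hA.regular_sample w.1 w.2).continuous_dirV)
      fun u => ?_
    exact ((measurable_hessYY hA.meas_G hA.smooth_G _ _).comp measurable_snd).sub
      ((measurable_gradY hA.meas_F hA.smooth_F _).comp measurable_fst)
  meas_bar := hA.regular.continuous_dirV.measurable
  lip w u u' hu := (hA.regular_sample w.1 w.2).sq_norm_dirV_sub_le _ _ _ _ _ _ hu
  lip_bar u u' hu := hA.regular.sq_norm_dirV_sub_le _ _ _ _ _ _ hu
  memLp u := by
    have e1 := VarianceLe.memLp_comp (hA.unbiased_F (pt u.1 u.2.1)) (hA.var_F _) h1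
      (WithLp.sndL 2 ℝ (Vec p) (Vec q))
    have e2 := VarianceLe.memLp_comp (hA.unbiased_Gyy (pt u.1 u.2.1)) (hA.var_Gyy _) h2
      (ContinuousLinearMap.apply ℝ (Vec q) u.2.2)
    exact e2.sub e1
  mean u := by
    have e1 := VarianceLe.memLp_comp (hA.unbiased_F (pt u.1 u.2.1)) (hA.var_F _) h1
      (WithLp.sndL 2 ℝ (Vec p) (Vec q))
    have e2 := VarianceLe.memLp_comp (hA.unbiased_Gyy (pt u.1 u.2.1)) (hA.var_Gyy _) h2
      (ContinuousLinearMap.apply ℝ (Vec q) u.2.2)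
    have i1 := Unbiased.integral_comp (hA.unbiased_F (pt u.1 u.2.1)) h1
      (WithLp.sndL 2 ℝ (Vec p) (Vec q))
    have i2 := Unbiased.integral_comp (hA.unbiased_Gyy (pt u.1 u.2.1)) h2
      (ContinuousLinearMap.apply ℝ (Vec q) u.2.2)
    exact (integral_sub (e2.integrable one_le_two) (e1.integrable one_le_two)).trans
      (congrArg₂ _ i2 i1)
  var u hu := by
    obtain ⟨a1, a2⟩ := VarianceLe.comp (hA.var_F (pt u.1 u.2.1)) h1
    obtain ⟨b1, b2⟩ := VarianceLe.comp (hA.var_Gyy (pt u.1 u.2.1)) h2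
    have e : ∀ w : Ξ × Z, ‖dirV (F w.1) (G w.2) u.1 u.2.1 u.2.2
        - dirV (expected P F) (expected Q G) u.1 u.2.1 u.2.2‖ ^ 2 ≤
        2 * ‖gradient (F w.1) (pt u.1 u.2.1) - gradient (expected P F) (pt u.1 u.2.1)‖ ^ 2
        + 2 * c.M ^ 2 * ‖hessYY (G w.2) (pt u.1 u.2.1) - hessYY (expected Q G) (pt u.1 u.2.1)‖ ^ 2 :=
        fun w => by
      have k1 := norm_snd_le (gradient (F w.1) (pt u.1 u.2.1) - gradient (expected P F) (pt u.1 u.2.1))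
      have k2 := ((hessYY (G w.2) (pt u.1 u.2.1)
        - hessYY (expected Q G) (pt u.1 u.2.1)).le_opNorm u.2.2).trans
          (mul_le_mul_of_nonneg_left hu (norm_nonneg _))
      have k3 : dirV (F w.1) (G w.2) u.1 u.2.1 u.2.2
        - dirV (expected P F) (expected Q G) u.1 u.2.1 u.2.2 =
        (hessYY (G w.2) (pt u.1 u.2.1) - hessYY (expected Q G) (pt u.1 u.2.1)) u.2.2
        - (gradient (F w.1) (pt u.1 u.2.1) - gradient (expected P F) (pt u.1 u.2.1)).snd := by
        simp only [dirV, gradY, WithLp.sub_snd, sub_apply]; abel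
      rw [k3]
      have k4 := (norm_sub_le _ _).trans (add_le_add k2 k1)
      refine (pow_le_pow_left₀ (norm_nonneg _) k4 2).trans ?_
      refine (add_sq_le).trans_eq ?_
      ring
    refine (integral_mono_of_nonneg (Eventually.of_forall fun w => by positivity)
      ((a1.const_mul 2).add (b1.const_mul (2 * c.M ^ 2))) (Eventually.of_forall e)).trans ?_
    refine (integral_add (a1.const_mul 2) (b1.const_mul (2 * c.M ^ 2))).trans_le ?_
    rw [integral_const_mul, integral_const_mul]
    gcongr

omit [IsProbabilityMeasure ν] in
theorem isOracle_dirY (h2 : MeasurePreserving Prod.snd ν Q) :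
    IsOracle ν c.M ((c.Lg : ℝ) ^ 2) 0 (c.σg ^ 2)
      (fun w (u : Args p q) => dirY (G w.2) u.1 u.2.1)
      (fun u => dirY (expected Q G) u.1 u.2.1) where
  meas := by
    have ⟨ξ⟩ : Nonempty Ξ := P.nonempty_of_neZero
    refine measurable_uncurry_swap (fun w => (hA.regular_sample ξ w.2).continuous_dirY)
      fun u => ?_
    exact (measurable_gradY hA.meas_G (fun ζ => (hA.smooth_G ζ).of_le (by norm_num)) _).comp
      measurable_snd
  meas_bar := hA.regular.continuous_dirY.measurable
  lip w u u' _ := by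
    simpa using (hA.regular_sample w.1 w.2).sq_norm_dirY_sub_le u.1 u'.1 u.2.1 u'.2.1
  lip_bar u u' _ := by
    simpa using hA.regular.sq_norm_dirY_sub_le u.1 u'.1 u.2.1 u'.2.1
  memLp u := VarianceLe.memLp_comp (hA.unbiased_G (pt u.1 u.2.1)) (hA.var_G _) h2
    (WithLp.sndL 2 ℝ (Vec p) (Vec q))
  mean u := Unbiased.integral_comp (hA.unbiased_G (pt u.1 u.2.1)) h2
    (WithLp.sndL 2 ℝ (Vec p) (Vec q))
  var u _ := by
    obtain ⟨a1, a2⟩ := VarianceLe.comp (hA.var_G (pt u.1 u.2.1)) h2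
    refine (integral_mono_of_nonneg (Eventually.of_forall fun w => by positivity)
      a1 (Eventually.of_forall fun w => ?_)).trans a2
    exact pow_le_pow_left₀ (norm_nonneg _) (norm_snd_le
      (gradient (G w.2) (pt u.1 u.2.1) - gradient (expected Q G) (pt u.1 u.2.1))) 2

end Assumptions

/-! ### Adapted square integrable vectors and orthogonality -/

section L2

variable {Ω : Type*} {m m' : MeasurableSpace Ω} [m0 : MeasurableSpace Ω] {n : ℕ}

/-- A square integrable random vector that is measurable with respect to `m`. -/
structure L2Adapted (Pr : Measure Ω) (m : MeasurableSpace Ω) (f : Ω → Vec n) : Prop where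
  meas : Measurable[m] f
  memLp : MemLp f 2 Pr

namespace L2Adapted

variable {Pr : Measure Ω} {f f' : Ω → Vec n}

theorem mono (h : L2Adapted Pr m f) (hm : m ≤ m') : L2Adapted Pr m' f :=
  ⟨h.meas.mono hm le_rfl, h.memLp⟩

theorem add (h : L2Adapted Pr m f) (h' : L2Adapted Pr m f') :
    L2Adapted Pr m (fun ω => f ω + f' ω) := ⟨h.meas.add h'.meas, h.memLp.add h'.memLp⟩

theorem sub (h : L2Adapted Pr m f) (h' : L2Adapted Pr m f') :
    L2Adapted Pr m (fun ω => f ω - f' ω) := ⟨h.meas.sub h'.meas, h.memLp.sub h'.memLp⟩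

theorem const_smul (h : L2Adapted Pr m f) (c : ℝ) :
    L2Adapted Pr m (fun ω => c • f ω) := ⟨h.meas.const_smul c, h.memLp.const_smul c⟩

theorem const [IsFiniteMeasure Pr] (v : Vec n) : L2Adapted Pr m (fun _ => v) :=
  ⟨measurable_const, memLp_const v⟩

theorem sum {f : ℕ → Ω → Vec n} {S : ℕ} (h : ∀ i < S, L2Adapted Pr m (f i)) :
    L2Adapted Pr m (fun ω => ∑ i ∈ Finset.range S, f i ω) :=
  ⟨Finset.measurable_sum _ fun i hi => (h i (Finset.mem_range.1 hi)).meas,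
    memLp_finsetSum _ fun i hi => (h i (Finset.mem_range.1 hi)).memLp⟩

theorem integrable_sq (h : L2Adapted Pr m f) : Integrable (fun ω => ‖f ω‖ ^ 2) Pr :=
  (memLp_two_iff_integrable_sq_norm h.memLp.1).1 h.memLp

end L2Adapted

variable {Pr : Measure Ω}

theorem integrable_sq_of_memLp {f : Ω → Vec n} (h : MemLp f 2 Pr) :
    Integrable (fun ω => ‖f ω‖ ^ 2) Pr :=
  (memLp_two_iff_integrable_sq_norm h.1).1 h

theorem memLp_of_sq_le {f : Ω → Vec n} (hf : AEStronglyMeasurable f Pr) {b : Ω → ℝ}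
    (hb : Integrable b Pr) (h : ∀ ω, ‖f ω‖ ^ 2 ≤ b ω) : MemLp f 2 Pr := by
  refine (memLp_two_iff_integrable_sq_norm hf).2 (hb.mono' (hf.norm.pow 2) ?_)
  exact Eventually.of_forall fun ω => by
    rw [Real.norm_of_nonneg (by positivity)]; exact h ω

theorem integrable_inner_of_memLp {f f' : Ω → Vec n} (h : MemLp f 2 Pr) (h' : MemLp f' 2 Pr) :
    Integrable (fun ω => ⟪f ω, f' ω⟫) Pr := by
  have e : (fun ω => ⟪f ω, f' ω⟫) =
      fun ω => (1 / 2 : ℝ) * (‖f ω + f' ω‖ ^ 2 - ‖f ω‖ ^ 2 - ‖f' ω‖ ^ 2) := by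
    ext1 ω
    rw [norm_add_sq_real]
    ring
  rw [e]
  exact (((integrable_sq_of_memLp (h.add h')).sub (integrable_sq_of_memLp h)).sub
    (integrable_sq_of_memLp h')).const_mul _

variable [IsProbabilityMeasure Pr] {W 𝒰 : Type*} [MeasurableSpace W] [MeasurableSpace 𝒰]
  {s : Ω → W}

theorem map_prod_of_indep (hm : m ≤ m0) (hs : Measurable s)
    (hind : Indep m (MeasurableSpace.comap s inferInstance) Pr) {X : Ω → 𝒰} (hX : Measurable[m] X) :
    Pr.map (fun ω => (X ω, s ω)) = (Pr.map X).prod (Pr.map s) := by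
  refine (indepFun_iff_map_prod_eq_prod_map_map (hX.mono hm le_rfl).aemeasurable
    hs.aemeasurable).1 ?_
  rw [IndepFun_iff_Indep]
  exact indep_of_indep_of_le_left hind hX.comap_le

/-- Independence makes the joint law of the past and the new sample a product; by Fubini the
integral over the sample comes first and vanishes. This replaces conditional expectations. -/
theorem integral_inner_eq_zero (hm : m ≤ m0) (hs : Measurable s)
    (hind : Indep m (MeasurableSpace.comap s inferInstance) Pr) {N : W → 𝒰 → Vec n}
    (hN : Measurable (Function.uncurry N)) (hint : ∀ u, Integrable (fun w => N w u) (Pr.map s))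
    (h0 : ∀ u, ∫ w, N w u ∂(Pr.map s) = 0) {a : Ω → Vec n} {u : Ω → 𝒰} (ha : Measurable[m] a)
    (hu : Measurable[m] u) (hI : Integrable (fun ω => ⟪a ω, N (s ω) (u ω)⟫) Pr) :
    ∫ ω, ⟪a ω, N (s ω) (u ω)⟫ ∂Pr = 0 := by
  have hX : Measurable[m] fun ω => (a ω, u ω) := ha.prodMk hu
  have hmap := map_prod_of_indep hm hs hind hX
  have hXs : Measurable fun ω => ((a ω, u ω), s ω) := (hX.mono hm le_rfl).prodMk hs
  set φ : (Vec n × 𝒰) × W → ℝ := fun z => ⟪z.1.1, N z.2 z.1.2⟫ with hφ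
  have hφm : Measurable φ :=
    (measurable_fst.comp measurable_fst).inner
      (hN.comp (measurable_snd.prodMk (measurable_snd.comp measurable_fst)))
  have hφi : Integrable φ (Pr.map fun ω => ((a ω, u ω), s ω)) :=
    (integrable_map_measure hφm.aestronglyMeasurable hXs.aemeasurable).2 hI
  have e : ∫ ω, φ ((a ω, u ω), s ω) ∂Pr = ∫ z, φ z ∂(Pr.map fun ω => ((a ω, u ω), s ω)) :=
    (integral_map hXs.aemeasurable hφm.aestronglyMeasurable).symm
  have : IsProbabilityMeasure (Pr.map s) := Measure.isProbabilityMeasure_map hs.aemeasurable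
  have : IsProbabilityMeasure (Pr.map fun ω => (a ω, u ω)) :=
    Measure.isProbabilityMeasure_map (hX.mono hm le_rfl).aemeasurable
  refine e.trans ?_
  rw [hmap] at hφi ⊢
  rw [integral_prod _ hφi]
  refine integral_eq_zero_of_ae (Eventually.of_forall fun z => ?_)
  have h1 := (innerSL ℝ z.1).integral_comp_comm (hint z.2)
  rw [h0, map_zero] at h1
  exact h1

/-- Pythagoras: the noise is centered given the past, hence orthogonal to everything determined by
the past. -/
theorem integral_sq_norm_add (hm : m ≤ m0) (hs : Measurable s)
    (hind : Indep m (MeasurableSpace.comap s inferInstance) Pr) {N : W → 𝒰 → Vec n}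
    (hN : Measurable (Function.uncurry N)) (hint : ∀ u, Integrable (fun w => N w u) (Pr.map s))
    (h0 : ∀ u, ∫ w, N w u ∂(Pr.map s) = 0) {a : Ω → Vec n} {u : Ω → 𝒰} (ha : L2Adapted Pr m a)
    (hu : Measurable[m] u) (hNu : MemLp (fun ω => N (s ω) (u ω)) 2 Pr) (b : ℝ) :
    ∫ ω, ‖a ω + b • N (s ω) (u ω)‖ ^ 2 ∂Pr =
      ∫ ω, ‖a ω‖ ^ 2 ∂Pr + b ^ 2 * ∫ ω, ‖N (s ω) (u ω)‖ ^ 2 ∂Pr := by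
  have hI := integrable_inner_of_memLp ha.memLp hNu
  have h1 := integral_inner_eq_zero hm hs hind hN hint h0 ha.meas hu hI
  have e : ∀ ω, ‖a ω + b • N (s ω) (u ω)‖ ^ 2 =
      ‖a ω‖ ^ 2 + (2 * b * ⟪a ω, N (s ω) (u ω)⟫ + b ^ 2 * ‖N (s ω) (u ω)‖ ^ 2) := fun ω => by
    rw [norm_add_sq_real, inner_smul_right, norm_smul, mul_pow, Real.norm_eq_abs, sq_abs]
    ring
  simp_rw [e]
  have i3 := (integrable_sq_of_memLp hNu).const_mul (b ^ 2)
  refine (integral_add ha.integrable_sq ((hI.const_mul (2 * b)).add i3)).trans ?_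
  have k := integral_add (hI.const_mul (2 * b)) i3
  rw [integral_const_mul, integral_const_mul, h1, mul_zero, zero_add] at k
  exact congrArg _ k

end L2

/-! ### The σ-algebras of past samples and the variance of batches -/

section History

variable {Ω W ι : Type*} [m0 : MeasurableSpace Ω] [MeasurableSpace W] {Pr : Measure Ω}
  {smp : ι → Ω → W}

/-- The σ-algebra generated by the samples with labels in `D`. -/
@[reducible] def hist (smp : ι → Ω → W) (D : Set ι) : MeasurableSpace Ω :=
  ⨆ d ∈ D, MeasurableSpace.comap (smp d) inferInstance

omit m0 in
theorem hist_mono {D D' : Set ι} (h : D ⊆ D') : hist smp D ≤ hist smp D' :=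
  biSup_mono h

theorem hist_le (hm : ∀ d, Measurable (smp d)) (D : Set ι) : hist smp D ≤ m0 :=
  iSup₂_le fun d _ => (hm d).comap_le

omit m0 in
theorem measurable_hist {D : Set ι} {d : ι} (hd : d ∈ D) : Measurable[hist smp D] (smp d) :=
  (comap_measurable (smp d)).mono
    (le_iSup₂ (f := fun d (_ : d ∈ D) => MeasurableSpace.comap (smp d) inferInstance) d hd) le_rfl

theorem indep_hist (hm : ∀ d, Measurable (smp d)) (hi : iIndepFun smp Pr) {D : Set ι} {d : ι}
    (hd : d ∉ D) : Indep (hist smp D) (MeasurableSpace.comap (smp d) inferInstance) Pr := by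
  have h1 := indep_iSup_of_disjoint (fun d => (hm d).comap_le) ((iIndepFun_iff_iIndep _ _ _).1 hi)
    (S := D) (T := {d}) (by simpa using hd)
  simpa [hist] using h1

variable [IsProbabilityMeasure Pr] {n : ℕ} {𝒰 : Type*} [MeasurableSpace 𝒰]

/-- Adding the average of a batch of conditionally centered terms increases the mean square by at
most the variance of one term divided by the size of the batch. -/
theorem integral_sq_norm_add_batch (hm : ∀ d, Measurable (smp d)) (hi : iIndepFun smp Pr)
    {D : Set ι} {d : ℕ → ι} (hinj : Function.Injective d) (hd : ∀ i, d i ∉ D) {N : W → 𝒰 → Vec n}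
    (hN : Measurable (Function.uncurry N))
    (hint : ∀ i u, Integrable (fun w => N w u) (Pr.map (smp (d i))))
    (h0 : ∀ i u, ∫ w, N w u ∂(Pr.map (smp (d i))) = 0) {a : Ω → Vec n} {u : Ω → 𝒰}
    (ha : L2Adapted Pr (hist smp D) a) (hu : Measurable[hist smp D] u)
    (hNu : ∀ i, MemLp (fun ω => N (smp (d i) ω) (u ω)) 2 Pr) {v : ℝ}
    (hv : ∀ i, ∫ ω, ‖N (smp (d i) ω) (u ω)‖ ^ 2 ∂Pr ≤ v) (b : ℝ) (S : ℕ) :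
    L2Adapted Pr (hist smp (D ∪ d '' Set.Iio S))
        (fun ω => a ω + b • ∑ i ∈ Finset.range S, N (smp (d i) ω) (u ω)) ∧
      ∫ ω, ‖a ω + b • ∑ i ∈ Finset.range S, N (smp (d i) ω) (u ω)‖ ^ 2 ∂Pr ≤
        ∫ ω, ‖a ω‖ ^ 2 ∂Pr + S * (b ^ 2 * v) := by
  induction S with
  | zero =>
    simp only [Finset.range_zero, Finset.sum_empty, smul_zero, add_zero, Nat.cast_zero, zero_mul]
    exact ⟨ha.mono (hist_mono Set.subset_union_left), le_rfl⟩
  | succ S ih =>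
    have e : (fun ω => a ω + b • ∑ i ∈ Finset.range (S + 1), N (smp (d i) ω) (u ω)) =
        fun ω => (a ω + b • ∑ i ∈ Finset.range S, N (smp (d i) ω) (u ω)) +
          b • N (smp (d S) ω) (u ω) := by
      ext1 ω
      rw [Finset.sum_range_succ, smul_add, add_assoc]
    have hsub : D ∪ d '' Set.Iio S ⊆ D ∪ d '' Set.Iio (S + 1) :=
      Set.union_subset_union_right _ (Set.image_mono (Set.Iio_subset_Iio (Nat.le_succ S)))
    -- Distinct labels make each sample of the batch independent of the past together with the
    -- earlier samples of the same batch, so the terms can be added one at a time.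
    have hnot : d S ∉ D ∪ d '' Set.Iio S := by
      rintro (h | ⟨i, hi, h⟩)
      · exact hd S h
      · exact (ne_of_lt hi) (hinj h)
    refine ⟨?_, ?_⟩
    · rw [e]
      have hmem : d S ∈ D ∪ d '' Set.Iio (S + 1) := Or.inr ⟨S, Nat.lt_succ_self S, rfl⟩
      have hu' : Measurable[hist smp (D ∪ d '' Set.Iio (S + 1))] u :=
        hu.mono (hist_mono Set.subset_union_left) le_rfl
      have hNm : Measurable[hist smp (D ∪ d '' Set.Iio (S + 1))]
          fun ω => N (smp (d S) ω) (u ω) := hN.comp ((measurable_hist hmem).prodMk hu')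
      exact (ih.1.mono (hist_mono hsub)).add (L2Adapted.const_smul ⟨hNm, hNu S⟩ b)
    · have h1 := integral_sq_norm_add (hist_le hm _) (hm (d S)) (indep_hist hm hi hnot) hN
        (hint S) (h0 S) ih.1 (hu.mono (hist_mono Set.subset_union_left) le_rfl) (hNu S) b
      have h2 : ∫ ω, ‖a ω + b • ∑ i ∈ Finset.range (S + 1), N (smp (d i) ω) (u ω)‖ ^ 2 ∂Pr =
          ∫ ω, ‖(a ω + b • ∑ i ∈ Finset.range S, N (smp (d i) ω) (u ω)) +
          b • N (smp (d S) ω) (u ω)‖ ^ 2 ∂Pr :=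
        congrArg (fun f : Ω → Vec n => ∫ ω, ‖f ω‖ ^ 2 ∂Pr) e
      rw [h2, h1]
      have h3 := mul_le_mul_of_nonneg_left (hv S) (sq_nonneg b)
      push_cast
      linarith [ih.2]

end History

/-! ### Mean squared errors of large batches and of SPIDER steps -/

namespace IsOracle

variable {p q n : ℕ} {Ω W ι : Type*} {m m' : MeasurableSpace Ω} [m0 : MeasurableSpace Ω] [MeasurableSpace W] {Pr : Measure Ω}
  {M A B V : ℝ} {D : W → Args p q → Vec n} {Dbar : Args p q → Vec n}

/-- A square integrable point at which the search directions are evaluated. -/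
structure Point (Pr : Measure Ω) (m : MeasurableSpace Ω) (M : ℝ) (u : Ω → Args p q) : Prop where
  x : @L2Adapted Ω m0 p Pr m fun ω => (u ω).1
  y : @L2Adapted Ω m0 q Pr m fun ω => (u ω).2.1
  v : @L2Adapted Ω m0 q Pr m fun ω => (u ω).2.2
  norm_le : ∀ ω, ‖(u ω).2.2‖ ≤ M

namespace Point

variable {u u' : Ω → Args p q}

theorem meas (h : Point Pr m M u) : Measurable[m] u :=
  h.x.meas.prodMk (h.y.meas.prodMk h.v.meas)

theorem mono (h : Point Pr m M u) (hm : m ≤ m') : Point Pr m' M u :=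
  ⟨h.x.mono hm, h.y.mono hm, h.v.mono hm, h.norm_le⟩

theorem const [IsFiniteMeasure Pr] (u : Args p q) (h : ‖u.2.2‖ ≤ M) : Point Pr m M fun _ => u :=
  ⟨L2Adapted.const u.1, L2Adapted.const u.2.1, L2Adapted.const u.2.2, fun _ => h⟩

theorem zero_le [IsProbabilityMeasure Pr] (h : Point Pr m M u) :
    ‖(0 : Args p q).2.2‖ ≤ M := by
  have ⟨ω⟩ : Nonempty Ω := Pr.nonempty_of_neZero
  simpa using (norm_nonneg _).trans (h.norm_le ω)

/-- The weighted squared distance of two points. -/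
noncomputable def sqDist (A B : ℝ) (u u' : Args p q) : ℝ :=
  A * (‖u.1 - u'.1‖ ^ 2 + ‖u.2.1 - u'.2.1‖ ^ 2) + B * ‖u.2.2 - u'.2.2‖ ^ 2

theorem integrable_sqDist (h : Point Pr m M u) (h' : Point Pr m M u') :
    Integrable (fun ω => sqDist A B (u ω) (u' ω)) Pr :=
  (((h.x.sub h'.x).integrable_sq.add (h.y.sub h'.y).integrable_sq).const_mul A).add
    ((h.v.sub h'.v).integrable_sq.const_mul B)

end Point

open Point

variable [IsProbabilityMeasure Pr] {s : Ω → W} {u u' : Ω → Args p q}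

/-- The Lipschitz bound compares the value at the random point with the value at 0, which is square
integrable by assumption. -/
theorem memLp_comp (hs : Measurable s) (hO : IsOracle (Pr.map s) M A B V D Dbar) (hm : m ≤ m0)
    (hu : Point Pr m M u) : MemLp (fun ω => D (s ω) (u ω)) 2 Pr := by
  have h0 : Point Pr m M fun _ => (0 : Args p q) :=
    Point.const 0 (hu.zero_le)
  have h1 : MemLp (fun ω => D (s ω) 0) 2 Pr :=
    (hO.memLp 0).comp_measurePreserving ⟨hs, rfl⟩
  have h2 : Measurable fun ω => D (s ω) (u ω) :=
    hO.meas.comp (hs.prodMk (hu.meas.mono hm le_rfl))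
  have h3 : MemLp (fun ω => D (s ω) (u ω) - D (s ω) 0) 2 Pr :=
    memLp_of_sq_le (h2.aestronglyMeasurable.sub h1.1) (hu.integrable_sqDist h0 (A := A) (B := B))
      fun ω => hO.lip _ _ _ (hu.norm_le ω)
  simpa [Pi.add_def] using h3.add h1

theorem memLp_bar {ν : Measure W} (hO : IsOracle ν M A B V D Dbar) (hm : m ≤ m0)
    (hu : Point Pr m M u) : MemLp (fun ω => Dbar (u ω)) 2 Pr := by
  have h0 : Point Pr m M fun _ => (0 : Args p q) :=
    Point.const 0 (hu.zero_le)
  have h1 : MemLp (fun _ : Ω => Dbar 0) 2 Pr := memLp_const _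
  have h2 : Measurable fun ω => Dbar (u ω) := hO.meas_bar.comp (hu.meas.mono hm le_rfl)
  have h3 : MemLp (fun ω => Dbar (u ω) - Dbar 0) 2 Pr :=
    memLp_of_sq_le (h2.aestronglyMeasurable.sub h1.1) (hu.integrable_sqDist h0 (A := A) (B := B))
      fun ω => hO.lip_bar _ _ (hu.norm_le ω)
  simpa [Pi.add_def] using h3.add h1

theorem adapted_bar {ν : Measure W} (hO : IsOracle ν M A B V D Dbar) (hm : m ≤ m0)
    (hu : Point Pr m M u) : L2Adapted Pr m (fun ω => Dbar (u ω)) :=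
  ⟨hO.meas_bar.comp hu.meas, hO.memLp_bar hm hu⟩

theorem integrable (hs : Measurable s) (hO : IsOracle (Pr.map s) M A B V D Dbar) (u : Args p q) :
    Integrable (fun w => D w u) (Pr.map s) :=
  have := Measure.isProbabilityMeasure_map (μ := Pr) hs.aemeasurable
  (hO.memLp u).integrable one_le_two

/-- By independence the sample may be integrated out with the point frozen. The variance bound holds
only in the ball, which carries the whole law of `u`. -/
theorem integral_sq_dev_le (hs : Measurable s) (hO : IsOracle (Pr.map s) M A B V D Dbar)
    (hm : m ≤ m0) (hind : Indep m (MeasurableSpace.comap s inferInstance) Pr)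
    (hu : Point Pr m M u) : ∫ ω, ‖D (s ω) (u ω) - Dbar (u ω)‖ ^ 2 ∂Pr ≤ V := by
  have hmap := map_prod_of_indep hm hs hind hu.meas
  have hus : Measurable fun ω => (u ω, s ω) := (hu.meas.mono hm le_rfl).prodMk hs
  set φ : Args p q × W → ℝ := fun z => ‖D z.2 z.1 - Dbar z.1‖ ^ 2 with hφ
  have hφm : Measurable φ :=
    ((hO.meas.comp measurable_swap).sub (hO.meas_bar.comp measurable_fst)).norm.pow_const 2
  have hI : Integrable (fun ω => φ (u ω, s ω)) Pr :=
    integrable_sq_of_memLp ((hO.memLp_comp hs hm hu).sub (hO.memLp_bar hm hu))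
  have hφi := (integrable_map_measure hφm.aestronglyMeasurable hus.aemeasurable).2 hI
  have e : ∫ ω, φ (u ω, s ω) ∂Pr = ∫ z, φ z ∂(Pr.map fun ω => (u ω, s ω)) :=
    (integral_map hus.aemeasurable hφm.aestronglyMeasurable).symm
  have : IsProbabilityMeasure (Pr.map s) := Measure.isProbabilityMeasure_map hs.aemeasurable
  have : IsProbabilityMeasure (Pr.map u) :=
    Measure.isProbabilityMeasure_map (hu.meas.mono hm le_rfl).aemeasurable
  refine e.trans_le ?_
  rw [hmap] at hφi ⊢
  rw [integral_prod _ hφi]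
  have hset : MeasurableSet {u : Args p q | ‖u.2.2‖ ≤ M} :=
    measurableSet_le (measurable_snd.comp measurable_snd).norm measurable_const
  have hae : ∀ᵐ u ∂(Pr.map u), ∫ w, φ (u, w) ∂(Pr.map s) ≤ V := by
    have : ∀ᵐ u ∂(Pr.map u), ‖u.2.2‖ ≤ M :=
      (ae_map_iff (hu.meas.mono hm le_rfl).aemeasurable hset).2 (Eventually.of_forall hu.norm_le)
    filter_upwards [this] with u hu using hO.var u hu
  refine (integral_mono_ae hφi.integral_prod_left (integrable_const V) hae).trans_eq ?_
  simp

variable {smp : ι → Ω → W} {H H' : Set ι} {d : ℕ → ι}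

theorem adapted_comp (hm : ∀ d, Measurable (smp d)) {d : ι}
    (hO : IsOracle (Pr.map (smp d)) M A B V D Dbar) (hd : d ∈ H)
    (hu : Point Pr (hist smp H) M u) : L2Adapted Pr (hist smp H) fun ω => D (smp d ω) (u ω) :=
  ⟨hO.meas.comp ((measurable_hist hd).prodMk hu.meas), hO.memLp_comp (hm d) (hist_le hm _) hu⟩

theorem adapted_batchMean (hm : ∀ d, Measurable (smp d))
    (hO : ∀ i, IsOracle (Pr.map (smp (d i))) M A B V D Dbar) (hd : ∀ i, d i ∈ H)
    (hu : Point Pr (hist smp H) M u) (S : ℕ) :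
    L2Adapted Pr (hist smp H) fun ω => batchMean S (fun i => smp (d i) ω) fun w => D w (u ω) :=
  (L2Adapted.sum fun i _ => (hO i).adapted_comp hm (hd i) hu).const_smul _

/-- The error of a large batch. -/
theorem integral_sq_batchMean_le (hm : ∀ d, Measurable (smp d)) (hi : iIndepFun smp Pr)
    (hinj : Function.Injective d) (hd : ∀ i, d i ∉ H)
    (hO : ∀ i, IsOracle (Pr.map (smp (d i))) M A B V D Dbar)
    (hu : Point Pr (hist smp H) M u) {S : ℕ} (hS : 0 < S) :
    ∫ ω, ‖(batchMean S (fun i => smp (d i) ω) fun w => D w (u ω)) - Dbar (u ω)‖ ^ 2 ∂Pr ≤ V / S := by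
  have hS' : (S : ℝ) ≠ 0 := by positivity
  have hpr : ∀ i, IsProbabilityMeasure (Pr.map (smp (d i))) := fun i =>
    Measure.isProbabilityMeasure_map (hm _).aemeasurable
  have h1 := (integral_sq_norm_add_batch hm hi hinj hd (N := fun w u => D w u - Dbar u)
    ((hO 0).meas.sub ((hO 0).meas_bar.comp measurable_snd))
    (fun i u => ((hO i).integrable (hm _) u).sub (integrable_const _))
    (fun i u => by
      rw [integral_sub ((hO i).integrable (hm _) u) (integrable_const _), (hO i).mean]
      simp)
    (L2Adapted.const (0 : Vec n)) hu.meas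
    (fun i => ((hO i).memLp_comp (hm _) (hist_le hm _) hu).sub
      ((hO i).memLp_bar (hist_le hm _) hu))
    (fun i => (hO i).integral_sq_dev_le (hm _) (hist_le hm _) (indep_hist hm hi (hd i)) hu)
    (S : ℝ)⁻¹ S).2
  have e : ∀ ω, (batchMean S (fun i => smp (d i) ω) fun w => D w (u ω)) - Dbar (u ω) =
      0 + (S : ℝ)⁻¹ • ∑ i ∈ Finset.range S, (D (smp (d i) ω) (u ω) - Dbar (u ω)) := fun ω => by
    rw [Finset.sum_sub_distrib, Finset.sum_const, Finset.card_range, smul_sub, zero_add,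
      ← Nat.cast_smul_eq_nsmul ℝ, smul_smul, inv_mul_cancel₀ hS', one_smul, batchMean]
  simp_rw [e]
  refine h1.trans_eq ?_
  simp only [norm_zero, ne_eq, OfNat.ofNat_ne_zero, not_false_eq_true, zero_pow, integral_zero]
  field_simp
  ring

/-- The error recursion of the SPIDER estimator. -/
theorem integral_sq_spider_le (hm : ∀ d, Measurable (smp d)) (hi : iIndepFun smp Pr)
    (hinj : Function.Injective d) (hd : ∀ i, d i ∉ H)
    (hO : ∀ i, IsOracle (Pr.map (smp (d i))) M A B V D Dbar)
    (hu : Point Pr (hist smp H) M u) (hu' : Point Pr (hist smp H) M u') {E : Ω → Vec n}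
    (hE : L2Adapted Pr (hist smp H) E) {S : ℕ} (hS : 0 < S) :
    ∫ ω, ‖(batchMean S (fun i => smp (d i) ω) fun w => D w (u' ω)) + (1 - (0 : ℝ)) • (E ω -
        batchMean S (fun i => smp (d i) ω) fun w => D w (u ω)) - Dbar (u' ω)‖ ^ 2 ∂Pr ≤
      ∫ ω, ‖E ω - Dbar (u ω)‖ ^ 2 ∂Pr + (∫ ω, sqDist A B (u' ω) (u ω) ∂Pr) / S := by
  have hS' : (S : ℝ) ≠ 0 := by positivity
  have hpr : ∀ i, IsProbabilityMeasure (Pr.map (smp (d i))) := fun i =>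
    Measure.isProbabilityMeasure_map (hm _).aemeasurable
  -- The noise of a SPIDER step is that of the difference D(u') - D(u) on a common sample. The new
  -- error is the old one plus the batch average of this centered term.
  set N : W → Args p q × Args p q → Vec n :=
    fun w z => (D w z.2 - D w z.1) - (Dbar z.2 - Dbar z.1) with hNdef
  have hN : Measurable (Function.uncurry N) := by
    have e1 : Measurable fun z : W × Args p q × Args p q => D z.1 z.2.2 :=
      (hO 0).meas.comp (measurable_fst.prodMk (measurable_snd.comp measurable_snd))
    have e2 : Measurable fun z : W × Args p q × Args p q => D z.1 z.2.1 :=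
      (hO 0).meas.comp (measurable_fst.prodMk (measurable_fst.comp measurable_snd))
    exact (e1.sub e2).sub (((hO 0).meas_bar.comp (measurable_snd.comp measurable_snd)).sub
      ((hO 0).meas_bar.comp (measurable_fst.comp measurable_snd)))
  have hint : ∀ i z, Integrable (fun w => N w z) (Pr.map (smp (d i))) := fun i z =>
    (((hO i).integrable (hm _) z.2).sub ((hO i).integrable (hm _) z.1)).sub (integrable_const _)
  have h0 : ∀ i z, ∫ w, N w z ∂(Pr.map (smp (d i))) = 0 := fun i z => by
    have k1 := integral_sub ((hO i).integrable (hm _) z.2) ((hO i).integrable (hm _) z.1)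
    refine (integral_sub (((hO i).integrable (hm _) z.2).sub ((hO i).integrable (hm _) z.1))
      (integrable_const _)).trans ?_
    rw [(hO i).mean, (hO i).mean] at k1
    simpa [sub_eq_zero] using k1
  have huu : Measurable[hist smp H] fun ω => (u ω, u' ω) := hu.meas.prodMk hu'.meas
  have hbar : L2Adapted Pr (hist smp H) fun ω => Dbar (u' ω) - Dbar (u ω) :=
    ((hO 0).adapted_bar (hist_le hm _) hu').sub ((hO 0).adapted_bar (hist_le hm _) hu)
  have hNu : ∀ i, MemLp (fun ω => N (smp (d i) ω) (u ω, u' ω)) 2 Pr := fun i =>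
    (((hO i).memLp_comp (hm _) (hist_le hm _) hu').sub
      ((hO i).memLp_comp (hm _) (hist_le hm _) hu)).sub hbar.memLp
  -- The variance is at most the second moment, which the Lipschitz bound of every single
  -- realization controls.
  have hv : ∀ i, ∫ ω, ‖N (smp (d i) ω) (u ω, u' ω)‖ ^ 2 ∂Pr ≤ ∫ ω, sqDist A B (u' ω) (u ω) ∂Pr := by
    intro i
    have h1 := integral_sq_norm_add (hist_le hm _) (hm (d i)) (indep_hist hm hi (hd i)) hN
      (hint i) (h0 i) hbar huu (hNu i) 1
    have h2 : ∫ ω, ‖Dbar (u' ω) - Dbar (u ω) + (1 : ℝ) • N (smp (d i) ω) (u ω, u' ω)‖ ^ 2 ∂Pr ≤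
        ∫ ω, sqDist A B (u' ω) (u ω) ∂Pr := by
      refine integral_mono_of_nonneg (Eventually.of_forall fun ω => by positivity)
        (hu'.integrable_sqDist hu) (Eventually.of_forall fun ω => ?_)
      have e : Dbar (u' ω) - Dbar (u ω) + (1 : ℝ) • N (smp (d i) ω) (u ω, u' ω) =
          D (smp (d i) ω) (u' ω) - D (smp (d i) ω) (u ω) := by
        rw [one_smul]; exact add_sub_cancel _ _
      change ‖_‖ ^ 2 ≤ _
      rw [e]
      exact (hO i).lip _ _ _ (hu'.norm_le ω)
    have h3 : 0 ≤ ∫ ω, ‖Dbar (u' ω) - Dbar (u ω)‖ ^ 2 ∂Pr := integral_nonneg fun ω => by positivity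
    linarith
  have h1 := (integral_sq_norm_add_batch hm hi hinj hd hN hint h0
    (hE.sub ((hO 0).adapted_bar (hist_le hm _) hu)) huu hNu hv (S : ℝ)⁻¹ S).2
  have e : ∀ ω, (batchMean S (fun i => smp (d i) ω) fun w => D w (u' ω)) + (1 - (0 : ℝ)) • (E ω -
        batchMean S (fun i => smp (d i) ω) fun w => D w (u ω)) - Dbar (u' ω) =
      (E ω - Dbar (u ω)) + (S : ℝ)⁻¹ • ∑ i ∈ Finset.range S, N (smp (d i) ω) (u ω, u' ω) :=
      fun ω => by
    simp only [hNdef, Finset.sum_sub_distrib, Finset.sum_const, Finset.card_range, smul_sub,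
      ← Nat.cast_smul_eq_nsmul ℝ, smul_smul, inv_mul_cancel₀ hS', one_smul, one_mul, batchMean, sub_zero]
    abel
  simp_rw [e]
  refine h1.trans_eq ?_
  congr 1
  field_simp

end IsOracle

/-! ### Deterministic estimates for one step -/

section Deterministic

variable {E : Type*} [NormedAddCommGroup E] [InnerProductSpace ℝ E]

/-- Serves both inner loops: `w` is the distance vector to the target, `d` the exact direction, `e`
its error, `r` the drift of the target. The step enters only through a norm inequality, so that a
projection is allowed. -/
theorem sq_norm_step_le {μ L s : ℝ} (hμ : 0 < μ) (hμL : μ ≤ L) (hs : 0 < s) (hsL : s * (4 * L) ≤ 1)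
    {w d e r w' : E} (hcoer : μ / 2 * ‖w‖ ^ 2 + 1 / (2 * L) * ‖d‖ ^ 2 ≤ ⟪d, w⟫)
    (hw' : ‖w'‖ ≤ ‖w - s • (d + e)‖) :
    ‖w' + r‖ ^ 2 ≤ (1 - s * μ / 4) * ‖w‖ ^ 2 + (-(s / (4 * L))) * ‖d + e‖ ^ 2
      + 4 * s / μ * ‖e‖ ^ 2 + 5 / (s * μ) * ‖r‖ ^ 2 := by
  have hL : 0 < L := hμ.trans_le hμL
  have hsμ : 0 < s * μ := mul_pos hs hμ
  have hsμ1 : s * μ ≤ 1 / 4 := by nlinarith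
  have h1 : ‖w - s • (d + e)‖ ^ 2 =
      ‖w‖ ^ 2 - 2 * s * ⟪d, w⟫ - 2 * s * ⟪e, w⟫ + s ^ 2 * ‖d + e‖ ^ 2 := by
    rw [norm_sub_sq_real, inner_smul_right, inner_add_right, norm_smul, mul_pow,
      Real.norm_of_nonneg hs.le, real_inner_comm w d, real_inner_comm w e]
    ring
  have h2 : -⟪e, w⟫ ≤ μ / 4 * ‖w‖ ^ 2 + 1 / μ * ‖e‖ ^ 2 := by
    have e1 := (abs_le.1 (abs_real_inner_le_norm e w)).1
    have e2 : 0 ≤ (μ / 2 * ‖w‖ - ‖e‖) ^ 2 / μ := by positivity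
    have e3 : (μ / 2 * ‖w‖ - ‖e‖) ^ 2 / μ =
        μ / 4 * ‖w‖ ^ 2 + 1 / μ * ‖e‖ ^ 2 - ‖e‖ * ‖w‖ := by field_simp; ring
    linarith
  have h3 : ‖d + e‖ ^ 2 ≤ 2 * ‖d‖ ^ 2 + 2 * ‖e‖ ^ 2 := by
    have := norm_add_le d e
    nlinarith [sq_nonneg (‖d‖ - ‖e‖), norm_nonneg (d + e)]
  have h4 : 1 / L ≤ 1 / μ := one_div_le_one_div_of_le hμ hμL
  -- Coercivity supplies -s/(2L)‖d + e‖² up to a multiple of ‖e‖²; the quadratic term of the step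
  -- uses half of it, the rest stays in the conclusion.
  have h5 : s ^ 2 * ‖d + e‖ ^ 2 ≤ s / (4 * L) * ‖d + e‖ ^ 2 := by
    have : s ^ 2 ≤ s / (4 * L) := by
      rw [le_div_iff₀ (by positivity)]; nlinarith
    gcongr
  have h6 : ‖w - s • (d + e)‖ ^ 2 ≤
      (1 - s * μ / 2) * ‖w‖ ^ 2 - s / (4 * L) * ‖d + e‖ ^ 2 + 3 * s / μ * ‖e‖ ^ 2 := by
    have k1 := mul_le_mul_of_nonneg_left hcoer (mul_pos two_pos hs).le
    have k2 := mul_le_mul_of_nonneg_left h2 (mul_pos two_pos hs).le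
    have k3 := mul_le_mul_of_nonneg_left h3 (show 0 ≤ s / (2 * L) by positivity)
    have k4 := mul_le_mul_of_nonneg_left h4 (show 0 ≤ s * ‖e‖ ^ 2 by positivity)
    have e1 : 2 * s * (1 / (2 * L) * ‖d‖ ^ 2) = s / (2 * L) * (2 * ‖d‖ ^ 2) := by
      field_simp
    have e2 : s / (2 * L) * (2 * ‖e‖ ^ 2) = s * ‖e‖ ^ 2 * (1 / L) := by
      field_simp
    have e3 : s / (2 * L) * ‖d + e‖ ^ 2 = 2 * (s / (4 * L) * ‖d + e‖ ^ 2) := by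
      field_simp; ring
    have e4 : 3 * s / μ * ‖e‖ ^ 2 = 3 * (s * ‖e‖ ^ 2 * (1 / μ)) := by ring
    have e5 : 2 * s * (1 / μ * ‖e‖ ^ 2) = 2 * (s * ‖e‖ ^ 2 * (1 / μ)) := by ring
    rw [h1]
    linarith
  have h7 : ‖w'‖ ^ 2 ≤ ‖w - s • (d + e)‖ ^ 2 := by gcongr
  -- Young's inequality with weight sμ/4, which gives up half of the contraction: (1 + sμ/4)(1 -
  -- sμ/2) ≤ 1 - sμ/4.
  have h8 : ‖w' + r‖ ^ 2 ≤ (1 + s * μ / 4) * ‖w'‖ ^ 2 + (1 + 4 / (s * μ)) * ‖r‖ ^ 2 := by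
    have e1 : ‖w' + r‖ ^ 2 ≤ (‖w'‖ + ‖r‖) ^ 2 := by
      have := norm_add_le w' r
      gcongr
    have e2 : 0 ≤ (s * μ * ‖w'‖ - 4 * ‖r‖) ^ 2 / (4 * (s * μ)) := by positivity
    have e3 : (s * μ * ‖w'‖ - 4 * ‖r‖) ^ 2 / (4 * (s * μ)) =
        s * μ / 4 * ‖w'‖ ^ 2 + 4 / (s * μ) * ‖r‖ ^ 2 - 2 * ‖w'‖ * ‖r‖ := by field_simp; ring
    nlinarith
  have h9 : (1 + 4 / (s * μ)) * ‖r‖ ^ 2 ≤ 5 / (s * μ) * ‖r‖ ^ 2 := by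
    have : 1 + 4 / (s * μ) ≤ 5 / (s * μ) := by
      rw [← sub_nonneg]
      have : 5 / (s * μ) - (1 + 4 / (s * μ)) = (1 - s * μ) / (s * μ) := by field_simp; ring
      rw [this]
      exact div_nonneg (by linarith) hsμ.le
    gcongr
  have h10 := mul_le_mul_of_nonneg_left (h7.trans h6) (show 0 ≤ 1 + s * μ / 4 by positivity)
  have h11 : 0 ≤ s * μ / 4 * (s / (4 * L) * ‖d + e‖ ^ 2) := by positivity
  have h12 : (1 + s * μ / 4) * (3 * s / μ * ‖e‖ ^ 2) ≤ 4 * s / μ * ‖e‖ ^ 2 := by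
    have e1 : 0 ≤ s / μ * ‖e‖ ^ 2 := by positivity
    have e2 : (1 + s * μ / 4) * (3 * s / μ * ‖e‖ ^ 2) =
      (1 + s * μ / 4) * 3 * (s / μ * ‖e‖ ^ 2) := by ring
    have e3 : 4 * s / μ * ‖e‖ ^ 2 = 4 * (s / μ * ‖e‖ ^ 2) := by ring
    rw [e2, e3]
    gcongr
    linarith
  have h13 : 0 ≤ (s * μ) ^ 2 / 8 * ‖w‖ ^ 2 := by positivity
  nlinarith

variable {q : ℕ} {M : ℝ}

theorem norm_projBall_le (hM : 0 ≤ M) (v : Vec q) : ‖projBall M v‖ ≤ M := by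
  unfold projBall
  split_ifs with h
  · exact h
  · have : 0 < ‖v‖ := hM.trans_lt (not_le.1 h)
    rw [norm_smul, norm_div, norm_norm, Real.norm_of_nonneg hM, div_mul_cancel₀ _ this.ne']

/-- Outside the ball, v - w is a nonnegative multiple of v plus the projected difference, and these
have nonnegative inner product. -/
theorem norm_projBall_sub_le {v w : Vec q} (hw : ‖w‖ ≤ M) :
    ‖projBall M v - w‖ ≤ ‖v - w‖ := by
  unfold projBall
  split_ifs with h
  · exact le_rfl
  · have hM : 0 ≤ M := (norm_nonneg _).trans hw
    have hv : M < ‖v‖ := not_le.1 h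
    have hv0 : 0 < ‖v‖ := hM.trans_lt hv
    have h1 : v - w = (1 - M / ‖v‖) • v + ((M / ‖v‖) • v - w) := by module
    have h2 : 0 ≤ 1 - M / ‖v‖ := by
      rw [sub_nonneg, div_le_one hv0]; exact hv.le
    have h3 : 0 ≤ ⟪v, (M / ‖v‖) • v - w⟫ := by
      rw [inner_sub_right, inner_smul_right, real_inner_self_eq_norm_sq]
      have e1 : M / ‖v‖ * ‖v‖ ^ 2 = ‖v‖ * M := by field_simp
      have e2 := (real_inner_le_norm v w).trans (mul_le_mul_of_nonneg_left hw hv0.le)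
      linarith
    refine (sq_le_sq₀ (norm_nonneg _) (norm_nonneg _)).1 ?_
    rw [h1, norm_add_sq_real, real_inner_smul_left]
    nlinarith [mul_nonneg h2 h3, sq_nonneg ‖(1 - M / ‖v‖) • v‖]

theorem measurable_projBall : Measurable (projBall (q := q) M) := by
  refine Measurable.ite (measurableSet_le measurable_norm measurable_const) measurable_id ?_
  exact (measurable_const.div measurable_norm).smul measurable_id

end Deterministic

/-- Summation of the contraction over a loop. -/
theorem loop_sum_le {κ b γ ρ : ℝ} (hκ : 0 ≤ κ) {d A e m : ℕ → ℝ} (hd : ∀ t, 0 ≤ d t) {n : ℕ}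
    (hn : 0 < n)
    (h : ∀ t < n, d (t + 1) ≤ (1 - κ) * d t + (-b) * A t + γ * e t + ρ * m t) :
    d n ≤ (1 - κ) * d 0 - b * ∑ t ∈ Finset.range n, A t + γ * ∑ t ∈ Finset.range n, e t
      + ρ * ∑ t ∈ Finset.range n, m t := by
  induction n, hn using Nat.le_induction with
  | base => simpa [sub_eq_add_neg] using h 0 zero_lt_one
  | succ n hn ih =>
    have h1 := ih fun t ht => h t (ht.trans (Nat.lt_succ_self n))
    have h2 := h n (Nat.lt_succ_self n)
    -- One contraction factor per loop suffices; it is kept for the first step and discarded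
    -- afterwards.
    have h3 := mul_nonneg hκ (hd n)
    simp only [Finset.sum_range_succ, mul_add]
    linarith

theorem integral_le_combination {Ω : Type*} [MeasurableSpace Ω] {Pr : Measure Ω}
    {f f₁ f₂ f₃ f₄ : Ω → ℝ} {c₁ c₂ c₃ c₄ : ℝ} (hf : Integrable f Pr) (h₁ : Integrable f₁ Pr)
    (h₂ : Integrable f₂ Pr) (h₃ : Integrable f₃ Pr) (h₄ : Integrable f₄ Pr)
    (h : ∀ ω, f ω ≤ c₁ * f₁ ω + c₂ * f₂ ω + c₃ * f₃ ω + c₄ * f₄ ω) :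
    ∫ ω, f ω ∂Pr ≤
      c₁ * ∫ ω, f₁ ω ∂Pr + c₂ * ∫ ω, f₂ ω ∂Pr + c₃ * ∫ ω, f₃ ω ∂Pr + c₄ * ∫ ω, f₄ ω ∂Pr := by
  have i1 := h₁.const_mul c₁
  have i2 := h₂.const_mul c₂
  have i3 := h₃.const_mul c₃
  have i4 := h₄.const_mul c₄
  refine (integral_mono hf (((i1.add i2).add i3).add i4) h).trans_eq ?_
  have e1 := integral_add i1 i2
  have e2 := integral_add (i1.add i2) i3
  have e3 := integral_add ((i1.add i2).add i3) i4
  simp only [integral_const_mul, Pi.add_apply] at e1 e2 e3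
  refine e3.trans ?_
  rw [e2, e1]

/-! ### Labels of the samples drawn before a given moment -/

/-- The outer iteration to which a sample belongs. -/
def Draw.iter : Draw → ℕ
  | .x1 k _ | .y1 k _ | .v1 k _ | .y2 k _ _ | .x2 k _ _ | .v2 k _ _ => k

/-- The moment within the outer iteration at which a sample is drawn. -/
def Draw.phase (T : ℕ) : Draw → ℕ
  | .x1 _ _ | .y1 _ _ | .v1 _ _ => 0
  | .y2 _ t _ => 1 + t
  | .x2 _ j _ | .v2 _ j _ => 1 + T + j

/-- The labels of the samples drawn before moment `n` of the outer iteration `k`. -/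
def past (T k n : ℕ) : Set Draw := {d | d.iter < k ∨ d.iter = k ∧ d.phase T < n}

theorem past_mono {T k n n' : ℕ} (h : n ≤ n') : past T k n ⊆ past T k n' := fun _ hd =>
  hd.imp_right fun hd => ⟨hd.1, hd.2.trans_le h⟩

theorem past_subset_succ (T k n : ℕ) : past T k n ⊆ past T (k + 1) 0 := fun _ hd =>
  Or.inl (hd.elim (fun h => h.trans (Nat.lt_succ_self k)) fun h => h.1 ▸ Nat.lt_succ_self k)

theorem mem_past {T k n : ℕ} {d : Draw} (h1 : d.iter = k) (h2 : d.phase T < n) : d ∈ past T k n :=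
  Or.inr ⟨h1, h2⟩

/-- With `indep_hist`, a sample drawn at moment `n` or later is independent of all quantities known
at that moment. -/
theorem notMem_past {T k n : ℕ} {d : Draw} (h1 : d.iter = k) (h2 : n ≤ d.phase T) :
    d ∉ past T k n := by
  rintro (h | h)
  · omega
  · omega

theorem L2Adapted.comp_lipschitz {Ω : Type*} {m : MeasurableSpace Ω} [m0 : MeasurableSpace Ω]
    {Pr : Measure Ω} [IsProbabilityMeasure Pr] {n k : ℕ} {f : Ω → Vec n} {φ : Vec n → Vec k}
    {C : ℝ} (hf : L2Adapted Pr m f) (hm : m ≤ m0) (hφ : ∀ x x', ‖φ x - φ x'‖ ≤ C * ‖x - x'‖) :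
    L2Adapted Pr m (fun ω => φ (f ω)) := by
  have hc : Continuous φ :=
    (LipschitzWith.of_dist_le' (K := C) fun x x' => by
      rw [dist_eq_norm, dist_eq_norm]; exact hφ x x').continuous
  refine ⟨hc.measurable.comp hf.meas, ?_⟩
  have h1 : MemLp (fun ω => φ (f ω) - φ 0) 2 Pr :=
    memLp_of_sq_le ((hc.measurable.comp (hf.meas.mono hm le_rfl)).sub_const _).aestronglyMeasurable
      (hf.integrable_sq.const_mul (C ^ 2)) fun ω => by
        rw [← mul_pow]
        have := hφ (f ω) 0
        rw [sub_zero] at this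
        gcongr
  simpa [Pi.add_def] using h1.add (memLp_const (φ 0))

/-- Extending the sums to the whole loop gives one bound for the error at every inner step. -/
theorem accumulate_le {c₁ c₂ S : ℝ} (hc₁ : 0 ≤ c₁) (hc₂ : 0 ≤ c₂) (hS : 0 ≤ S) {e m A : ℕ → ℝ}
    (hm : ∀ t, 0 ≤ m t) (hA : ∀ t, 0 ≤ A t) {n : ℕ}
    (h : ∀ t < n, e (t + 1) ≤ e t + (c₁ * m t + c₂ * A t) / S) {t : ℕ} (ht : t ≤ n) :
    e t ≤ e 0 + (c₁ * ∑ t ∈ Finset.range n, m t + c₂ * ∑ t ∈ Finset.range n, A t) / S := by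
  have h1 : ∀ t ≤ n,
      e t ≤ e 0 + (c₁ * ∑ t ∈ Finset.range t, m t + c₂ * ∑ t ∈ Finset.range t, A t) / S := by
    intro t ht
    induction t with
    | zero => simp
    | succ t ih =>
      have k1 := ih (Nat.le_of_succ_le ht)
      have k2 := h t ht
      simp only [Finset.sum_range_succ, mul_add]
      rw [show c₁ * ∑ t ∈ Finset.range t, m t + c₁ * m t + (c₂ * ∑ t ∈ Finset.range t, A t
        + c₂ * A t) = (c₁ * ∑ t ∈ Finset.range t, m t + c₂ * ∑ t ∈ Finset.range t, A t) +
        (c₁ * m t + c₂ * A t) by ring, add_div]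
      linarith
  have h2 : ∀ f : ℕ → ℝ, (∀ t, 0 ≤ f t) →
      ∑ t ∈ Finset.range t, f t ≤ ∑ t ∈ Finset.range n, f t := fun f hf =>
    Finset.sum_le_sum_of_subset_of_nonneg (Finset.range_mono ht) fun i _ _ => hf i
  have h3 := h2 m hm
  have h4 := h2 A hA
  refine (h1 t ht).trans ?_
  gcongr

/-- Within a loop the outer variables jump in the first step only; this evaluates their total
movement. -/
theorem sum_range_eq_zeroth {m : ℕ → ℝ} (hm : ∀ t, m (t + 1) = 0) {n : ℕ} (hn : 0 < n) :
    ∑ t ∈ Finset.range n, m t = m 0 := by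
  obtain ⟨n, rfl⟩ := Nat.exists_eq_succ_of_ne_zero hn.ne'
  rw [Finset.sum_range_succ', Finset.sum_eq_zero fun t _ => hm t, zero_add]

namespace IsSampling

variable {Ξ Z Ω : Type*} [MeasurableSpace Ξ] [MeasurableSpace Z] [MeasurableSpace Ω]
    {P : Measure Ξ} {Q : Measure Z} {Pr : Measure Ω} {smp : Draw → Ω → Ξ × Z}

theorem measurePreserving_fst (hS : IsSampling P Q Pr smp) (d : Draw) :
    MeasurePreserving Prod.fst (Pr.map (smp d)) P :=
  ⟨measurable_fst, (Measure.map_map measurable_fst (hS.meas d)).trans (hS.law_fst d)⟩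

theorem measurePreserving_snd (hS : IsSampling P Q Pr smp) (d : Draw) :
    MeasurePreserving Prod.snd (Pr.map (smp d)) Q :=
  ⟨measurable_snd, (Measure.map_map measurable_snd (hS.meas d)).trans (hS.law_snd d)⟩

end IsSampling

/-- All components of the random state are square integrable and measurable with respect to `m`. -/
structure YAdapted {p q : ℕ} {Ω : Type*} [m0 : MeasurableSpace Ω] (Pr : Measure Ω)
    (m : MeasurableSpace Ω) (u : Ω → YState p q) : Prop where
  x : @L2Adapted Ω m0 p Pr m fun ω => (u ω).x
  y : @L2Adapted Ω m0 q Pr m fun ω => (u ω).y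
  Dy : @L2Adapted Ω m0 q Pr m fun ω => (u ω).Dy

/-- All components of the random state are square integrable and measurable with respect to `m`,
and `v` is in the ball of radius `M`. -/
structure VAdapted {p q : ℕ} {Ω : Type*} [m0 : MeasurableSpace Ω] (Pr : Measure Ω)
    (m : MeasurableSpace Ω) (M : ℝ) (u : Ω → VState p q) : Prop where
  x : @L2Adapted Ω m0 p Pr m fun ω => (u ω).x
  y : @L2Adapted Ω m0 q Pr m fun ω => (u ω).y
  v : @L2Adapted Ω m0 q Pr m fun ω => (u ω).v
  Dx : @L2Adapted Ω m0 p Pr m fun ω => (u ω).Dx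
  Dv : @L2Adapted Ω m0 q Pr m fun ω => (u ω).Dv
  norm_le : ∀ ω, ‖(u ω).v‖ ≤ M

/-! ### The lower-level loop -/

section Loops

variable {p q : ℕ} {Ξ Z Ω : Type*} [MeasurableSpace Ξ] [MeasurableSpace Z]
  {m : MeasurableSpace Ω} [m0 : MeasurableSpace Ω]
  {P : Measure Ξ} [IsProbabilityMeasure P] {Q : Measure Z} [IsProbabilityMeasure Q]
  {F : Ξ → Joint p q → ℝ} {G : Z → Joint p q → ℝ} {c : Constants}
  {Pr : Measure Ω} [IsProbabilityMeasure Pr] {smp : Draw → Ω → Ξ × Z}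
  (hA : Assumptions P Q F G c) (hS : IsSampling P Q Pr smp)

section YLoop

-- D_y does not involve v, so the third argument is set to 0, which lies in the ball.
include hA in
omit [IsProbabilityMeasure P] [IsProbabilityMeasure Q] in
theorem YAdapted.point {u : Ω → YState p q} (h : YAdapted Pr m u) :
    IsOracle.Point Pr m c.M fun ω => ((u ω).x, (u ω).y, (0 : Vec q)) :=
  ⟨h.x, h.y, L2Adapted.const 0, fun ω => by
    simpa using hA.regular.M_nonneg⟩

omit [IsProbabilityMeasure Pr] in
include hA hS in
theorem oracleY (d : Draw) : IsOracle (Pr.map (smp d)) c.M ((c.Lg : ℝ) ^ 2) 0 (c.σg ^ 2)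
      (fun w (u : Args p q) => dirY (G w.2) u.1 u.2.1)
      (fun u => dirY (expected Q G) u.1 u.2.1) :=
  hA.isOracle_dirY (hS.measurePreserving_snd d)

variable {a : Params} {k : ℕ} {u : Ω → YState p q} {xn : Ω → Vec p}

/-- The random states of the lower-level loop. -/
noncomputable def yPath (a : Params) (G : Z → Joint p q → ℝ) (smp : Draw → Ω → Ξ × Z) (k : ℕ)
    (u : Ω → YState p q) (xn : Ω → Vec p) (t : ℕ) (ω : Ω) : YState p q :=
  yLoop a G (fun d => smp d ω) k (u ω) (xn ω) t

-- The value at `t` has used the large batches (moment 0) and the small batches of steps below `t`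
-- (moments up to t), hence the bound 1 + t.
include hA hS in
theorem yPath_adapted (hu : YAdapted Pr (hist smp (past a.T k 1)) u)
    (hxn : L2Adapted Pr (hist smp (past a.T k 1)) xn) (t : ℕ) :
    YAdapted Pr (hist smp (past a.T k (1 + t))) (yPath a G smp k u xn t) := by
  induction t with
  | zero => exact hu
  | succ t ih =>
    have hle : hist smp (past a.T k (1 + t)) ≤ hist smp (past a.T k (1 + (t + 1))) :=
      hist_mono (past_mono (by omega))
    have hx : L2Adapted Pr (hist smp (past a.T k (1 + (t + 1)))) xn :=
      hxn.mono (hist_mono (past_mono (by omega)))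
    have hy : L2Adapted Pr (hist smp (past a.T k (1 + (t + 1))))
        fun ω => (yPath a G smp k u xn (t + 1) ω).y :=
      (ih.y.mono hle).sub ((ih.Dy.mono hle).const_smul _)
    have hd : ∀ i, Draw.y2 k t i ∈ past a.T k (1 + (t + 1)) := fun i =>
      mem_past rfl (by simp only [Draw.phase]; omega)
    have hp1 := (ih.point hA).mono hle
    have hp2 : IsOracle.Point Pr (hist smp (past a.T k (1 + (t + 1)))) c.M
        fun ω => (xn ω, (yPath a G smp k u xn (t + 1) ω).y, (0 : Vec q)) :=
      ⟨hx, hy, L2Adapted.const 0, fun ω => by simpa using hA.regular.M_nonneg⟩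
    have hb1 := IsOracle.adapted_batchMean hS.meas (fun i => oracleY hA hS (.y2 k t i)) hd hp1 a.S2
    have hb2 := IsOracle.adapted_batchMean hS.meas (fun i => oracleY hA hS (.y2 k t i)) hd hp2 a.S2
    exact ⟨hx, hy, hb2.add (((ih.Dy.mono hle).sub hb1).const_smul _)⟩

omit [MeasurableSpace Ξ] [MeasurableSpace Z] m0 in
theorem yPath_x_succ (t : ℕ) (ω : Ω) : (yPath a G smp k u xn (t + 1) ω).x = xn ω := rfl

omit [MeasurableSpace Ξ] [MeasurableSpace Z] m0 in
theorem yPath_y_succ (t : ℕ) (ω : Ω) : (yPath a G smp k u xn (t + 1) ω).y =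
    (yPath a G smp k u xn t ω).y - (a.lam1 * a.β) • (yPath a G smp k u xn t ω).Dy := rfl

include hA hS in
theorem yPath_error_succ (hτ : a.τy = 0) (hS2 : 0 < a.S2)
    (hu : YAdapted Pr (hist smp (past a.T k 1)) u)
    (hxn : L2Adapted Pr (hist smp (past a.T k 1)) xn) (t : ℕ) :
    ∫ ω, ‖(yPath a G smp k u xn (t + 1) ω).Dy - dirY (expected Q G)
        (yPath a G smp k u xn (t + 1) ω).x (yPath a G smp k u xn (t + 1) ω).y‖ ^ 2 ∂Pr ≤
      ∫ ω, ‖(yPath a G smp k u xn t ω).Dy - dirY (expected Q G)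
        (yPath a G smp k u xn t ω).x (yPath a G smp k u xn t ω).y‖ ^ 2 ∂Pr +
      ((c.Lg : ℝ) ^ 2 * ∫ ω, ‖(yPath a G smp k u xn (t + 1) ω).x
          - (yPath a G smp k u xn t ω).x‖ ^ 2 ∂Pr +
        ((c.Lg : ℝ) ^ 2 * (a.lam1 * a.β) ^ 2) *
          ∫ ω, ‖(yPath a G smp k u xn t ω).Dy‖ ^ 2 ∂Pr) / a.S2 := by
  have h := yPath_adapted hA hS hu hxn t
  have hx : L2Adapted Pr (hist smp (past a.T k (1 + t))) xn :=
    hxn.mono (hist_mono (past_mono (by omega)))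
  have hy : L2Adapted Pr (hist smp (past a.T k (1 + t)))
      fun ω => (yPath a G smp k u xn (t + 1) ω).y := h.y.sub (h.Dy.const_smul _)
  have hp2 : IsOracle.Point Pr (hist smp (past a.T k (1 + t))) c.M
      fun ω => (xn ω, (yPath a G smp k u xn (t + 1) ω).y, (0 : Vec q)) :=
    ⟨hx, hy, L2Adapted.const 0, fun ω => by simpa using hA.regular.M_nonneg⟩
  have h1 := IsOracle.integral_sq_spider_le (d := fun i => Draw.y2 k t i) hS.meas hS.indep
    (fun i j hij => by simpa using hij)
    (fun i => notMem_past (T := a.T) (k := k) (n := 1 + t) rfl le_rfl)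
    (fun i => oracleY hA hS (.y2 k t i)) (h.point hA) hp2 h.Dy hS2
  have e : ∀ ω, (yPath a G smp k u xn (t + 1) ω).Dy =
    (batchMean a.S2 (fun i => smp (.y2 k t i) ω) fun w =>
      dirY (G w.2) (xn ω) (yPath a G smp k u xn (t + 1) ω).y) + (1 - (0 : ℝ)) •
      ((yPath a G smp k u xn t ω).Dy - batchMean a.S2 (fun i => smp (.y2 k t i) ω) fun w =>
      dirY (G w.2) (yPath a G smp k u xn t ω).x (yPath a G smp k u xn t ω).y) := fun ω => by
    rw [← hτ]; rfl
  simp_rw [e]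
  refine h1.trans (le_of_eq ?_)
  congr 2
  have e2 : ∀ ω, IsOracle.Point.sqDist ((c.Lg : ℝ) ^ 2) 0
      (xn ω, (yPath a G smp k u xn (t + 1) ω).y, (0 : Vec q))
      ((yPath a G smp k u xn t ω).x, (yPath a G smp k u xn t ω).y, (0 : Vec q)) =
      (c.Lg : ℝ) ^ 2 * ‖(yPath a G smp k u xn (t + 1) ω).x - (yPath a G smp k u xn t ω).x‖ ^ 2
      + ((c.Lg : ℝ) ^ 2 * (a.lam1 * a.β) ^ 2) * ‖(yPath a G smp k u xn t ω).Dy‖ ^ 2 := fun ω => by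
    simp only [IsOracle.Point.sqDist, yPath_y_succ, yPath_x_succ]
    rw [sub_sub_cancel_left, norm_neg, norm_smul, mul_pow, Real.norm_eq_abs, sq_abs]
    ring
  simp_rw [e2]
  refine (integral_add ((hx.sub h.x).integrable_sq.const_mul _)
    (h.Dy.integrable_sq.const_mul _)).trans ?_
  rw [integral_const_mul, integral_const_mul]
  rfl

omit [IsProbabilityMeasure P] [IsProbabilityMeasure Q] in
include hA in
theorem adapted_lowerSol (hm : m ≤ m0) {x : Ω → Vec p} (hx : L2Adapted Pr m x) :
    L2Adapted Pr m fun ω => lowerSol (expected Q G) (x ω) :=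
  hx.comp_lipschitz hm hA.regular.norm_lowerSol_sub_le

omit [IsProbabilityMeasure P] [IsProbabilityMeasure Q] in
include hA in
theorem adapted_auxSol (hm : m ≤ m0) {x : Ω → Vec p} (hx : L2Adapted Pr m x) :
    L2Adapted Pr m fun ω => auxSol (expected P F) (expected Q G) (x ω) :=
  hx.comp_lipschitz hm hA.regular.norm_auxSol_sub_le

-- `sq_norm_step_le` with the gradient of the lower-level problem as exact direction and the
-- movement of y* as drift, which is Lipschitz with constant C_y.
include hA hS in
theorem yPath_dist_succ (hμL : c.μ ≤ c.Lg) (hs : 0 < a.lam1 * a.β)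
    (hsL : a.lam1 * a.β * (4 * c.Lg) ≤ 1)
    (hu : YAdapted Pr (hist smp (past a.T k 1)) u)
    (hxn : L2Adapted Pr (hist smp (past a.T k 1)) xn) (t : ℕ) :
    ∫ ω, ‖(yPath a G smp k u xn (t + 1) ω).y - lowerSol (expected Q G)
        (yPath a G smp k u xn (t + 1) ω).x‖ ^ 2 ∂Pr ≤
      (1 - a.lam1 * a.β * c.μ / 4) * ∫ ω, ‖(yPath a G smp k u xn t ω).y - lowerSol (expected Q G)
        (yPath a G smp k u xn t ω).x‖ ^ 2 ∂Pr
      + (-(a.lam1 * a.β / (4 * c.Lg))) * ∫ ω, ‖(yPath a G smp k u xn t ω).Dy‖ ^ 2 ∂Pr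
      + 4 * (a.lam1 * a.β) / c.μ * ∫ ω, ‖(yPath a G smp k u xn t ω).Dy - dirY (expected Q G)
        (yPath a G smp k u xn t ω).x (yPath a G smp k u xn t ω).y‖ ^ 2 ∂Pr
      + (5 / (a.lam1 * a.β * c.μ) * c.Cy ^ 2) * ∫ ω, ‖(yPath a G smp k u xn (t + 1) ω).x
          - (yPath a G smp k u xn t ω).x‖ ^ 2 ∂Pr := by
  have hR := hA.regular
  have hle : ∀ D, hist smp D ≤ m0 := hist_le hS.meas
  have h := yPath_adapted hA hS hu hxn t
  have h' := yPath_adapted hA hS hu hxn (t + 1)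
  have hmono : hist smp (past a.T k (1 + t)) ≤ hist smp (past a.T k (1 + (t + 1))) :=
    hist_mono (past_mono (by omega))
  refine integral_le_combination
    (h'.y.sub (adapted_lowerSol hA (hle _) h'.x)).integrable_sq
    (h.y.sub (adapted_lowerSol hA (hle _) h.x)).integrable_sq h.Dy.integrable_sq
    (h.Dy.sub ((oracleY hA hS (.x1 0 0)).adapted_bar (hle _) (h.point hA))).integrable_sq
    (h'.x.sub (h.x.mono hmono)).integrable_sq fun ω => ?_
  set Y := yPath a G smp k u xn t ω
  set Y' := yPath a G smp k u xn (t + 1) ω with hY'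
  have hy' : Y'.y = Y.y - (a.lam1 * a.β) • Y.Dy := rfl
  have hμ := hA.μ_pos
  have h1 := sq_norm_step_le hA.μ_pos hμL hs hsL
    (e := Y.Dy - dirY (expected Q G) Y.x Y.y)
    (r := lowerSol (expected Q G) Y.x - lowerSol (expected Q G) Y'.x)
    (w' := Y'.y - lowerSol (expected Q G) Y.x)
    (hR.lower_coercive Y.x Y.y (hμ.trans_le hμL)) (by
      rw [add_sub_cancel, hy', sub_right_comm])
  rw [add_sub_cancel, sub_add_sub_cancel] at h1
  have h2 := hR.norm_lowerSol_sub_le Y'.x Y.x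
  rw [norm_sub_rev (lowerSol (expected Q G) Y'.x)] at h2
  have h3 : ‖lowerSol (expected Q G) Y.x - lowerSol (expected Q G) Y'.x‖ ^ 2 ≤
      c.Cy ^ 2 * ‖Y'.x - Y.x‖ ^ 2 := by
    rw [← mul_pow]; gcongr
  have h4 : 5 / (a.lam1 * a.β * c.μ) *
      ‖lowerSol (expected Q G) Y.x - lowerSol (expected Q G) Y'.x‖ ^ 2 ≤
      5 / (a.lam1 * a.β * c.μ) * (c.Cy ^ 2 * ‖Y'.x - Y.x‖ ^ 2) := by
    gcongr
  linarith

include hA hS in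
/-- The effect of a whole lower-level loop on the distance to the solution and on the error. -/
theorem yPath_summary (hμL : c.μ ≤ c.Lg) (hs : 0 < a.lam1 * a.β)
    (hsL : a.lam1 * a.β * (4 * c.Lg) ≤ 1) (hτ : a.τy = 0) (hS2 : 0 < a.S2) (hT : 0 < a.T)
    (hu : YAdapted Pr (hist smp (past a.T k 1)) u)
    (hxn : L2Adapted Pr (hist smp (past a.T k 1)) xn) :
    ∃ A : ℝ, 0 ≤ A ∧
      (∫ ω, ‖(yPath a G smp k u xn a.T ω).y - lowerSol (expected Q G) (xn ω)‖ ^ 2 ∂Pr ≤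
        (1 - a.lam1 * a.β * c.μ / 4) * ∫ ω, ‖(u ω).y - lowerSol (expected Q G) (u ω).x‖ ^ 2 ∂Pr
        - a.lam1 * a.β / (4 * c.Lg) * A
        + 4 * (a.lam1 * a.β) / c.μ * (a.T *
          (∫ ω, ‖(u ω).Dy - dirY (expected Q G) (u ω).x (u ω).y‖ ^ 2 ∂Pr
          + ((c.Lg : ℝ) ^ 2 * ∫ ω, ‖xn ω - (u ω).x‖ ^ 2 ∂Pr
            + (c.Lg : ℝ) ^ 2 * (a.lam1 * a.β) ^ 2 * A) / a.S2))
        + 5 / (a.lam1 * a.β * c.μ) * c.Cy ^ 2 * ∫ ω, ‖xn ω - (u ω).x‖ ^ 2 ∂Pr) ∧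
      (∫ ω, ‖(yPath a G smp k u xn a.T ω).Dy - dirY (expected Q G) (xn ω)
          (yPath a G smp k u xn a.T ω).y‖ ^ 2 ∂Pr ≤
        ∫ ω, ‖(u ω).Dy - dirY (expected Q G) (u ω).x (u ω).y‖ ^ 2 ∂Pr
          + ((c.Lg : ℝ) ^ 2 * ∫ ω, ‖xn ω - (u ω).x‖ ^ 2 ∂Pr
            + (c.Lg : ℝ) ^ 2 * (a.lam1 * a.β) ^ 2 * A) / a.S2) ∧
      ∫ ω, ‖(yPath a G smp k u xn a.T ω).y - (u ω).y‖ ^ 2 ∂Pr ≤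
        a.T * (a.lam1 * a.β) ^ 2 * A := by
  have hxT : ∀ ω, (yPath a G smp k u xn a.T ω).x = xn ω := fun ω => by
    obtain ⟨n, hn⟩ := Nat.exists_eq_succ_of_ne_zero hT.ne'
    rw [hn, yPath_x_succ]
  set A : ℕ → ℝ := fun t => ∫ ω, ‖(yPath a G smp k u xn t ω).Dy‖ ^ 2 ∂Pr with hAdef
  set mv : ℕ → ℝ := fun t => ∫ ω, ‖(yPath a G smp k u xn (t + 1) ω).x
          - (yPath a G smp k u xn t ω).x‖ ^ 2 ∂Pr with hmv
  have hA0 : ∀ t, 0 ≤ A t := fun t => integral_nonneg fun ω => by positivity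
  have hm0 : ∀ t, 0 ≤ mv t := fun t => integral_nonneg fun ω => by positivity
  have hmsum : ∑ t ∈ Finset.range a.T, mv t = ∫ ω, ‖xn ω - (u ω).x‖ ^ 2 ∂Pr := by
    rw [sum_range_eq_zeroth (fun t => ?_) hT]
    · rfl
    · simp [hmv, yPath_x_succ]
  set e : ℕ → ℝ := fun t => ∫ ω, ‖(yPath a G smp k u xn t ω).Dy - dirY (expected Q G)
        (yPath a G smp k u xn t ω).x (yPath a G smp k u xn t ω).y‖ ^ 2 ∂Pr with he
  have herr : ∀ t ≤ a.T, e t ≤ e 0 + ((c.Lg : ℝ) ^ 2 * ∫ ω, ‖xn ω - (u ω).x‖ ^ 2 ∂Pr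
            + (c.Lg : ℝ) ^ 2 * (a.lam1 * a.β) ^ 2 * ∑ t ∈ Finset.range a.T, A t) / a.S2 := by
    intro t ht
    rw [← hmsum]
    exact accumulate_le (by positivity) (by positivity) (Nat.cast_nonneg _) hm0 hA0
      (fun t _ => yPath_error_succ hA hS hτ hS2 hu hxn t) ht
  have hμ := hA.μ_pos
  refine ⟨∑ t ∈ Finset.range a.T, A t, Finset.sum_nonneg fun t _ => hA0 t, ?_, ?_, ?_⟩
  · have h1 := loop_sum_le (κ := a.lam1 * a.β * c.μ / 4) (by positivity)
      (d := fun t => ∫ ω, ‖(yPath a G smp k u xn t ω).y - lowerSol (expected Q G)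
        (yPath a G smp k u xn t ω).x‖ ^ 2 ∂Pr)
      (fun t => integral_nonneg fun ω => by positivity) hT
      (fun t _ => yPath_dist_succ hA hS hμL hs hsL hu hxn t)
    have h2 : ∑ t ∈ Finset.range a.T, e t ≤ a.T * (e 0 +
        ((c.Lg : ℝ) ^ 2 * ∫ ω, ‖xn ω - (u ω).x‖ ^ 2 ∂Pr
            + (c.Lg : ℝ) ^ 2 * (a.lam1 * a.β) ^ 2 * ∑ t ∈ Finset.range a.T, A t) / a.S2) := by
      refine (Finset.sum_le_card_nsmul _ _ _ fun t ht =>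
        herr t (Finset.mem_range.1 ht).le).trans_eq ?_
      rw [Finset.card_range, nsmul_eq_mul]
    simp_rw [hxT] at h1
    have h3 := mul_le_mul_of_nonneg_left h2 (show 0 ≤ 4 * (a.lam1 * a.β) / c.μ by positivity)
    rw [← hmsum]
    rw [← hmsum] at h3
    refine h1.trans ?_
    gcongr ?_ + _
    gcongr ?_ + ?_
    · exact le_rfl
    · exact h3
  · have h1 := herr a.T le_rfl
    simp only [he, hxT] at h1
    exact h1
  · have h1 : ∀ t ω, (yPath a G smp k u xn t ω).y - (u ω).y =
        -((a.lam1 * a.β) • ∑ i ∈ Finset.range t, (yPath a G smp k u xn i ω).Dy) := by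
      intro t ω
      induction t with
      | zero => simp [yPath, yLoop]
      | succ t ih =>
        rw [yPath_y_succ, Finset.sum_range_succ, smul_add, neg_add, ← ih]
        abel
    -- Cauchy–Schwarz over the steps of the loop; this displacement enters the errors of D^x and D^v
    -- in the next loop.
    have h2 : ∀ ω, ‖(yPath a G smp k u xn a.T ω).y - (u ω).y‖ ^ 2 ≤
        a.T * (a.lam1 * a.β) ^ 2 *
          ∑ i ∈ Finset.range a.T, ‖(yPath a G smp k u xn i ω).Dy‖ ^ 2 := by
      intro ω
      rw [h1, norm_neg, norm_smul, mul_pow, Real.norm_eq_abs, sq_abs]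
      have e1 := norm_sum_le (Finset.range a.T) fun i => (yPath a G smp k u xn i ω).Dy
      have e2 := sq_sum_le_card_mul_sum_sq (s := Finset.range a.T)
        (f := fun i => ‖(yPath a G smp k u xn i ω).Dy‖)
      rw [Finset.card_range] at e2
      have e3 := (pow_le_pow_left₀ (norm_nonneg _) e1 2).trans e2
      calc _ ≤ (a.lam1 * a.β) ^ 2 *
            (a.T * ∑ i ∈ Finset.range a.T, ‖(yPath a G smp k u xn i ω).Dy‖ ^ 2) := by gcongr
        _ = _ := by ring
    have h3 : ∀ i ∈ Finset.range a.T,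
        Integrable (fun ω => ‖(yPath a G smp k u xn i ω).Dy‖ ^ 2) Pr := fun i _ =>
      (yPath_adapted hA hS hu hxn i).Dy.integrable_sq
    refine (integral_mono_of_nonneg (Eventually.of_forall fun ω => by positivity)
      ((integrable_finsetSum _ h3).const_mul _) (Eventually.of_forall h2)).trans_eq ?_
    rw [integral_const_mul, integral_finsetSum _ h3]

end YLoop

end Loops

/-! ### The auxiliary-variable loop -/

section Loops

variable {p q : ℕ} {Ξ Z Ω : Type*} [MeasurableSpace Ξ] [MeasurableSpace Z]
  {m : MeasurableSpace Ω} [m0 : MeasurableSpace Ω]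
  {P : Measure Ξ} [IsProbabilityMeasure P] {Q : Measure Z} [IsProbabilityMeasure Q]
  {F : Ξ → Joint p q → ℝ} {G : Z → Joint p q → ℝ} {c : Constants}
  {Pr : Measure Ω} [IsProbabilityMeasure Pr] {smp : Draw → Ω → Ξ × Z}
  (hA : Assumptions P Q F G c) (hS : IsSampling P Q Pr smp)

section VLoop

omit [IsProbabilityMeasure Pr] in
theorem VAdapted.point {u : Ω → VState p q} (h : VAdapted Pr m c.M u) :
    IsOracle.Point Pr m c.M fun ω => ((u ω).x, (u ω).y, (u ω).v) :=
  ⟨h.x, h.y, h.v, h.norm_le⟩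

include hA hS in
theorem oracleX (d : Draw) : IsOracle (Pr.map (smp d)) c.M c.M1 (2 * (c.Lg : ℝ) ^ 2)
      (2 * c.σf ^ 2 + 2 * c.M ^ 2 * c.σgxy ^ 2)
      (fun w (u : Args p q) => dirX (F w.1) (G w.2) u.1 u.2.1 u.2.2)
      (fun u => dirX (expected P F) (expected Q G) u.1 u.2.1 u.2.2) :=
  have := Measure.isProbabilityMeasure_map (μ := Pr) (hS.meas d).aemeasurable
  hA.isOracle_dirX (hS.measurePreserving_fst d) (hS.measurePreserving_snd d)

include hA hS in
theorem oracleV (d : Draw) : IsOracle (Pr.map (smp d)) c.M c.M1 (2 * (c.Lg : ℝ) ^ 2)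
      (2 * c.σf ^ 2 + 2 * c.M ^ 2 * c.σgyy ^ 2)
      (fun w (u : Args p q) => dirV (F w.1) (G w.2) u.1 u.2.1 u.2.2)
      (fun u => dirV (expected P F) (expected Q G) u.1 u.2.1 u.2.2) :=
  have := Measure.isProbabilityMeasure_map (μ := Pr) (hS.meas d).aemeasurable
  hA.isOracle_dirV (hS.measurePreserving_fst d) (hS.measurePreserving_snd d)

variable {a : Params} {k : ℕ} {u : Ω → VState p q} {xn : Ω → Vec p} {yn : Ω → Vec q}

/-- The random states of the auxiliary-variable loop. -/
noncomputable def vPath (a : Params) (F : Ξ → Joint p q → ℝ) (G : Z → Joint p q → ℝ)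
    (smp : Draw → Ω → Ξ × Z) (k : ℕ) (u : Ω → VState p q) (xn : Ω → Vec p) (yn : Ω → Vec q)
    (j : ℕ) (ω : Ω) : VState p q :=
  vLoop a F G (fun d => smp d ω) k (u ω) (xn ω) (yn ω) j

omit [MeasurableSpace Ξ] [MeasurableSpace Z] m0 in
theorem vPath_x_succ (j : ℕ) (ω : Ω) : (vPath a F G smp k u xn yn (j + 1) ω).x = xn ω := rfl

omit [MeasurableSpace Ξ] [MeasurableSpace Z] m0 in
theorem vPath_y_succ (j : ℕ) (ω : Ω) : (vPath a F G smp k u xn yn (j + 1) ω).y = yn ω := rfl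

omit [MeasurableSpace Ξ] [MeasurableSpace Z] m0 in
theorem vPath_v_succ (j : ℕ) (ω : Ω) : (vPath a F G smp k u xn yn (j + 1) ω).v =
    projBall a.M ((vPath a F G smp k u xn yn j ω).v
      - (a.lam2 * a.η) • (vPath a F G smp k u xn yn j ω).Dv) := rfl

omit [IsProbabilityMeasure Pr] in
theorem L2Adapted.projBall {n : ℕ} {f : Ω → Vec n} (hm : m ≤ m0) {M : ℝ} (hM : 0 ≤ M)
    (hf : L2Adapted Pr m f) : L2Adapted Pr m fun ω => projBall M (f ω) :=
  ⟨measurable_projBall.comp hf.meas,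
    memLp_of_sq_le (measurable_projBall.comp (hf.meas.mono hm le_rfl)).aestronglyMeasurable
      hf.integrable_sq fun ω => by
        have := norm_projBall_sub_le (v := f ω) (w := 0) (by simpa using hM)
        rw [sub_zero, sub_zero] at this
        gcongr⟩

include hA hS in
theorem vPath_adapted (hM : a.M = c.M)
    (hu : VAdapted Pr (hist smp (past a.T k (1 + a.T))) c.M u)
    (hxn : L2Adapted Pr (hist smp (past a.T k (1 + a.T))) xn)
    (hyn : L2Adapted Pr (hist smp (past a.T k (1 + a.T))) yn) (j : ℕ) :
    VAdapted Pr (hist smp (past a.T k (1 + a.T + j))) c.M (vPath a F G smp k u xn yn j) := by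
  induction j with
  | zero => exact hu
  | succ j ih =>
    have hle : hist smp (past a.T k (1 + a.T + j)) ≤ hist smp (past a.T k (1 + a.T + (j + 1))) :=
      hist_mono (past_mono (by omega))
    have hx : L2Adapted Pr (hist smp (past a.T k (1 + a.T + (j + 1)))) xn :=
      hxn.mono (hist_mono (past_mono (by omega)))
    have hy : L2Adapted Pr (hist smp (past a.T k (1 + a.T + (j + 1)))) yn :=
      hyn.mono (hist_mono (past_mono (by omega)))
    have hM0 : 0 ≤ a.M := hM ▸ hA.regular.M_nonneg
    have hv : L2Adapted Pr (hist smp (past a.T k (1 + a.T + (j + 1))))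
        fun ω => (vPath a F G smp k u xn yn (j + 1) ω).v :=
      ((ih.v.mono hle).sub ((ih.Dv.mono hle).const_smul _)).projBall (hist_le hS.meas _) hM0
    have hdx : ∀ i, Draw.x2 k j i ∈ past a.T k (1 + a.T + (j + 1)) := fun i =>
      mem_past rfl (by simp only [Draw.phase]; omega)
    have hdv : ∀ i, Draw.v2 k j i ∈ past a.T k (1 + a.T + (j + 1)) := fun i =>
      mem_past rfl (by simp only [Draw.phase]; omega)
    have hn : ∀ ω, ‖(vPath a F G smp k u xn yn (j + 1) ω).v‖ ≤ c.M := fun ω => by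
      rw [vPath_v_succ, ← hM]; exact norm_projBall_le hM0 _
    have hp1 := ih.point.mono hle
    have hp2 : IsOracle.Point Pr (hist smp (past a.T k (1 + a.T + (j + 1)))) c.M
        fun ω => (xn ω, yn ω, (vPath a F G smp k u xn yn (j + 1) ω).v) := ⟨hx, hy, hv, hn⟩
    have hb1 := IsOracle.adapted_batchMean hS.meas (fun i => oracleX hA hS (.x2 k j i)) hdx hp1 a.S2
    have hb2 := IsOracle.adapted_batchMean hS.meas (fun i => oracleX hA hS (.x2 k j i)) hdx hp2 a.S2
    have hb3 := IsOracle.adapted_batchMean hS.meas (fun i => oracleV hA hS (.v2 k j i)) hdv hp1 a.S2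
    have hb4 := IsOracle.adapted_batchMean hS.meas (fun i => oracleV hA hS (.v2 k j i)) hdv hp2 a.S2
    exact ⟨hx, hy, hv, hb2.add (((ih.Dx.mono hle).sub hb1).const_smul _),
      hb4.add (((ih.Dv.mono hle).sub hb3).const_smul _), hn⟩

-- The new point of step `j` is already determined before the batches of that step are drawn, as the
-- SPIDER recursion requires.
include hA hS in
theorem vPath_point_succ (hM : a.M = c.M)
    (hu : VAdapted Pr (hist smp (past a.T k (1 + a.T))) c.M u)
    (hxn : L2Adapted Pr (hist smp (past a.T k (1 + a.T))) xn)
    (hyn : L2Adapted Pr (hist smp (past a.T k (1 + a.T))) yn) (j : ℕ) :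
    IsOracle.Point Pr (hist smp (past a.T k (1 + a.T + j))) c.M
      fun ω => (xn ω, yn ω, (vPath a F G smp k u xn yn (j + 1) ω).v) := by
  have h := vPath_adapted hA hS hM hu hxn hyn j
  have hM0 : 0 ≤ a.M := hM ▸ hA.regular.M_nonneg
  exact ⟨hxn.mono (hist_mono (past_mono (by omega))), hyn.mono (hist_mono (past_mono (by omega))),
    (h.v.sub (h.Dv.const_smul _)).projBall (hist_le hS.meas _) hM0, fun ω => by
      rw [vPath_v_succ, ← hM]; exact norm_projBall_le hM0 _⟩

include hA hS in
/-- The mean squared movement in one step of the auxiliary-variable loop. -/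
theorem vPath_move_le (hM : a.M = c.M)
    (hu : VAdapted Pr (hist smp (past a.T k (1 + a.T))) c.M u)
    (hxn : L2Adapted Pr (hist smp (past a.T k (1 + a.T))) xn)
    (hyn : L2Adapted Pr (hist smp (past a.T k (1 + a.T))) yn) (j : ℕ) :
    ∫ ω, IsOracle.Point.sqDist c.M1 (2 * (c.Lg : ℝ) ^ 2)
      (xn ω, yn ω, (vPath a F G smp k u xn yn (j + 1) ω).v)
      ((vPath a F G smp k u xn yn j ω).x, (vPath a F G smp k u xn yn j ω).y,
        (vPath a F G smp k u xn yn j ω).v) ∂Pr ≤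
      c.M1 * (∫ ω, ‖(vPath a F G smp k u xn yn (j + 1) ω).x
          - (vPath a F G smp k u xn yn j ω).x‖ ^ 2 ∂Pr
        + ∫ ω, ‖(vPath a F G smp k u xn yn (j + 1) ω).y
          - (vPath a F G smp k u xn yn j ω).y‖ ^ 2 ∂Pr) +
        (2 * (c.Lg : ℝ) ^ 2 * (a.lam2 * a.η) ^ 2) *
          ∫ ω, ‖(vPath a F G smp k u xn yn j ω).Dv‖ ^ 2 ∂Pr := by
  have h := vPath_adapted hA hS hM hu hxn hyn j
  have hp := vPath_point_succ hA hS hM hu hxn hyn j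
  have e : ∀ ω, IsOracle.Point.sqDist c.M1 (2 * (c.Lg : ℝ) ^ 2)
      (xn ω, yn ω, (vPath a F G smp k u xn yn (j + 1) ω).v)
      ((vPath a F G smp k u xn yn j ω).x, (vPath a F G smp k u xn yn j ω).y,
        (vPath a F G smp k u xn yn j ω).v) ≤
      c.M1 * ‖(vPath a F G smp k u xn yn (j + 1) ω).x - (vPath a F G smp k u xn yn j ω).x‖ ^ 2
      + c.M1 * ‖(vPath a F G smp k u xn yn (j + 1) ω).y - (vPath a F G smp k u xn yn j ω).y‖ ^ 2
      + (2 * (c.Lg : ℝ) ^ 2 * (a.lam2 * a.η) ^ 2) * ‖(vPath a F G smp k u xn yn j ω).Dv‖ ^ 2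
      + 0 * (0 : ℝ) := fun ω => by
    simp only [IsOracle.Point.sqDist, vPath_x_succ, vPath_y_succ, vPath_v_succ, hM]
    -- The old iterate lies in the ball, so the projected step is no longer than the unprojected
    -- one.
    have h1 := norm_projBall_sub_le (v := (vPath a F G smp k u xn yn j ω).v
      - (a.lam2 * a.η) • (vPath a F G smp k u xn yn j ω).Dv) (h.norm_le ω)
    rw [sub_sub_cancel_left, norm_neg, norm_smul] at h1
    have h2 := pow_le_pow_left₀ (norm_nonneg _) h1 2
    rw [mul_pow, Real.norm_eq_abs, sq_abs] at h2
    have h3 := mul_le_mul_of_nonneg_left h2 (show 0 ≤ 2 * (c.Lg : ℝ) ^ 2 by positivity)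
    linarith
  have h1 := integral_le_combination (hp.integrable_sqDist h.point) (hp.x.sub h.x).integrable_sq
    (hp.y.sub h.y).integrable_sq h.Dv.integrable_sq (integrable_const 0) e
  refine h1.trans_eq ?_
  simp only [vPath_x_succ, vPath_y_succ]
  ring

include hA hS in
theorem vPath_errorX_succ (hτ : a.τx = 0) (hM : a.M = c.M) (hS2 : 0 < a.S2)
    (hu : VAdapted Pr (hist smp (past a.T k (1 + a.T))) c.M u)
    (hxn : L2Adapted Pr (hist smp (past a.T k (1 + a.T))) xn)
    (hyn : L2Adapted Pr (hist smp (past a.T k (1 + a.T))) yn) (j : ℕ) :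
    ∫ ω, ‖(vPath a F G smp k u xn yn (j + 1) ω).Dx - dirX (expected P F) (expected Q G)
        (vPath a F G smp k u xn yn (j + 1) ω).x (vPath a F G smp k u xn yn (j + 1) ω).y
        (vPath a F G smp k u xn yn (j + 1) ω).v‖ ^ 2 ∂Pr ≤
      ∫ ω, ‖(vPath a F G smp k u xn yn j ω).Dx - dirX (expected P F) (expected Q G)
        (vPath a F G smp k u xn yn j ω).x (vPath a F G smp k u xn yn j ω).y
        (vPath a F G smp k u xn yn j ω).v‖ ^ 2 ∂Pr +
      (c.M1 * (∫ ω, ‖(vPath a F G smp k u xn yn (j + 1) ω).x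
          - (vPath a F G smp k u xn yn j ω).x‖ ^ 2 ∂Pr
        + ∫ ω, ‖(vPath a F G smp k u xn yn (j + 1) ω).y
          - (vPath a F G smp k u xn yn j ω).y‖ ^ 2 ∂Pr) +
        (2 * (c.Lg : ℝ) ^ 2 * (a.lam2 * a.η) ^ 2) *
          ∫ ω, ‖(vPath a F G smp k u xn yn j ω).Dv‖ ^ 2 ∂Pr) / a.S2 := by
  have h := vPath_adapted hA hS hM hu hxn hyn j
  have hp := vPath_point_succ hA hS hM hu hxn hyn j
  have h1 := IsOracle.integral_sq_spider_le (d := fun i => Draw.x2 k j i) hS.meas hS.indep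
    (fun i j hij => by simpa using hij)
    (fun i => notMem_past (T := a.T) (k := k) (n := 1 + a.T + j) rfl le_rfl)
    (fun i => oracleX hA hS (.x2 k j i)) h.point hp h.Dx hS2
  have e : ∀ ω, (vPath a F G smp k u xn yn (j + 1) ω).Dx =
    (batchMean a.S2 (fun i => smp (.x2 k j i) ω) fun w =>
      dirX (F w.1) (G w.2) (xn ω) (yn ω) (vPath a F G smp k u xn yn (j + 1) ω).v) + (1 - (0 : ℝ)) •
      ((vPath a F G smp k u xn yn j ω).Dx - batchMean a.S2 (fun i => smp (.x2 k j i) ω) fun w =>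
      dirX (F w.1) (G w.2) (vPath a F G smp k u xn yn j ω).x (vPath a F G smp k u xn yn j ω).y
        (vPath a F G smp k u xn yn j ω).v) := fun ω => by
    rw [← hτ]; rfl
  simp_rw [e]
  refine h1.trans ?_
  gcongr
  exact vPath_move_le hA hS hM hu hxn hyn j

include hA hS in
theorem vPath_errorV_succ (hτ : a.τv = 0) (hM : a.M = c.M) (hS2 : 0 < a.S2)
    (hu : VAdapted Pr (hist smp (past a.T k (1 + a.T))) c.M u)
    (hxn : L2Adapted Pr (hist smp (past a.T k (1 + a.T))) xn)
    (hyn : L2Adapted Pr (hist smp (past a.T k (1 + a.T))) yn) (j : ℕ) :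
    ∫ ω, ‖(vPath a F G smp k u xn yn (j + 1) ω).Dv - dirV (expected P F) (expected Q G)
        (vPath a F G smp k u xn yn (j + 1) ω).x (vPath a F G smp k u xn yn (j + 1) ω).y
        (vPath a F G smp k u xn yn (j + 1) ω).v‖ ^ 2 ∂Pr ≤
      ∫ ω, ‖(vPath a F G smp k u xn yn j ω).Dv - dirV (expected P F) (expected Q G)
        (vPath a F G smp k u xn yn j ω).x (vPath a F G smp k u xn yn j ω).y
        (vPath a F G smp k u xn yn j ω).v‖ ^ 2 ∂Pr +
      (c.M1 * (∫ ω, ‖(vPath a F G smp k u xn yn (j + 1) ω).x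
          - (vPath a F G smp k u xn yn j ω).x‖ ^ 2 ∂Pr
        + ∫ ω, ‖(vPath a F G smp k u xn yn (j + 1) ω).y
          - (vPath a F G smp k u xn yn j ω).y‖ ^ 2 ∂Pr) +
        (2 * (c.Lg : ℝ) ^ 2 * (a.lam2 * a.η) ^ 2) *
          ∫ ω, ‖(vPath a F G smp k u xn yn j ω).Dv‖ ^ 2 ∂Pr) / a.S2 := by
  have h := vPath_adapted hA hS hM hu hxn hyn j
  have hp := vPath_point_succ hA hS hM hu hxn hyn j
  have h1 := IsOracle.integral_sq_spider_le (d := fun i => Draw.v2 k j i) hS.meas hS.indep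
    (fun i j hij => by simpa using hij)
    (fun i => notMem_past (T := a.T) (k := k) (n := 1 + a.T + j) rfl le_rfl)
    (fun i => oracleV hA hS (.v2 k j i)) h.point hp h.Dv hS2
  have e : ∀ ω, (vPath a F G smp k u xn yn (j + 1) ω).Dv =
    (batchMean a.S2 (fun i => smp (.v2 k j i) ω) fun w =>
      dirV (F w.1) (G w.2) (xn ω) (yn ω) (vPath a F G smp k u xn yn (j + 1) ω).v) + (1 - (0 : ℝ)) •
      ((vPath a F G smp k u xn yn j ω).Dv - batchMean a.S2 (fun i => smp (.v2 k j i) ω) fun w =>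
      dirV (F w.1) (G w.2) (vPath a F G smp k u xn yn j ω).x (vPath a F G smp k u xn yn j ω).y
        (vPath a F G smp k u xn yn j ω).v) := fun ω => by
    rw [← hτ]; rfl
  simp_rw [e]
  refine h1.trans ?_
  gcongr
  exact vPath_move_le hA hS hM hu hxn hyn j

-- `sq_norm_step_le` with exact direction H(v - v*), where H is the Hessian at the current, inexact
-- y. The error then consists of the estimation error and of D_v(x, y, v*), the price of y ≠ y*(x).
include hA hS in
theorem vPath_dist_succ (hμL : c.μ ≤ c.Lg) (hs : 0 < a.lam2 * a.η)
    (hsL : a.lam2 * a.η * (4 * c.Lg) ≤ 1) (hM : a.M = c.M)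
    (hu : VAdapted Pr (hist smp (past a.T k (1 + a.T))) c.M u)
    (hxn : L2Adapted Pr (hist smp (past a.T k (1 + a.T))) xn)
    (hyn : L2Adapted Pr (hist smp (past a.T k (1 + a.T))) yn) (j : ℕ) :
    ∫ ω, ‖(vPath a F G smp k u xn yn (j + 1) ω).v - auxSol (expected P F) (expected Q G)
        (vPath a F G smp k u xn yn (j + 1) ω).x‖ ^ 2 ∂Pr ≤
      (1 - a.lam2 * a.η * c.μ / 4) * ∫ ω, ‖(vPath a F G smp k u xn yn j ω).v
        - auxSol (expected P F) (expected Q G) (vPath a F G smp k u xn yn j ω).x‖ ^ 2 ∂Pr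
      + (-(a.lam2 * a.η / (4 * c.Lg))) * ∫ ω, ‖(vPath a F G smp k u xn yn j ω).Dv‖ ^ 2 ∂Pr
      + 4 * (a.lam2 * a.η) / c.μ *
        (2 * ∫ ω, ‖(vPath a F G smp k u xn yn j ω).Dv - dirV (expected P F) (expected Q G)
          (vPath a F G smp k u xn yn j ω).x (vPath a F G smp k u xn yn j ω).y
          (vPath a F G smp k u xn yn j ω).v‖ ^ 2 ∂Pr
        + 2 * c.M1 * ∫ ω, ‖(vPath a F G smp k u xn yn j ω).y - lowerSol (expected Q G)
          (vPath a F G smp k u xn yn j ω).x‖ ^ 2 ∂Pr)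
      + (5 / (a.lam2 * a.η * c.μ) * c.Cv ^ 2) *
        ∫ ω, ‖(vPath a F G smp k u xn yn (j + 1) ω).x
          - (vPath a F G smp k u xn yn j ω).x‖ ^ 2 ∂Pr := by
  have hR := hA.regular
  have hle : ∀ D, hist smp D ≤ m0 := hist_le hS.meas
  have h := vPath_adapted hA hS hM hu hxn hyn j
  have h' := vPath_adapted hA hS hM hu hxn hyn (j + 1)
  have hmono : hist smp (past a.T k (1 + a.T + j)) ≤ hist smp (past a.T k (1 + a.T + (j + 1))) :=
    hist_mono (past_mono (by omega))
  have iE := (h.Dv.sub ((oracleV hA hS (.x1 0 0)).adapted_bar (hle _) h.point)).integrable_sq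
  have iY := (h.y.sub (adapted_lowerSol hA (hle _) h.x)).integrable_sq
  have key := integral_le_combination
    (h'.v.sub (adapted_auxSol hA (hle _) h'.x)).integrable_sq
    (h.v.sub (adapted_auxSol hA (hle _) h.x)).integrable_sq h.Dv.integrable_sq
    ((iE.const_mul 2).add (iY.const_mul (2 * c.M1)))
    (h'.x.sub (h.x.mono hmono)).integrable_sq
    (c₁ := 1 - a.lam2 * a.η * c.μ / 4) (c₂ := -(a.lam2 * a.η / (4 * c.Lg)))
    (c₃ := 4 * (a.lam2 * a.η) / c.μ) (c₄ := 5 / (a.lam2 * a.η * c.μ) * c.Cv ^ 2) fun ω => by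
    set V := vPath a F G smp k u xn yn j ω
    set V' := vPath a F G smp k u xn yn (j + 1) ω with hV'
    have hv' : V'.v = projBall c.M (V.v - (a.lam2 * a.η) • V.Dv) := by rw [← hM]; rfl
    have hμ := hA.μ_pos
    set vs := auxSol (expected P F) (expected Q G) V.x
    have hD : hessYY (expected Q G) (pt V.x V.y) (V.v - vs) + (V.Dv
        - hessYY (expected Q G) (pt V.x V.y) (V.v - vs)) = V.Dv := add_sub_cancel _ _
    have h1 := sq_norm_step_le hA.μ_pos hμL hs hsL
      (e := V.Dv - hessYY (expected Q G) (pt V.x V.y) (V.v - vs))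
      (r := vs - auxSol (expected P F) (expected Q G) V'.x) (w' := V'.v - vs)
      (hR.hessYY_coercive (pt V.x V.y) (V.v - vs) (hμ.trans_le hμL)) (by
        rw [hD, hv', sub_right_comm]
        exact norm_projBall_sub_le (hR.norm_auxSol_le _))
    rw [hD, sub_add_sub_cancel] at h1
    have h2 := hR.norm_auxSol_sub_le V'.x V.x
    rw [norm_sub_rev] at h2
    have h3 : ‖vs - auxSol (expected P F) (expected Q G) V'.x‖ ^ 2 ≤
        c.Cv ^ 2 * ‖V'.x - V.x‖ ^ 2 := by
      rw [← mul_pow]; gcongr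
    have h4 : 5 / (a.lam2 * a.η * c.μ) *
        ‖vs - auxSol (expected P F) (expected Q G) V'.x‖ ^ 2 ≤
        5 / (a.lam2 * a.η * c.μ) * (c.Cv ^ 2 * ‖V'.x - V.x‖ ^ 2) := by
      gcongr
    -- D_v vanishes at (x, y*(x), v*), so D_v(x, y, v*) is controlled by the distance of y to y*(x).
    have h5 := hR.sq_norm_dirV_sub_le V.x V.x V.y (lowerSol (expected Q G) V.x) vs vs
      (hR.norm_auxSol_le _)
    rw [hR.dirV_auxSol, sub_zero] at h5
    have h6 : V.Dv - hessYY (expected Q G) (pt V.x V.y) (V.v - vs) =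
        (V.Dv - dirV (expected P F) (expected Q G) V.x V.y V.v)
        + dirV (expected P F) (expected Q G) V.x V.y vs := by
      simp only [dirV, map_sub]; abel
    have h7 : ‖V.Dv - hessYY (expected Q G) (pt V.x V.y) (V.v - vs)‖ ^ 2 ≤
        2 * ‖V.Dv - dirV (expected P F) (expected Q G) V.x V.y V.v‖ ^ 2 +
        2 * c.M1 * ‖V.y - lowerSol (expected Q G) V.x‖ ^ 2 := by
      rw [h6]
      refine (pow_le_pow_left₀ (norm_nonneg _) (norm_add_le _ _) 2).trans (add_sq_le.trans ?_)
      simp only [sub_self, norm_zero] at h5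
      linarith
    have h8 := mul_le_mul_of_nonneg_left h7
      (show 0 ≤ 4 * (a.lam2 * a.η) / c.μ by positivity)
    simp only [Pi.add_apply]
    linarith
  have e := integral_add (iE.const_mul 2) (iY.const_mul (2 * c.M1))
  rw [integral_const_mul, integral_const_mul] at e
  refine key.trans_eq ?_
  congr 3

include hA hS in
/-- The effect of a whole auxiliary-variable loop on the distance to the solution and on the
errors. -/
theorem vPath_summary (hμL : c.μ ≤ c.Lg) (hs : 0 < a.lam2 * a.η)
    (hsL : a.lam2 * a.η * (4 * c.Lg) ≤ 1) (hτx : a.τx = 0) (hτv : a.τv = 0) (hM : a.M = c.M)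
    (hS2 : 0 < a.S2) (hJ : 0 < a.J)
    (hu : VAdapted Pr (hist smp (past a.T k (1 + a.T))) c.M u)
    (hxn : L2Adapted Pr (hist smp (past a.T k (1 + a.T))) xn)
    (hyn : L2Adapted Pr (hist smp (past a.T k (1 + a.T))) yn) :
    ∃ B : ℝ, 0 ≤ B ∧
      (∫ ω, ‖(vPath a F G smp k u xn yn a.J ω).v
          - auxSol (expected P F) (expected Q G) (xn ω)‖ ^ 2 ∂Pr ≤
        (1 - a.lam2 * a.η * c.μ / 4) *
          ∫ ω, ‖(u ω).v - auxSol (expected P F) (expected Q G) (u ω).x‖ ^ 2 ∂Pr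
        - a.lam2 * a.η / (4 * c.Lg) * B
        + 4 * (a.lam2 * a.η) / c.μ * (a.J *
          (2 * (∫ ω, ‖(u ω).Dv - dirV (expected P F) (expected Q G) (u ω).x (u ω).y
            (u ω).v‖ ^ 2 ∂Pr
          + (c.M1 * (∫ ω, ‖xn ω - (u ω).x‖ ^ 2 ∂Pr + ∫ ω, ‖yn ω - (u ω).y‖ ^ 2 ∂Pr)
            + 2 * (c.Lg : ℝ) ^ 2 * (a.lam2 * a.η) ^ 2 * B) / a.S2)
          + 2 * c.M1 * (∫ ω, ‖(u ω).y - lowerSol (expected Q G) (u ω).x‖ ^ 2 ∂Pr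
            + ∫ ω, ‖yn ω - lowerSol (expected Q G) (xn ω)‖ ^ 2 ∂Pr)))
        + 5 / (a.lam2 * a.η * c.μ) * c.Cv ^ 2 * ∫ ω, ‖xn ω - (u ω).x‖ ^ 2 ∂Pr) ∧
      (∫ ω, ‖(vPath a F G smp k u xn yn a.J ω).Dx - dirX (expected P F) (expected Q G) (xn ω)
          (yn ω) (vPath a F G smp k u xn yn a.J ω).v‖ ^ 2 ∂Pr ≤
        ∫ ω, ‖(u ω).Dx - dirX (expected P F) (expected Q G) (u ω).x (u ω).y (u ω).v‖ ^ 2 ∂Pr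
          + (c.M1 * (∫ ω, ‖xn ω - (u ω).x‖ ^ 2 ∂Pr + ∫ ω, ‖yn ω - (u ω).y‖ ^ 2 ∂Pr)
            + 2 * (c.Lg : ℝ) ^ 2 * (a.lam2 * a.η) ^ 2 * B) / a.S2) ∧
      ∫ ω, ‖(vPath a F G smp k u xn yn a.J ω).Dv - dirV (expected P F) (expected Q G) (xn ω)
          (yn ω) (vPath a F G smp k u xn yn a.J ω).v‖ ^ 2 ∂Pr ≤
        ∫ ω, ‖(u ω).Dv - dirV (expected P F) (expected Q G) (u ω).x (u ω).y (u ω).v‖ ^ 2 ∂Pr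
          + (c.M1 * (∫ ω, ‖xn ω - (u ω).x‖ ^ 2 ∂Pr + ∫ ω, ‖yn ω - (u ω).y‖ ^ 2 ∂Pr)
            + 2 * (c.Lg : ℝ) ^ 2 * (a.lam2 * a.η) ^ 2 * B) / a.S2 := by
  have hμ := hA.μ_pos
  have hM1 : 0 ≤ c.M1 := by rw [Constants.M1]; positivity
  obtain ⟨J', hJ'⟩ := Nat.exists_eq_succ_of_ne_zero hJ.ne'
  have hxJ : ∀ ω, (vPath a F G smp k u xn yn a.J ω).x = xn ω := fun ω => by
    rw [hJ', vPath_x_succ]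
  have hyJ : ∀ ω, (vPath a F G smp k u xn yn a.J ω).y = yn ω := fun ω => by
    rw [hJ', vPath_y_succ]
  set B : ℕ → ℝ := fun j => ∫ ω, ‖(vPath a F G smp k u xn yn j ω).Dv‖ ^ 2 ∂Pr with hBdef
  set mx : ℕ → ℝ := fun j => ∫ ω, ‖(vPath a F G smp k u xn yn (j + 1) ω).x
          - (vPath a F G smp k u xn yn j ω).x‖ ^ 2 ∂Pr with hmx
  set my : ℕ → ℝ := fun j => ∫ ω, ‖(vPath a F G smp k u xn yn (j + 1) ω).y
          - (vPath a F G smp k u xn yn j ω).y‖ ^ 2 ∂Pr with hmy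
  have hB0 : ∀ j, 0 ≤ B j := fun j => integral_nonneg fun ω => by positivity
  have hmx0 : ∀ j, 0 ≤ mx j := fun j => integral_nonneg fun ω => by positivity
  have hmy0 : ∀ j, 0 ≤ my j := fun j => integral_nonneg fun ω => by positivity
  have hmxsum : ∑ j ∈ Finset.range a.J, mx j = ∫ ω, ‖xn ω - (u ω).x‖ ^ 2 ∂Pr := by
    rw [sum_range_eq_zeroth (fun j => ?_) hJ]
    · rfl
    · simp [hmx, vPath_x_succ]
  have hmsum : ∑ j ∈ Finset.range a.J, (mx j + my j) =
      ∫ ω, ‖xn ω - (u ω).x‖ ^ 2 ∂Pr + ∫ ω, ‖yn ω - (u ω).y‖ ^ 2 ∂Pr := by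
    rw [sum_range_eq_zeroth (fun j => ?_) hJ]
    · rfl
    · simp [hmx, hmy, vPath_x_succ, vPath_y_succ]
  set eV : ℕ → ℝ := fun j => ∫ ω, ‖(vPath a F G smp k u xn yn j ω).Dv
        - dirV (expected P F) (expected Q G)
        (vPath a F G smp k u xn yn j ω).x (vPath a F G smp k u xn yn j ω).y
        (vPath a F G smp k u xn yn j ω).v‖ ^ 2 ∂Pr with heV
  set eX : ℕ → ℝ := fun j => ∫ ω, ‖(vPath a F G smp k u xn yn j ω).Dx
        - dirX (expected P F) (expected Q G)
        (vPath a F G smp k u xn yn j ω).x (vPath a F G smp k u xn yn j ω).y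
        (vPath a F G smp k u xn yn j ω).v‖ ^ 2 ∂Pr with heX
  have herrV : ∀ j ≤ a.J, eV j ≤ eV 0 + (c.M1 * (∫ ω, ‖xn ω - (u ω).x‖ ^ 2 ∂Pr
      + ∫ ω, ‖yn ω - (u ω).y‖ ^ 2 ∂Pr)
      + 2 * (c.Lg : ℝ) ^ 2 * (a.lam2 * a.η) ^ 2 * ∑ j ∈ Finset.range a.J, B j) / a.S2 := by
    intro j hj
    rw [← hmsum]
    exact accumulate_le hM1 (by positivity) (Nat.cast_nonneg _)
      (fun j => add_nonneg (hmx0 j) (hmy0 j)) hB0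
      (fun j _ => vPath_errorV_succ hA hS hτv hM hS2 hu hxn hyn j) hj
  have herrX : ∀ j ≤ a.J, eX j ≤ eX 0 + (c.M1 * (∫ ω, ‖xn ω - (u ω).x‖ ^ 2 ∂Pr
      + ∫ ω, ‖yn ω - (u ω).y‖ ^ 2 ∂Pr)
      + 2 * (c.Lg : ℝ) ^ 2 * (a.lam2 * a.η) ^ 2 * ∑ j ∈ Finset.range a.J, B j) / a.S2 := by
    intro j hj
    rw [← hmsum]
    exact accumulate_le hM1 (by positivity) (Nat.cast_nonneg _)
      (fun j => add_nonneg (hmx0 j) (hmy0 j)) hB0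
      (fun j _ => vPath_errorX_succ hA hS hτx hM hS2 hu hxn hyn j) hj
  refine ⟨∑ j ∈ Finset.range a.J, B j, Finset.sum_nonneg fun j _ => hB0 j, ?_, ?_, ?_⟩
  · set dy : ℕ → ℝ := fun j => ∫ ω, ‖(vPath a F G smp k u xn yn j ω).y - lowerSol (expected Q G)
          (vPath a F G smp k u xn yn j ω).x‖ ^ 2 ∂Pr with hdy
    set dy0 : ℝ := ∫ ω, ‖(u ω).y - lowerSol (expected Q G) (u ω).x‖ ^ 2 ∂Pr with hdy0
    set dy1 : ℝ := ∫ ω, ‖yn ω - lowerSol (expected Q G) (xn ω)‖ ^ 2 ∂Pr with hdy1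
    have hdy0n : 0 ≤ dy0 := integral_nonneg fun ω => by positivity
    have hdy1n : 0 ≤ dy1 := integral_nonneg fun ω => by positivity
    -- The first step still uses (x_k, y_k), all later ones use (x_{k+1}, y_{k+1}). This puts the
    -- lower-level distance at k + 1 on the right-hand side.
    have hdyle : ∀ j, dy j ≤ dy0 + dy1 := by
      rintro (_ | j)
      · change dy0 ≤ _; linarith
      · change dy1 ≤ _; linarith
    have h1 := loop_sum_le (κ := a.lam2 * a.η * c.μ / 4) (by positivity)
      (d := fun j => ∫ ω, ‖(vPath a F G smp k u xn yn j ω).v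
        - auxSol (expected P F) (expected Q G) (vPath a F G smp k u xn yn j ω).x‖ ^ 2 ∂Pr)
      (e := fun j => 2 * eV j + 2 * c.M1 * dy j)
      (fun t => integral_nonneg fun ω => by positivity) hJ
      (fun t _ => vPath_dist_succ hA hS hμL hs hsL hM hu hxn hyn t)
    have h2 : ∑ j ∈ Finset.range a.J, (2 * eV j + 2 * c.M1 * dy j) ≤ a.J * (2 * (eV 0 +
        (c.M1 * (∫ ω, ‖xn ω - (u ω).x‖ ^ 2 ∂Pr + ∫ ω, ‖yn ω - (u ω).y‖ ^ 2 ∂Pr)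
            + 2 * (c.Lg : ℝ) ^ 2 * (a.lam2 * a.η) ^ 2 * ∑ j ∈ Finset.range a.J, B j) / a.S2)
        + 2 * c.M1 * (dy0 + dy1)) := by
      refine (Finset.sum_le_card_nsmul _ _ _ fun j hj => add_le_add
        (mul_le_mul_of_nonneg_left (herrV j (Finset.mem_range.1 hj).le) two_pos.le)
        (mul_le_mul_of_nonneg_left (hdyle j) (by positivity))).trans_eq ?_
      rw [Finset.card_range, nsmul_eq_mul]
    simp_rw [hxJ] at h1
    have h3 := mul_le_mul_of_nonneg_left h2 (show 0 ≤ 4 * (a.lam2 * a.η) / c.μ by positivity)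
    rw [hmxsum] at h1
    refine h1.trans ?_
    gcongr ?_ + _
    gcongr ?_ + ?_
    · exact le_rfl
    · exact h3
  · have h1 := herrX a.J le_rfl
    simp only [heX, hxJ, hyJ] at h1
    exact h1
  · have h1 := herrV a.J le_rfl
    simp only [heV, hxJ, hyJ] at h1
    exact h1

end VLoop

end Loops

/-! ### One outer iteration -/

/-- All components of the random state are square integrable and measurable with respect to `m`,
and `v` is in the ball of radius `M`. -/
structure SAdapted {p q : ℕ} {Ω : Type*} [m0 : MeasurableSpace Ω] (Pr : Measure Ω)
    (m : MeasurableSpace Ω) (M : ℝ) (u : Ω → State p q) : Prop where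
  x : @L2Adapted Ω m0 p Pr m fun ω => (u ω).x
  y : @L2Adapted Ω m0 q Pr m fun ω => (u ω).y
  v : @L2Adapted Ω m0 q Pr m fun ω => (u ω).v
  Dx : @L2Adapted Ω m0 p Pr m fun ω => (u ω).Dx
  Dy : @L2Adapted Ω m0 q Pr m fun ω => (u ω).Dy
  Dv : @L2Adapted Ω m0 q Pr m fun ω => (u ω).Dv
  norm_le : ∀ ω, ‖(u ω).v‖ ≤ M

/-- The parameters are those of the variance-reduced variant, with admissible step sizes. -/
structure IsSpider (c : Constants) (a : Params) : Prop where
  τx : a.τx = 0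
  τy : a.τy = 0
  τv : a.τv = 0
  M : a.M = c.M
  S1 : 0 < a.S1
  S2 : 0 < a.S2
  T : 0 < a.T
  J : 0 < a.J
  s1_pos : 0 < a.lam1 * a.β
  s2_pos : 0 < a.lam2 * a.η
  s1_le : a.lam1 * a.β * (4 * c.Lg) ≤ 1
  s2_le : a.lam2 * a.η * (4 * c.Lg) ≤ 1
  α_pos : 0 < a.α
  α_le : a.α * c.LPhi ≤ 1 / 6

section Run

variable {p q : ℕ} {Ξ Z Ω : Type*} [MeasurableSpace Ξ] [MeasurableSpace Z]
  {m : MeasurableSpace Ω} [m0 : MeasurableSpace Ω]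
  {P : Measure Ξ} [IsProbabilityMeasure P] {Q : Measure Z} [IsProbabilityMeasure Q]
  {F : Ξ → Joint p q → ℝ} {G : Z → Joint p q → ℝ} {c : Constants}
  {Pr : Measure Ω} [IsProbabilityMeasure Pr] {smp : Draw → Ω → Ξ × Z}
  (hA : Assumptions P Q F G c) (hS : IsSampling P Q Pr smp)
  {a : Params} (ha : IsSpider c a) {x₀ : Vec p} {y₀ v₀ : Vec q}

section Refresh

variable (a F G) (s : Draw → Ξ × Z) (k : ℕ) (u : State p q)

omit [MeasurableSpace Ξ] [MeasurableSpace Z] in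
theorem refresh_x : (refresh a F G s k u).x = u.x := by unfold refresh; split_ifs <;> rfl

omit [MeasurableSpace Ξ] [MeasurableSpace Z] in
theorem refresh_y : (refresh a F G s k u).y = u.y := by unfold refresh; split_ifs <;> rfl

omit [MeasurableSpace Ξ] [MeasurableSpace Z] in
theorem refresh_v : (refresh a F G s k u).v = u.v := by unfold refresh; split_ifs <;> rfl

end Refresh

variable (a F G smp x₀ y₀ v₀) in
/-- The random state in outer iteration `k` after the estimates have been renewed. -/
noncomputable def rPath (k : ℕ) (ω : Ω) : State p q :=
  refresh a F G (fun d => smp d ω) k (run a F G (fun d => smp d ω) x₀ y₀ v₀ k)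

variable (a F G smp x₀ y₀ v₀) in
/-- The random upper-level point after outer iteration `k`. -/
noncomputable def xNext (k : ℕ) (ω : Ω) : Vec p :=
  (rPath F G smp a x₀ y₀ v₀ k ω).x - a.α • (rPath F G smp a x₀ y₀ v₀ k ω).Dx

variable (a F G smp x₀ y₀ v₀) in
/-- The random initial state of the lower-level loop in outer iteration `k`. -/
noncomputable def yInit (k : ℕ) (ω : Ω) : YState p q :=
  { x := (rPath F G smp a x₀ y₀ v₀ k ω).x
    y := (rPath F G smp a x₀ y₀ v₀ k ω).y
    Dy := (rPath F G smp a x₀ y₀ v₀ k ω).Dy }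

variable (a F G smp x₀ y₀ v₀) in
/-- The random initial state of the auxiliary-variable loop in outer iteration `k`. -/
noncomputable def vInit (k : ℕ) (ω : Ω) : VState p q :=
  { x := (rPath F G smp a x₀ y₀ v₀ k ω).x
    y := (rPath F G smp a x₀ y₀ v₀ k ω).y
    v := (rPath F G smp a x₀ y₀ v₀ k ω).v
    Dx := (rPath F G smp a x₀ y₀ v₀ k ω).Dx
    Dv := (rPath F G smp a x₀ y₀ v₀ k ω).Dv }

variable (a F G smp x₀ y₀ v₀) in
/-- The random final state of the lower-level loop in outer iteration `k`. -/
noncomputable def yLast (k : ℕ) (ω : Ω) : YState p q :=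
  yPath a G smp k (yInit F G smp a x₀ y₀ v₀ k) (xNext F G smp a x₀ y₀ v₀ k) a.T ω

variable (a F G smp x₀ y₀ v₀) in
/-- The random final state of the auxiliary-variable loop in outer iteration `k`. -/
noncomputable def vLast (k : ℕ) (ω : Ω) : VState p q :=
  vPath a F G smp k (vInit F G smp a x₀ y₀ v₀ k) (xNext F G smp a x₀ y₀ v₀ k)
    (fun ω => (yLast F G smp a x₀ y₀ v₀ k ω).y) a.J ω

omit [MeasurableSpace Ξ] [MeasurableSpace Z] m0 in
theorem run_succ (k : ℕ) (ω : Ω) : run a F G (fun d => smp d ω) x₀ y₀ v₀ (k + 1) =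
    { x := xNext F G smp a x₀ y₀ v₀ k ω
      y := (yLast F G smp a x₀ y₀ v₀ k ω).y
      v := (vLast F G smp a x₀ y₀ v₀ k ω).v
      Dx := (vLast F G smp a x₀ y₀ v₀ k ω).Dx
      Dy := (yLast F G smp a x₀ y₀ v₀ k ω).Dy
      Dv := (vLast F G smp a x₀ y₀ v₀ k ω).Dv } := rfl

include hA hS in
theorem refresh_adapted {k : ℕ} {u : Ω → State p q}
    (hu : SAdapted Pr (hist smp (past a.T k 0)) c.M u) :
    SAdapted Pr (hist smp (past a.T k 1)) c.M
      (fun ω => refresh a F G (fun d => smp d ω) k (u ω)) := by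
  have hle : hist smp (past a.T k 0) ≤ hist smp (past a.T k 1) :=
    hist_mono (past_mono zero_le_one)
  by_cases hk : k % a.q1 = 0
  · have hp : IsOracle.Point Pr (hist smp (past a.T k 1)) c.M
        fun ω => ((u ω).x, (u ω).y, (u ω).v) :=
      ⟨hu.x.mono hle, hu.y.mono hle, hu.v.mono hle, hu.norm_le⟩
    have hbx := IsOracle.adapted_batchMean hS.meas (fun i => oracleX hA hS (.x1 k i))
      (H := past a.T k 1) (fun i => mem_past rfl zero_lt_one) hp a.S1
    have hby := IsOracle.adapted_batchMean hS.meas (fun i => oracleY hA hS (.y1 k i))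
      (H := past a.T k 1) (fun i => mem_past rfl zero_lt_one) hp a.S1
    have hbv := IsOracle.adapted_batchMean hS.meas (fun i => oracleV hA hS (.v1 k i))
      (H := past a.T k 1) (fun i => mem_past rfl zero_lt_one) hp a.S1
    simp only [refresh, if_pos hk]
    exact ⟨hu.x.mono hle, hu.y.mono hle, hu.v.mono hle, hbx, hby, hbv, hu.norm_le⟩
  · simp only [refresh, if_neg hk]
    exact ⟨hu.x.mono hle, hu.y.mono hle, hu.v.mono hle, hu.Dx.mono hle, hu.Dy.mono hle,
      hu.Dv.mono hle, hu.norm_le⟩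

include hA hS ha in
theorem run_adapted (hv₀ : ‖v₀‖ ≤ c.M) (k : ℕ) : SAdapted Pr (hist smp (past a.T k 0)) c.M
    (fun ω => run a F G (fun d => smp d ω) x₀ y₀ v₀ k) := by
  induction k with
  | zero =>
    exact ⟨L2Adapted.const _, L2Adapted.const _, L2Adapted.const _, L2Adapted.const _,
      L2Adapted.const _, L2Adapted.const _, fun _ => hv₀⟩
  | succ k ih =>
    have hr := refresh_adapted hA hS ih
    have hxn : L2Adapted Pr (hist smp (past a.T k 1)) (xNext F G smp a x₀ y₀ v₀ k) :=
      hr.x.sub (hr.Dx.const_smul _)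
    have hyi : YAdapted Pr (hist smp (past a.T k 1)) (yInit F G smp a x₀ y₀ v₀ k) :=
      ⟨hr.x, hr.y, hr.Dy⟩
    have hy : YAdapted Pr (hist smp (past a.T k (1 + a.T))) (yLast F G smp a x₀ y₀ v₀ k) :=
      yPath_adapted hA hS hyi hxn a.T
    have hle : hist smp (past a.T k 1) ≤ hist smp (past a.T k (1 + a.T)) :=
      hist_mono (past_mono (by omega))
    have hv : VAdapted Pr (hist smp (past a.T k (1 + a.T + a.J))) c.M
        (vLast F G smp a x₀ y₀ v₀ k) := by
      have hvi : VAdapted Pr (hist smp (past a.T k (1 + a.T))) c.M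
          (vInit F G smp a x₀ y₀ v₀ k) :=
        ⟨hr.x.mono hle, hr.y.mono hle, hr.v.mono hle, hr.Dx.mono hle, hr.Dv.mono hle, hr.norm_le⟩
      exact vPath_adapted hA hS ha.M hvi (hxn.mono hle) hy.y a.J
    have hs : ∀ n, hist smp (past a.T k n) ≤ hist smp (past a.T (k + 1) 0) := fun n =>
      hist_mono (past_subset_succ _ _ _)
    exact ⟨hxn.mono (hs _), hy.y.mono (hs _), hv.v.mono (hs _), hv.Dx.mono (hs _),
      hy.Dy.mono (hs _), hv.Dv.mono (hs _), hv.norm_le⟩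

include hA hS ha in
theorem rPath_adapted (hv₀ : ‖v₀‖ ≤ c.M) (k : ℕ) : SAdapted Pr (hist smp (past a.T k 1)) c.M
    (rPath F G smp a x₀ y₀ v₀ k) :=
  refresh_adapted hA hS (run_adapted hA hS ha hv₀ k)

section Quantities

variable (P Q F G Pr smp a x₀ y₀ v₀) (k : ℕ)

/-- The mean square of `D_k^x`. -/
noncomputable def sqDx : ℝ := ∫ ω, ‖(rPath F G smp a x₀ y₀ v₀ k ω).Dx‖ ^ 2 ∂Pr

/-- The mean squared distance of `y_k` to the lower-level solution. -/
noncomputable def distY : ℝ := ∫ ω, ‖(rPath F G smp a x₀ y₀ v₀ k ω).y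
  - lowerSol (expected Q G) (rPath F G smp a x₀ y₀ v₀ k ω).x‖ ^ 2 ∂Pr

/-- The mean squared distance of `v_k` to the auxiliary solution. -/
noncomputable def distV : ℝ := ∫ ω, ‖(rPath F G smp a x₀ y₀ v₀ k ω).v
  - auxSol (expected P F) (expected Q G) (rPath F G smp a x₀ y₀ v₀ k ω).x‖ ^ 2 ∂Pr

/-- The mean squared error of `D_k^x`. -/
noncomputable def errX : ℝ := ∫ ω, ‖(rPath F G smp a x₀ y₀ v₀ k ω).Dx
  - dirX (expected P F) (expected Q G) (rPath F G smp a x₀ y₀ v₀ k ω).x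
    (rPath F G smp a x₀ y₀ v₀ k ω).y (rPath F G smp a x₀ y₀ v₀ k ω).v‖ ^ 2 ∂Pr

/-- The mean squared error of `D_k^y`. -/
noncomputable def errY : ℝ := ∫ ω, ‖(rPath F G smp a x₀ y₀ v₀ k ω).Dy
  - dirY (expected Q G) (rPath F G smp a x₀ y₀ v₀ k ω).x
    (rPath F G smp a x₀ y₀ v₀ k ω).y‖ ^ 2 ∂Pr

/-- The mean squared error of `D_k^v`. -/
noncomputable def errV : ℝ := ∫ ω, ‖(rPath F G smp a x₀ y₀ v₀ k ω).Dv
  - dirV (expected P F) (expected Q G) (rPath F G smp a x₀ y₀ v₀ k ω).x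
    (rPath F G smp a x₀ y₀ v₀ k ω).y (rPath F G smp a x₀ y₀ v₀ k ω).v‖ ^ 2 ∂Pr

/-- The mean of the value function. -/
noncomputable def meanPhi : ℝ :=
  ∫ ω, valueFun (expected P F) (expected Q G) (rPath F G smp a x₀ y₀ v₀ k ω).x ∂Pr

/-- The mean squared gradient of the value function. -/
noncomputable def sqGrad : ℝ := ∫ ω, ‖gradient (valueFun (expected P F) (expected Q G))
  (rPath F G smp a x₀ y₀ v₀ k ω).x‖ ^ 2 ∂Pr

end Quantities

theorem err_of_dvd_aux {k : ℕ} {u : Ω → State p q}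
    (hA : Assumptions P Q F G c) (hS : IsSampling P Q Pr smp) (hS1 : 0 < a.S1)
    (hk : k % a.q1 = 0) (hu : SAdapted Pr (hist smp (past a.T k 0)) c.M u) :
    (∫ ω, ‖(refresh a F G (fun d => smp d ω) k (u ω)).Dx
      - dirX (expected P F) (expected Q G) (u ω).x (u ω).y (u ω).v‖ ^ 2 ∂Pr ≤
      (2 * c.σf ^ 2 + 2 * c.M ^ 2 * c.σgxy ^ 2) / a.S1) ∧
    (∫ ω, ‖(refresh a F G (fun d => smp d ω) k (u ω)).Dy
      - dirY (expected Q G) (u ω).x (u ω).y‖ ^ 2 ∂Pr ≤ c.σg ^ 2 / a.S1) ∧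
    ∫ ω, ‖(refresh a F G (fun d => smp d ω) k (u ω)).Dv
      - dirV (expected P F) (expected Q G) (u ω).x (u ω).y (u ω).v‖ ^ 2 ∂Pr ≤
      (2 * c.σf ^ 2 + 2 * c.M ^ 2 * c.σgyy ^ 2) / a.S1 := by
  have hp : IsOracle.Point Pr (hist smp (past a.T k 0)) c.M
      fun ω => ((u ω).x, (u ω).y, (u ω).v) := ⟨hu.x, hu.y, hu.v, hu.norm_le⟩
  simp only [refresh, if_pos hk]
  exact ⟨IsOracle.integral_sq_batchMean_le (d := fun i => Draw.x1 k i) hS.meas hS.indep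
      (fun i j hij => by simpa using hij) (fun i => notMem_past rfl (Nat.zero_le _))
      (fun i => oracleX hA hS (.x1 k i)) hp hS1,
    IsOracle.integral_sq_batchMean_le (d := fun i => Draw.y1 k i) hS.meas hS.indep
      (fun i j hij => by simpa using hij) (fun i => notMem_past rfl (Nat.zero_le _))
      (fun i => oracleY hA hS (.y1 k i)) hp hS1,
    IsOracle.integral_sq_batchMean_le (d := fun i => Draw.v1 k i) hS.meas hS.indep
      (fun i j hij => by simpa using hij) (fun i => notMem_past rfl (Nat.zero_le _))
      (fun i => oracleV hA hS (.v1 k i)) hp hS1⟩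

include hA hS ha in
theorem err_of_dvd (hv₀ : ‖v₀‖ ≤ c.M) {k : ℕ} (hk : k % a.q1 = 0) :
    errX P Q F G Pr smp a x₀ y₀ v₀ k ≤ (2 * c.σf ^ 2 + 2 * c.M ^ 2 * c.σgxy ^ 2) / a.S1 ∧
    errY Q F G Pr smp a x₀ y₀ v₀ k ≤ c.σg ^ 2 / a.S1 ∧
    errV P Q F G Pr smp a x₀ y₀ v₀ k ≤ (2 * c.σf ^ 2 + 2 * c.M ^ 2 * c.σgyy ^ 2) / a.S1 := by
  have h := err_of_dvd_aux hA hS ha.S1 hk (run_adapted hA hS ha hv₀ k (x₀ := x₀) (y₀ := y₀))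
  simp only [errX, errY, errV, rPath, refresh_x, refresh_y, refresh_v]
  exact h

include hA hS ha in
theorem integrable_sqGrad (hq : 0 < q) (hv₀ : ‖v₀‖ ≤ c.M) (k : ℕ) :
    Integrable (fun ω => ‖gradient (valueFun (expected P F) (expected Q G))
      (rPath F G smp a x₀ y₀ v₀ k ω).x‖ ^ 2) Pr :=
  ((rPath_adapted hA hS ha hv₀ k).x.comp_lipschitz (hist_le hS.meas _)
    (hA.regular.norm_gradient_valueFun_sub_le hq)).integrable_sq

-- f and y* are Lipschitz, so Φ grows at most linearly.
omit [IsProbabilityMeasure P] [IsProbabilityMeasure Q] in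
include hA in
theorem integrable_valueFun (hm : m ≤ m0) {x : Ω → Vec p} (hx : L2Adapted Pr m x) :
    Integrable (fun ω => valueFun (expected P F) (expected Q G) (x ω)) Pr := by
  set Φ := valueFun (expected P F) (expected Q G) with hΦ
  have hR := hA.regular
  have h1 : ∀ x, |Φ x - Φ 0| ≤ c.Cf * ((1 + c.Lg / c.μ) * ‖x‖) := by
    intro x
    have e1 := hR.lip_f.lip.norm_sub_le (pt x (lowerSol (expected Q G) x))
      (pt 0 (lowerSol (expected Q G) 0))
    have e2 := hR.norm_pt_lowerSol_sub_le x 0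
    rw [sub_zero] at e2
    rw [pt_sub, sub_zero, Real.norm_eq_abs] at e1
    exact e1.trans (by gcongr)
  have h2 : Integrable (fun ω => Φ (x ω) - Φ 0) Pr := by
    have hxi : Integrable (fun ω => ‖x ω‖) Pr := (hx.memLp.integrable one_le_two).norm
    refine ((hxi.const_mul (1 + c.Lg / c.μ)).const_mul c.Cf).mono'
      ((hR.differentiable_valueFun.continuous.measurable.comp
        (hx.meas.mono hm le_rfl)).sub_const _).aestronglyMeasurable ?_
    exact Eventually.of_forall fun ω => h1 (x ω)
  simpa [Pi.add_def] using h2.add (integrable_const (Φ 0))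

-- Descent lemma for Φ along -αD, with -⟪∇Φ, D⟫ written by polarization as (‖D - ∇Φ‖² - ‖D‖² -
-- ‖∇Φ‖²)/2. The curvature term costs α/6 of the resulting α/2‖D‖² and leaves α/3. The distance of D
-- to ∇Φ splits into estimation error and tracking error.
include hA hS ha in
theorem meanPhi_succ_le (hq : 0 < q) (hv₀ : ‖v₀‖ ≤ c.M) (k : ℕ) :
    meanPhi P Q F G Pr smp a x₀ y₀ v₀ (k + 1) ≤ meanPhi P Q F G Pr smp a x₀ y₀ v₀ k
      - a.α / 2 * sqGrad P Q F G Pr smp a x₀ y₀ v₀ k - a.α / 3 * sqDx F G Pr smp a x₀ y₀ v₀ k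
      + a.α * errX P Q F G Pr smp a x₀ y₀ v₀ k
      + a.α * c.M1 * distY Q F G Pr smp a x₀ y₀ v₀ k
      + 2 * a.α * (c.Lg : ℝ) ^ 2 * distV P Q F G Pr smp a x₀ y₀ v₀ k := by
  have hR := hA.regular
  have hle : ∀ D, hist smp D ≤ m0 := hist_le hS.meas
  have hr := rPath_adapted hA hS ha hv₀ k (x₀ := x₀) (y₀ := y₀)
  have hp : IsOracle.Point Pr (hist smp (past a.T k 1)) c.M
      fun ω => ((rPath F G smp a x₀ y₀ v₀ k ω).x, (rPath F G smp a x₀ y₀ v₀ k ω).y,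
        (rPath F G smp a x₀ y₀ v₀ k ω).v) := ⟨hr.x, hr.y, hr.v, hr.norm_le⟩
  have hxn : L2Adapted Pr (hist smp (past a.T k 1)) (xNext F G smp a x₀ y₀ v₀ k) :=
    hr.x.sub (hr.Dx.const_smul _)
  have iG := integrable_sqGrad hA hS ha hq hv₀ k (x₀ := x₀) (y₀ := y₀)
  have iE := (hr.Dx.sub ((oracleX hA hS (.x1 0 0)).adapted_bar (hle _) hp)).integrable_sq
  have iY := (hr.y.sub (adapted_lowerSol hA (hle _) hr.x)).integrable_sq
  have iV := (hr.v.sub (adapted_auxSol hA (hle _) hr.x)).integrable_sq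
  have iΦ := integrable_valueFun hA (hle _) hr.x
  have iΦ' := integrable_valueFun hA (hle _) hxn
  have hpath : ∀ ω, valueFun (expected P F) (expected Q G) (xNext F G smp a x₀ y₀ v₀ k ω)
      - valueFun (expected P F) (expected Q G) (rPath F G smp a x₀ y₀ v₀ k ω).x
      + a.α / 2 * ‖gradient (valueFun (expected P F) (expected Q G))
        (rPath F G smp a x₀ y₀ v₀ k ω).x‖ ^ 2
      ≤ -(a.α / 3) * ‖(rPath F G smp a x₀ y₀ v₀ k ω).Dx‖ ^ 2
      + a.α * ‖(rPath F G smp a x₀ y₀ v₀ k ω).Dx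
        - dirX (expected P F) (expected Q G) (rPath F G smp a x₀ y₀ v₀ k ω).x
          (rPath F G smp a x₀ y₀ v₀ k ω).y (rPath F G smp a x₀ y₀ v₀ k ω).v‖ ^ 2
      + a.α * c.M1 * ‖(rPath F G smp a x₀ y₀ v₀ k ω).y
        - lowerSol (expected Q G) (rPath F G smp a x₀ y₀ v₀ k ω).x‖ ^ 2
      + 2 * a.α * (c.Lg : ℝ) ^ 2 * ‖(rPath F G smp a x₀ y₀ v₀ k ω).v
        - auxSol (expected P F) (expected Q G) (rPath F G smp a x₀ y₀ v₀ k ω).x‖ ^ 2 := by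
    intro ω
    have hnew : xNext F G smp a x₀ y₀ v₀ k ω = (rPath F G smp a x₀ y₀ v₀ k ω).x +
        -(a.α • (rPath F G smp a x₀ y₀ v₀ k ω).Dx) := sub_eq_add_neg _ _
    set r := rPath F G smp a x₀ y₀ v₀ k ω with hrdef
    set g := gradient (valueFun (expected P F) (expected Q G)) r.x with hg
    have h1 := hR.valueFun_descent hq r.x (-(a.α • r.Dx))
    rw [inner_neg_right, inner_smul_right, norm_neg, norm_smul, mul_pow, Real.norm_eq_abs,
      sq_abs] at h1
    have h2 : ‖r.Dx - g‖ ^ 2 ≤ 2 * ‖r.Dx - dirX (expected P F) (expected Q G) r.x r.y r.v‖ ^ 2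
        + 2 * (c.M1 * ‖r.y - lowerSol (expected Q G) r.x‖ ^ 2
        + 2 * (c.Lg : ℝ) ^ 2 * ‖r.v - auxSol (expected P F) (expected Q G) r.x‖ ^ 2) := by
      have e1 : r.Dx - g = (r.Dx - dirX (expected P F) (expected Q G) r.x r.y r.v)
          + (dirX (expected P F) (expected Q G) r.x r.y r.v - g) := by abel
      have e2 := hR.sq_norm_dirX_sub_le r.x r.x r.y (lowerSol (expected Q G) r.x) r.v
        (auxSol (expected P F) (expected Q G) r.x) (hr.norm_le ω)
      rw [← hR.gradient_valueFun] at e2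
      simp only [sub_self, norm_zero] at e2
      rw [e1]
      refine (pow_le_pow_left₀ (norm_nonneg _) (norm_add_le _ _) 2).trans (add_sq_le.trans ?_)
      linarith
    have h3 : ‖r.Dx - g‖ ^ 2 = ‖r.Dx‖ ^ 2 - 2 * ⟪g, r.Dx⟫ + ‖g‖ ^ 2 := by
      rw [norm_sub_sq_real, real_inner_comm]
    have h4 : c.LPhi * (a.α ^ 2 * ‖r.Dx‖ ^ 2) ≤ a.α / 6 * ‖r.Dx‖ ^ 2 := by
      have := mul_le_mul_of_nonneg_left ha.α_le
        (mul_nonneg ha.α_pos.le (sq_nonneg ‖r.Dx‖))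
      linarith
    have h5 := mul_le_mul_of_nonneg_left h2 (half_pos ha.α_pos).le
    rw [hnew]
    rw [h3] at h5
    linarith
  have key := integral_le_combination ((iΦ'.sub iΦ).add (iG.const_mul (a.α / 2)))
    hr.Dx.integrable_sq iE iY iV hpath
  have e1 := integral_add (iΦ'.sub iΦ) (iG.const_mul (a.α / 2))
  have e2 := integral_sub iΦ' iΦ
  rw [integral_const_mul] at e1
  have e3 : meanPhi P Q F G Pr smp a x₀ y₀ v₀ (k + 1) =
      ∫ ω, valueFun (expected P F) (expected Q G) (xNext F G smp a x₀ y₀ v₀ k ω) ∂Pr := by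
    simp only [meanPhi, rPath, refresh_x, run_succ]
  rw [e3]
  have e4 := e1.symm.trans_le key
  simp only [Pi.sub_apply] at e4
  rw [e2] at e4
  simp only [meanPhi, sqGrad, sqDx, errX, distY, distV]
  linarith

include hA hS ha in
/-- One outer iteration. -/
theorem iteration_summary (hq : 0 < q) (hv₀ : ‖v₀‖ ≤ c.M) (k : ℕ) :
    ∃ A B : ℝ, 0 ≤ A ∧ 0 ≤ B ∧
      (distY Q F G Pr smp a x₀ y₀ v₀ (k + 1) ≤
        (1 - a.lam1 * a.β * c.μ / 4) * distY Q F G Pr smp a x₀ y₀ v₀ k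
        - a.lam1 * a.β / (4 * c.Lg) * A
        + 4 * (a.lam1 * a.β) / c.μ * (a.T * (errY Q F G Pr smp a x₀ y₀ v₀ k
          + ((c.Lg : ℝ) ^ 2 * (a.α ^ 2 * sqDx F G Pr smp a x₀ y₀ v₀ k)
            + (c.Lg : ℝ) ^ 2 * (a.lam1 * a.β) ^ 2 * A) / a.S2))
        + 5 / (a.lam1 * a.β * c.μ) * c.Cy ^ 2 * (a.α ^ 2 * sqDx F G Pr smp a x₀ y₀ v₀ k)) ∧
      (distV P Q F G Pr smp a x₀ y₀ v₀ (k + 1) ≤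
        (1 - a.lam2 * a.η * c.μ / 4) * distV P Q F G Pr smp a x₀ y₀ v₀ k
        - a.lam2 * a.η / (4 * c.Lg) * B
        + 4 * (a.lam2 * a.η) / c.μ * (a.J * (2 * (errV P Q F G Pr smp a x₀ y₀ v₀ k
          + (c.M1 * (a.α ^ 2 * sqDx F G Pr smp a x₀ y₀ v₀ k + a.T * (a.lam1 * a.β) ^ 2 * A)
            + 2 * (c.Lg : ℝ) ^ 2 * (a.lam2 * a.η) ^ 2 * B) / a.S2)
          + 2 * c.M1 * (distY Q F G Pr smp a x₀ y₀ v₀ k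
            + distY Q F G Pr smp a x₀ y₀ v₀ (k + 1))))
        + 5 / (a.lam2 * a.η * c.μ) * c.Cv ^ 2 * (a.α ^ 2 * sqDx F G Pr smp a x₀ y₀ v₀ k)) ∧
      ((k + 1) % a.q1 ≠ 0 →
        errX P Q F G Pr smp a x₀ y₀ v₀ (k + 1) ≤ errX P Q F G Pr smp a x₀ y₀ v₀ k
          + (c.M1 * (a.α ^ 2 * sqDx F G Pr smp a x₀ y₀ v₀ k + a.T * (a.lam1 * a.β) ^ 2 * A)
            + 2 * (c.Lg : ℝ) ^ 2 * (a.lam2 * a.η) ^ 2 * B) / a.S2 ∧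
        errY Q F G Pr smp a x₀ y₀ v₀ (k + 1) ≤ errY Q F G Pr smp a x₀ y₀ v₀ k
          + ((c.Lg : ℝ) ^ 2 * (a.α ^ 2 * sqDx F G Pr smp a x₀ y₀ v₀ k)
            + (c.Lg : ℝ) ^ 2 * (a.lam1 * a.β) ^ 2 * A) / a.S2 ∧
        errV P Q F G Pr smp a x₀ y₀ v₀ (k + 1) ≤ errV P Q F G Pr smp a x₀ y₀ v₀ k
          + (c.M1 * (a.α ^ 2 * sqDx F G Pr smp a x₀ y₀ v₀ k + a.T * (a.lam1 * a.β) ^ 2 * A)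
            + 2 * (c.Lg : ℝ) ^ 2 * (a.lam2 * a.η) ^ 2 * B) / a.S2) := by
  have hR := hA.regular
  have hμ := hA.μ_pos
  have hμL := hR.μ_le_Lg hq
  have hM1 : 0 ≤ c.M1 := by rw [Constants.M1]; positivity
  have hs1 := ha.s1_pos
  have hs2 := ha.s2_pos
  have hr := rPath_adapted hA hS ha hv₀ k (x₀ := x₀) (y₀ := y₀)
  have hxn : L2Adapted Pr (hist smp (past a.T k 1)) (xNext F G smp a x₀ y₀ v₀ k) :=
    hr.x.sub (hr.Dx.const_smul _)
  have hyi : YAdapted Pr (hist smp (past a.T k 1)) (yInit F G smp a x₀ y₀ v₀ k) :=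
    ⟨hr.x, hr.y, hr.Dy⟩
  have hy : YAdapted Pr (hist smp (past a.T k (1 + a.T))) (yLast F G smp a x₀ y₀ v₀ k) :=
    yPath_adapted hA hS hyi hxn a.T
  have hle : hist smp (past a.T k 1) ≤ hist smp (past a.T k (1 + a.T)) :=
    hist_mono (past_mono (by omega))
  have hvi : VAdapted Pr (hist smp (past a.T k (1 + a.T))) c.M (vInit F G smp a x₀ y₀ v₀ k) :=
    ⟨hr.x.mono hle, hr.y.mono hle, hr.v.mono hle, hr.Dx.mono hle, hr.Dv.mono hle, hr.norm_le⟩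
  obtain ⟨A, hA0, hA1, hA2, hA3⟩ := yPath_summary hA hS hμL ha.s1_pos ha.s1_le ha.τy ha.S2 ha.T
    hyi hxn
  obtain ⟨B, hB0, hB1, hB2, hB3⟩ := vPath_summary hA hS hμL ha.s2_pos ha.s2_le ha.τx ha.τv ha.M
    ha.S2 ha.J hvi (hxn.mono hle) hy.y
  have hX : ∫ ω, ‖xNext F G smp a x₀ y₀ v₀ k ω - (rPath F G smp a x₀ y₀ v₀ k ω).x‖ ^ 2 ∂Pr =
      a.α ^ 2 * sqDx F G Pr smp a x₀ y₀ v₀ k := by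
    rw [sqDx, ← integral_const_mul]
    congr 1 with ω
    rw [xNext, sub_sub_cancel_left, norm_neg, norm_smul, mul_pow, Real.norm_eq_abs, sq_abs]
  have hXy : ∫ ω, ‖xNext F G smp a x₀ y₀ v₀ k ω - (yInit F G smp a x₀ y₀ v₀ k ω).x‖ ^ 2 ∂Pr =
      a.α ^ 2 * sqDx F G Pr smp a x₀ y₀ v₀ k := hX
  have hXv : ∫ ω, ‖xNext F G smp a x₀ y₀ v₀ k ω - (vInit F G smp a x₀ y₀ v₀ k ω).x‖ ^ 2 ∂Pr =
      a.α ^ 2 * sqDx F G Pr smp a x₀ y₀ v₀ k := hX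
  have hYd : ∫ ω, ‖(yLast F G smp a x₀ y₀ v₀ k ω).y - (vInit F G smp a x₀ y₀ v₀ k ω).y‖ ^ 2 ∂Pr ≤
      a.T * (a.lam1 * a.β) ^ 2 * A := hA3
  have hdY : distY Q F G Pr smp a x₀ y₀ v₀ (k + 1) =
      ∫ ω, ‖(yLast F G smp a x₀ y₀ v₀ k ω).y - lowerSol (expected Q G)
        (xNext F G smp a x₀ y₀ v₀ k ω)‖ ^ 2 ∂Pr := by
    simp only [distY, rPath, refresh_x, refresh_y, run_succ]
  have hdV : distV P Q F G Pr smp a x₀ y₀ v₀ (k + 1) =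
      ∫ ω, ‖(vLast F G smp a x₀ y₀ v₀ k ω).v - auxSol (expected P F) (expected Q G)
        (xNext F G smp a x₀ y₀ v₀ k ω)‖ ^ 2 ∂Pr := by
    simp only [distV, rPath, refresh_x, refresh_v, run_succ]
  have hRle : (c.M1 * (a.α ^ 2 * sqDx F G Pr smp a x₀ y₀ v₀ k
      + ∫ ω, ‖(yLast F G smp a x₀ y₀ v₀ k ω).y - (vInit F G smp a x₀ y₀ v₀ k ω).y‖ ^ 2 ∂Pr)
      + 2 * (c.Lg : ℝ) ^ 2 * (a.lam2 * a.η) ^ 2 * B) / a.S2 ≤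
      (c.M1 * (a.α ^ 2 * sqDx F G Pr smp a x₀ y₀ v₀ k + a.T * (a.lam1 * a.β) ^ 2 * A)
      + 2 * (c.Lg : ℝ) ^ 2 * (a.lam2 * a.η) ^ 2 * B) / a.S2 := by
    gcongr
  rw [hXy] at hA1 hA2
  rw [hXv] at hB1 hB2 hB3
  -- Without renewal the estimates at k + 1 are those left by the loops, so their final errors carry
  -- over.
  have hrf : (k + 1) % a.q1 ≠ 0 → ∀ ω, rPath F G smp a x₀ y₀ v₀ (k + 1) ω =
      run a F G (fun d => smp d ω) x₀ y₀ v₀ (k + 1) := fun hk ω => if_neg hk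
  refine ⟨A, B, hA0, hB0, ?_, ?_, fun hk => ⟨?_, ?_, ?_⟩⟩
  · rw [hdY]
    exact hA1
  · have h1 := mul_le_mul_of_nonneg_left hRle
      (show 0 ≤ 4 * (a.lam2 * a.η) / c.μ * (a.J * 2) by positivity)
    rw [hdV, hdY]
    have e : distY Q F G Pr smp a x₀ y₀ v₀ k = ∫ ω, ‖(vInit F G smp a x₀ y₀ v₀ k ω).y
      - lowerSol (expected Q G) (vInit F G smp a x₀ y₀ v₀ k ω).x‖ ^ 2 ∂Pr := rfl
    have e2 : errV P Q F G Pr smp a x₀ y₀ v₀ k = ∫ ω, ‖(vInit F G smp a x₀ y₀ v₀ k ω).Dv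
      - dirV (expected P F) (expected Q G) (vInit F G smp a x₀ y₀ v₀ k ω).x
      (vInit F G smp a x₀ y₀ v₀ k ω).y (vInit F G smp a x₀ y₀ v₀ k ω).v‖ ^ 2 ∂Pr := rfl
    have e3 : distV P Q F G Pr smp a x₀ y₀ v₀ k = ∫ ω, ‖(vInit F G smp a x₀ y₀ v₀ k ω).v
      - auxSol (expected P F) (expected Q G) (vInit F G smp a x₀ y₀ v₀ k ω).x‖ ^ 2 ∂Pr := rfl
    rw [e, e2, e3]
    refine hB1.trans ?_
    gcongr
  · have e : errX P Q F G Pr smp a x₀ y₀ v₀ (k + 1) = ∫ ω, ‖(vLast F G smp a x₀ y₀ v₀ k ω).Dx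
        - dirX (expected P F) (expected Q G) (xNext F G smp a x₀ y₀ v₀ k ω)
          (yLast F G smp a x₀ y₀ v₀ k ω).y (vLast F G smp a x₀ y₀ v₀ k ω).v‖ ^ 2 ∂Pr := by
      simp only [errX, hrf hk, run_succ]
    rw [e]
    exact hB2.trans (add_le_add_right hRle _)
  · have e : errY Q F G Pr smp a x₀ y₀ v₀ (k + 1) = ∫ ω, ‖(yLast F G smp a x₀ y₀ v₀ k ω).Dy
        - dirY (expected Q G) (xNext F G smp a x₀ y₀ v₀ k ω)
          (yLast F G smp a x₀ y₀ v₀ k ω).y‖ ^ 2 ∂Pr := by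
      simp only [errY, hrf hk, run_succ]
    rw [e]
    exact hA2
  · have e : errV P Q F G Pr smp a x₀ y₀ v₀ (k + 1) = ∫ ω, ‖(vLast F G smp a x₀ y₀ v₀ k ω).Dv
        - dirV (expected P F) (expected Q G) (xNext F G smp a x₀ y₀ v₀ k ω)
          (yLast F G smp a x₀ y₀ v₀ k ω).y (vLast F G smp a x₀ y₀ v₀ k ω).v‖ ^ 2 ∂Pr := by
      simp only [errV, hrf hk, run_succ]
    rw [e]
    exact hB3.trans (add_le_add_right hRle _)

end Run

/-! ### Summation over the periods between large batches -/

/-- An error that is reset every `q` steps and grows by `R k / q` in between. -/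
theorem sum_periodic_reset_le {q : ℕ} (hq : 0 < q) {e R : ℕ → ℝ} {b : ℝ} (hR : ∀ k, 0 ≤ R k)
    (h0 : ∀ k, k % q = 0 → e k ≤ b) (h1 : ∀ k, (k + 1) % q ≠ 0 → e (k + 1) ≤ e k + R k / q)
    (K : ℕ) : ∑ k ∈ Finset.range K, (e k + R k / q - R k) ≤ K * b := by
  have hq0 : (0 : ℝ) < q := by exact_mod_cast hq
  have hmod : ∀ k, ((k % q : ℕ) : ℝ) + 1 ≤ q := fun k => by exact_mod_cast Nat.mod_lt k hq
  -- The induction needs a second invariant: the current excess e K - b may persist for all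
  -- remaining q - K % q steps of the period and is charged in advance.
  suffices h : ∀ K : ℕ, (∑ k ∈ Finset.range K, (e k + R k / q - R k) ≤ K * b) ∧
      ∑ k ∈ Finset.range K, (e k + R k / q - R k) + (q - (K % q : ℕ)) * (e K - b) ≤ K * b from
    (h K).1
  intro K
  induction K with
  | zero =>
    have := h0 0 (Nat.zero_mod _)
    refine ⟨by simp, ?_⟩
    simp only [Finset.range_zero, Finset.sum_empty, Nat.zero_mod, Nat.cast_zero, sub_zero,
      zero_add, zero_mul]
    nlinarith
  | succ K ih =>
    have hRq : R K / q ≤ R K := div_le_self (hR K) (by exact_mod_cast hq)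
    rw [Finset.sum_range_succ]
    push_cast
    have hlt := hmod K
    -- A positive excess is covered by the second invariant, as at least one step of the period
    -- remains; otherwise the first invariant suffices.
    have key : ∑ k ∈ Finset.range K, (e k + R k / q - R k) + (e K - b) ≤ K * b := by
      rcases le_total 0 (e K - b) with h | h
      · nlinarith [ih.2]
      · linarith [ih.1]
    refine ⟨by linarith, ?_⟩
    by_cases hK : (K + 1) % q = 0
    · have := h0 _ hK
      rw [hK, Nat.cast_zero, sub_zero]
      nlinarith
    · have e1 : (K + 1) % q = K % q + 1 := by
        rw [Nat.add_mod_eq_ite] at hK ⊢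
        rcases Nat.lt_or_ge 1 q with h | h
        · rw [Nat.mod_eq_of_lt h] at hK ⊢
          split_ifs at hK ⊢ with h2
          · have := Nat.mod_lt K hq
            omega
          · rfl
        · have : q = 1 := by omega
          subst this
          simp [Nat.mod_one] at hK
      have h2 := h1 K hK
      rw [e1]
      push_cast
      have h3 : ((q : ℝ) - (K % q : ℕ) - 1) * (e (K + 1) - b) ≤
          (q - (K % q : ℕ) - 1) * (e K + R K / q - b) :=
        mul_le_mul_of_nonneg_left (by linarith) (by linarith)
      have h4 : ((q : ℝ) - (K % q : ℕ)) * (R K / q) ≤ R K := by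
        have : (0 : ℝ) ≤ (K % q : ℕ) := Nat.cast_nonneg _
        calc ((q : ℝ) - (K % q : ℕ)) * (R K / q) ≤ q * (R K / q) :=
              mul_le_mul_of_nonneg_right (by linarith) (div_nonneg (hR K) hq0.le)
          _ = R K := mul_div_cancel₀ _ hq0.ne'
      nlinarith [ih.2]

/-- Summation of a descent inequality for a potential with three error terms that are reset
every `q` steps. -/
theorem sum_le_of_potential {q : ℕ} (hq : 0 < q) {Ψ D e₁ e₂ e₃ R₁ R₂ R₃ : ℕ → ℝ}
    {b₁ b₂ b₃ w₁ w₂ w₃ : ℝ} (hw₁ : 0 ≤ w₁) (hw₂ : 0 ≤ w₂) (hw₃ : 0 ≤ w₃)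
    (hR₁ : ∀ k, 0 ≤ R₁ k) (hR₂ : ∀ k, 0 ≤ R₂ k) (hR₃ : ∀ k, 0 ≤ R₃ k)
    (h0 : ∀ k, k % q = 0 → e₁ k ≤ b₁ ∧ e₂ k ≤ b₂ ∧ e₃ k ≤ b₃)
    (h1 : ∀ k, (k + 1) % q ≠ 0 → e₁ (k + 1) ≤ e₁ k + R₁ k / q ∧ e₂ (k + 1) ≤ e₂ k + R₂ k / q ∧
      e₃ (k + 1) ≤ e₃ k + R₃ k / q)
    (hstep : ∀ k, Ψ (k + 1) + D k ≤ Ψ k + w₁ * (e₁ k + R₁ k / q - R₁ k)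
      + w₂ * (e₂ k + R₂ k / q - R₂ k) + w₃ * (e₃ k + R₃ k / q - R₃ k)) (K : ℕ) :
    Ψ K + ∑ k ∈ Finset.range K, D k ≤ Ψ 0 + K * (w₁ * b₁ + w₂ * b₂ + w₃ * b₃) := by
  have hsum : ∀ K : ℕ, Ψ K + ∑ k ∈ Finset.range K, D k ≤ Ψ 0
      + w₁ * ∑ k ∈ Finset.range K, (e₁ k + R₁ k / q - R₁ k)
      + w₂ * ∑ k ∈ Finset.range K, (e₂ k + R₂ k / q - R₂ k)
      + w₃ * ∑ k ∈ Finset.range K, (e₃ k + R₃ k / q - R₃ k) := by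
    intro K
    induction K with
    | zero => simp
    | succ K ih =>
      simp only [Finset.sum_range_succ]
      linarith [hstep K]
  have s₁ := sum_periodic_reset_le hq hR₁ (fun k hk => (h0 k hk).1) (fun k hk => (h1 k hk).1) K
  have s₂ := sum_periodic_reset_le hq hR₂ (fun k hk => (h0 k hk).2.1)
    (fun k hk => (h1 k hk).2.1) K
  have s₃ := sum_periodic_reset_le hq hR₃ (fun k hk => (h0 k hk).2.2)
    (fun k hk => (h1 k hk).2.2) K
  linarith [hsum K, mul_le_mul_of_nonneg_left s₁ hw₁, mul_le_mul_of_nonneg_left s₂ hw₂,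
    mul_le_mul_of_nonneg_left s₃ hw₃]

/-! ### The Lyapunov argument -/

/-- Step sizes for which the sum of value function and squared tracking errors decreases. -/
structure IsBalanced (c : Constants) (a : Params) : Prop where
  coupling_le : 8 * (a.lam2 * a.η) / c.μ * a.J * c.M1 ≤ 1
  distY_le : 2 * (8 * (a.lam2 * a.η) / c.μ * a.J * c.M1) + a.α * c.M1 ≤
    a.lam1 * a.β * c.μ / 4
  distV_le : 2 * a.α * (c.Lg : ℝ) ^ 2 ≤ a.lam2 * a.η * c.μ / 4
  stepX_le : 5 / (a.lam1 * a.β * c.μ) * c.Cy ^ 2 * a.α ^ 2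
    + 5 / (a.lam2 * a.η * c.μ) * c.Cv ^ 2 * a.α ^ 2
    + 4 * (a.lam1 * a.β) / c.μ * a.T * ((c.Lg : ℝ) ^ 2 * a.α ^ 2)
    + (8 * (a.lam2 * a.η) / c.μ * a.J + a.α) * (c.M1 * a.α ^ 2) ≤ a.α / 3
  stepY_le : 4 * (a.lam1 * a.β) / c.μ * a.T * ((c.Lg : ℝ) ^ 2 * (a.lam1 * a.β) ^ 2)
    + (8 * (a.lam2 * a.η) / c.μ * a.J + a.α) * (c.M1 * (a.T * (a.lam1 * a.β) ^ 2)) ≤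
    a.lam1 * a.β / (4 * c.Lg)
  stepV_le : (8 * (a.lam2 * a.η) / c.μ * a.J + a.α)
    * (2 * (c.Lg : ℝ) ^ 2 * (a.lam2 * a.η) ^ 2) ≤ a.lam2 * a.η / (4 * c.Lg)

section Convergence

variable {p q : ℕ} {Ξ Z Ω : Type*} [MeasurableSpace Ξ] [MeasurableSpace Z]
  [MeasurableSpace Ω]
  {P : Measure Ξ} [IsProbabilityMeasure P] {Q : Measure Z} [IsProbabilityMeasure Q]
  {F : Ξ → Joint p q → ℝ} {G : Z → Joint p q → ℝ} {c : Constants}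
  {Pr : Measure Ω} [IsProbabilityMeasure Pr] {smp : Draw → Ω → Ξ × Z}

/-- Each field of `IsBalanced` says that the total coefficient of one quantity in the potential
inequality has the right sign: `distY_le` and `distV_le` for the tracking errors, `stepX_le`,
`stepY_le`, `stepV_le` for the squared directions in x, y and v; `coupling_le` keeps the potential
bounded below. -/
theorem sum_sqGrad_le (hq : 0 < q) (hA : Assumptions P Q F G c) (hS : IsSampling P Q Pr smp)
    {a : Params} (ha : IsSpider c a) (hb : IsBalanced c a) (hq1 : 0 < a.q1) (hS2 : a.S2 = a.q1)
    {x₀ : Vec p} {y₀ v₀ : Vec q} (hv₀ : ‖v₀‖ ≤ c.M) (K : ℕ) :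
    meanPhi P Q F G Pr smp a x₀ y₀ v₀ K
      + ∑ k ∈ Finset.range K, a.α / 2 * sqGrad P Q F G Pr smp a x₀ y₀ v₀ k ≤
    meanPhi P Q F G Pr smp a x₀ y₀ v₀ 0 + distY Q F G Pr smp a x₀ y₀ v₀ 0
      + distV P Q F G Pr smp a x₀ y₀ v₀ 0
      + K * (a.α * ((2 * c.σf ^ 2 + 2 * c.M ^ 2 * c.σgxy ^ 2) / a.S1)
      + 4 * (a.lam1 * a.β) / c.μ * a.T * (c.σg ^ 2 / a.S1)
      + 8 * (a.lam2 * a.η) / c.μ * a.J * ((2 * c.σf ^ 2 + 2 * c.M ^ 2 * c.σgyy ^ 2) / a.S1)) := by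
  have hμ := hA.μ_pos
  have hM1 : 0 ≤ c.M1 := by rw [Constants.M1]; positivity
  have hs1 := ha.s1_pos
  have hs2 := ha.s2_pos
  have hα := ha.α_pos
  have hδ : ∀ k, 0 ≤ distY Q F G Pr smp a x₀ y₀ v₀ k := fun k =>
    integral_nonneg fun ω => sq_nonneg _
  have hν : ∀ k, 0 ≤ distV P Q F G Pr smp a x₀ y₀ v₀ k := fun k =>
    integral_nonneg fun ω => sq_nonneg _
  have hX : ∀ k, 0 ≤ sqDx F G Pr smp a x₀ y₀ v₀ k := fun k =>
    integral_nonneg fun ω => sq_nonneg _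
  choose A B hA0 hB0 hI hII hE using
    iteration_summary hA hS ha hq hv₀ (x₀ := x₀) (y₀ := y₀) (smp := smp)
  -- Here S₂ = q₁ is essential: the error growth R/S₂ per iteration is matched with a period of q₁
  -- iterations.
  simp only [hS2] at hI hII hE
  have hρ : 0 ≤ 8 * (a.lam2 * a.η) / c.μ * a.J * c.M1 := by positivity
  have key := sum_le_of_potential hq1
    -- The v-loop bound contains ρ times the y-distances at k and k + 1, where ρ = 8λ₂ηJM̄₁/μ.
    -- Moving the latter to the left reduces the weight of the y-distance to 1 - ρ, and 2ρ + αM̄₁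
    -- has to be absorbed by the contraction.
    (Ψ := fun k => meanPhi P Q F G Pr smp a x₀ y₀ v₀ k
      + (1 - 8 * (a.lam2 * a.η) / c.μ * a.J * c.M1) * distY Q F G Pr smp a x₀ y₀ v₀ k
      + distV P Q F G Pr smp a x₀ y₀ v₀ k)
    (D := fun k => a.α / 2 * sqGrad P Q F G Pr smp a x₀ y₀ v₀ k)
    (w₁ := a.α) (w₂ := 4 * (a.lam1 * a.β) / c.μ * a.T)
    (w₃ := 8 * (a.lam2 * a.η) / c.μ * a.J)
    (R₁ := fun k => c.M1 * (a.α ^ 2 * sqDx F G Pr smp a x₀ y₀ v₀ k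
      + a.T * (a.lam1 * a.β) ^ 2 * A k) + 2 * (c.Lg : ℝ) ^ 2 * (a.lam2 * a.η) ^ 2 * B k)
    (R₂ := fun k => (c.Lg : ℝ) ^ 2 * (a.α ^ 2 * sqDx F G Pr smp a x₀ y₀ v₀ k)
            + (c.Lg : ℝ) ^ 2 * (a.lam1 * a.β) ^ 2 * A k)
    (R₃ := fun k => c.M1 * (a.α ^ 2 * sqDx F G Pr smp a x₀ y₀ v₀ k
      + a.T * (a.lam1 * a.β) ^ 2 * A k) + 2 * (c.Lg : ℝ) ^ 2 * (a.lam2 * a.η) ^ 2 * B k)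
    hα.le (by positivity) (by positivity)
    (fun k => by have := hX k; have := hA0 k; have := hB0 k; positivity)
    (fun k => by have := hX k; have := hA0 k; positivity)
    (fun k => by have := hX k; have := hA0 k; have := hB0 k; positivity)
    (fun k hk => err_of_dvd hA hS ha hv₀ hk (x₀ := x₀) (y₀ := y₀))
    (fun k hk => hE k hk)
    (fun k => by
      have h1 := hI k
      have h2 := hII k
      have h3 := meanPhi_succ_le hA hS ha hq hv₀ k (x₀ := x₀) (y₀ := y₀)
      have d1 := mul_le_mul_of_nonneg_right hb.distY_le (hδ k)
      have d2 := mul_le_mul_of_nonneg_right hb.distV_le (hν k)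
      have d3 := mul_le_mul_of_nonneg_right hb.stepX_le (hX k)
      have d4 := mul_le_mul_of_nonneg_right hb.stepY_le (hA0 k)
      have d5 := mul_le_mul_of_nonneg_right hb.stepV_le (hB0 k)
      -- The descent of Φ sees the error of D^x only at the start of the iteration, so the growth
      -- term that the summation lemma allows for it is spare.
      have d6 : 0 ≤ a.α * ((c.M1 * (a.α ^ 2 * sqDx F G Pr smp a x₀ y₀ v₀ k
          + a.T * (a.lam1 * a.β) ^ 2 * A k)
          + 2 * (c.Lg : ℝ) ^ 2 * (a.lam2 * a.η) ^ 2 * B k) / a.q1) := by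
        have := hX k; have := hA0 k; have := hB0 k; positivity
      linear_combination h1 + h2 + h3 + d1 + d2 + d3 + d4 + d5 + d6) K
  have hc := hb.coupling_le
  have n1 := mul_nonneg (sub_nonneg.2 hc) (hδ K)
  have n2 := mul_nonneg hρ (hδ 0)
  have n3 := hν K
  linarith

end Convergence

/-! ### Numerical consequences of the choice of step sizes -/

namespace Constants

variable {c : Constants} {T J : ℕ} {β η : ℝ}

/-- If M̄₁ = 0, then L_f = 0 and M L_gg = 0, hence C_f L_gg = 0 because M ≥ C_f/μ, and every term of
L_Φ vanishes. Positivity matters because M̄₁ stands in denominators of the step sizes, where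
division by zero would give the value 0. -/
theorem M1_pos (hμ : 0 < c.μ) (hM : c.Cf / c.μ ≤ c.M) (h : 0 < c.LPhi) : 0 < c.M1 := by
  have h0 : 0 ≤ c.M1 := by rw [M1]; positivity
  refine lt_of_le_of_ne h0 fun h1 => h.ne' ?_
  rw [M1] at h1
  have hLf : (c.Lf : ℝ) = 0 := by
    have : (c.Lf : ℝ) ^ 2 = 0 := by nlinarith [sq_nonneg (c.Lf : ℝ), sq_nonneg (c.M * c.Lgg)]
    exact pow_eq_zero_iff two_ne_zero |>.1 this
  have hML : c.M * c.Lgg = 0 := by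
    have : (c.M * c.Lgg) ^ 2 = 0 := by
      nlinarith [sq_nonneg (c.Lf : ℝ), sq_nonneg (c.M * c.Lgg)]
    exact pow_eq_zero_iff two_ne_zero |>.1 this
  have hCL : c.Cf * c.Lgg = 0 := by
    rcases mul_eq_zero.1 hML with hM0 | hL
    · have h2 : (c.Cf : ℝ) / c.μ = 0 := le_antisymm (hM0 ▸ hM) (by positivity)
      rw [(div_eq_zero_iff.1 h2).resolve_right hμ.ne', zero_mul]
    · rw [hL, mul_zero]
  rw [LPhi, hLf]
  linear_combination (c.Cf / c.μ + 2 * c.Lg / c.μ ^ 2 + c.Lg ^ 2 / c.μ ^ 3) * hCL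

theorem three_le_C3 (hT : 0 < T) (hJ : 0 < J) : 3 ≤ c.C3 T J := by
  have h1 : (1 : ℝ) ≤ T := by exact_mod_cast hT
  have h2 : (1 : ℝ) ≤ J := by exact_mod_cast hJ
  have h3 : 0 ≤ (J : ℝ) ^ 2 * c.M ^ 2 := by positivity
  rw [C3]
  nlinarith

theorem T_le_C3 (hT : 0 < T) : (T : ℝ) ≤ c.C3 T J := by
  have h1 : (1 : ℝ) ≤ T := by exact_mod_cast hT
  have h3 : 0 ≤ (J : ℝ) ^ 2 * c.M ^ 2 := by positivity
  have h4 : 0 ≤ (J : ℝ) ^ 2 := by positivity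
  rw [C3]
  nlinarith

theorem lam1_pos (hμ : 0 < c.μ) (hL : 0 < (c.Lg : ℝ)) (hT : 0 < T) (hJ : 0 < J) (hβ : 0 < β) :
    0 < c.lam1 T J β 1 := by
  have h3 : 0 < c.C3 T J := by linarith [three_le_C3 (c := c) hT hJ]
  have hT0 : (0 : ℝ) < T := by exact_mod_cast hT
  exact lt_min (by positivity) (by positivity)

theorem lam2_pos (hμ : 0 < c.μ) (hL : 0 < (c.Lg : ℝ)) (hM1 : 0 < c.M1) (hT : 0 < T)
    (hJ : 0 < J) (hβ : 0 < β) (hη : 0 < η) : 0 < c.lam2 T J β η 1 := by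
  have h1 := lam1_pos (c := c) hμ hL hT hJ hβ
  have hT0 : (0 : ℝ) < T := by exact_mod_cast hT
  have hJ0 : (0 : ℝ) < J := by exact_mod_cast hJ
  exact lt_min (by positivity) (lt_min (by positivity) (by positivity))

theorem alpha_pos (hμ : 0 < c.μ) (hL : 0 < (c.Lg : ℝ)) (hM1 : 0 < c.M1) (hLPhi : 0 < c.LPhi)
    (hT : 0 < T) (hJ : 0 < J) (hβ : 0 < β) (hη : 0 < η) : 0 < c.alpha T J β η 1 := by
  have h1 := lam1_pos (c := c) hμ hL hT hJ hβ
  have h2 := lam2_pos (c := c) hμ hL hM1 hT hJ hβ hη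
  have h3 : 0 < c.C3 T J := by linarith [three_le_C3 (c := c) hT hJ]
  have hT0 : (0 : ℝ) < T := by exact_mod_cast hT
  have hJ0 : (0 : ℝ) < J := by exact_mod_cast hJ
  have h4 : 0 < c.C4 T J β 1 := by rw [C4]; positivity
  have h5 : 0 < c.C5 T J β η 1 := by rw [C5]; positivity
  exact lt_min (by positivity) <| lt_min (by positivity) <| lt_min (by positivity) <|
    lt_min (by rw [Real.sqrt_one]; positivity) <| lt_min (by positivity) <|
    lt_min (by positivity) (by positivity)

theorem lam1_le (hμ : 0 < c.μ) : c.lam1 T J β 1 * (2 * c.Lg + 2 * c.μ) ≤ 1 :=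
  (le_div_iff₀ (by positivity)).1 (min_le_left _ _)

theorem lam2_le (hμ : 0 < c.μ) : c.lam2 T J β η 1 * (2 * c.Lg + 2 * c.μ) ≤ 1 :=
  (le_div_iff₀ (by positivity)).1 (min_le_left _ _)

/-- 384 = 2⁷ · 3, from T ≥ 1 in the exponent and C₃ ≥ 3. -/
theorem lam1_mul_le (hμ : 0 < c.μ) (hL : 0 < (c.Lg : ℝ)) (hT : 0 < T) (hJ : 0 < J) (hβ : 0 < β) :
    384 * (c.lam1 T J β 1 * β * (T * (c.Lg : ℝ) ^ 2 * β)) ≤ c.μ := by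
  have h3 := three_le_C3 (c := c) hT hJ
  have hT0 : (0 : ℝ) < T := by exact_mod_cast hT
  have hl := lam1_pos (c := c) hμ hL hT hJ hβ
  have h : c.lam1 T J β 1 * (T * (c.Lg : ℝ) ^ 2 * β ^ 2 * c.C3 T J) ≤
      (1 / 2) ^ (2 * T + 5) * c.μ * 1 :=
    (le_div_iff₀ (by positivity)).1 (min_le_right _ _)
  have hp : ((1 : ℝ) / 2) ^ (2 * T + 5) ≤ (1 / 2) ^ 7 :=
    pow_le_pow_of_le_one (by norm_num) (by norm_num) (by omega)
  have h5 : c.lam1 T J β 1 * (T * (c.Lg : ℝ) ^ 2 * β ^ 2 * 3) ≤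
      c.lam1 T J β 1 * (T * (c.Lg : ℝ) ^ 2 * β ^ 2 * c.C3 T J) := by gcongr
  have h6 := mul_le_mul_of_nonneg_right hp hμ.le
  linarith

theorem lam2_coupling_le (hM1 : 0 < c.M1) (hJ : 0 < J) (hη : 0 < η) :
    c.lam2 T J β η 1 * η * (128 * c.M1 * J) ≤ c.μ ^ 2 * (c.lam1 T J β 1 * β) := by
  have hJ0 : (0 : ℝ) < J := by exact_mod_cast hJ
  have h : c.lam2 T J β η 1 ≤ c.μ ^ 2 * c.lam1 T J β 1 * β / (128 * c.M1 * J * η) :=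
    (min_le_right _ _).trans (min_le_left _ _)
  rw [le_div_iff₀ (by positivity)] at h
  linarith

/-- 1024 = 2¹⁰, since T + J ≥ 2. -/
theorem lam2_mul_le (hμ : 0 < c.μ) (hL : 0 < (c.Lg : ℝ)) (hM1 : 0 < c.M1) (hT : 0 < T)
    (hJ : 0 < J) (hβ : 0 < β) (hη : 0 < η) :
    1024 * (c.lam2 T J β η 1 * η * (J * ((c.Lg : ℝ) ^ 2 * η + T * c.M1 * β))) ≤ c.μ := by
  have hT0 : (0 : ℝ) < T := by exact_mod_cast hT
  have hJ0 : (0 : ℝ) < J := by exact_mod_cast hJ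
  have h : c.lam2 T J β η 1 ≤
      (1 / 2) ^ (2 * (T + J) + 6) * c.μ * 1 / (J * ((c.Lg : ℝ) ^ 2 * η ^ 2 + T * c.M1 * β * η)) :=
    (min_le_right _ _).trans (min_le_right _ _)
  rw [le_div_iff₀ (by positivity)] at h
  have hp : ((1 : ℝ) / 2) ^ (2 * (T + J) + 6) ≤ (1 / 2) ^ 10 :=
    pow_le_pow_of_le_one (by norm_num) (by norm_num) (by omega)
  have h6 := mul_le_mul_of_nonneg_right hp hμ.le
  linarith

theorem alpha_le (h : 0 < c.LPhi) : c.alpha T J β η 1 * c.LPhi ≤ 1 / 6 := by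
  have h1 : c.alpha T J β η 1 ≤ 1 / (6 * c.LPhi) :=
    (min_le_right _ _).trans ((min_le_right _ _).trans (min_le_left _ _))
  rw [le_div_iff₀ (by positivity)] at h1
  linarith

theorem alpha_mul_le₁ (hM1 : 0 < c.M1) : c.alpha T J β η 1 * (96 * c.Cy ^ 2 + 8 * c.M1) ≤
    c.μ * (c.lam1 T J β 1 * β) := by
  rw [← mul_assoc]
  exact (le_div_iff₀ (by positivity)).1 (min_le_left _ _)

theorem alpha_mul_le₂ (hL : 0 < (c.Lg : ℝ)) : c.alpha T J β η 1 *
    (48 * ((c.Lg : ℝ) ^ 2 + c.Cv ^ 2)) ≤ c.μ * (c.lam2 T J β η 1 * η) := by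
  rw [← mul_assoc c.μ]
  exact (le_div_iff₀ (by positivity)).1 ((min_le_right _ _).trans (min_le_left _ _))

theorem alpha_sq_mul_M1_le (hM1 : 0 < c.M1) (hα : 0 ≤ c.alpha T J β η 1) :
    144 * (c.alpha T J β η 1 ^ 2 * c.M1) ≤ 1 := by
  have h1 : c.alpha T J β η 1 ≤ Real.sqrt 1 / (12 * Real.sqrt c.M1) :=
    (min_le_right _ _).trans ((min_le_right _ _).trans ((min_le_right _ _).trans
      (min_le_left _ _)))
  rw [Real.sqrt_one, le_div_iff₀ (by positivity)] at h1
  have h2 := pow_le_one₀ (n := 2) (by positivity) h1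
  rw [mul_pow, mul_pow, Real.sq_sqrt hM1.le] at h2
  linarith

theorem alpha_mul_le₃ (hμ : 0 < c.μ) (hL : 0 < (c.Lg : ℝ)) (hT : 0 < T) (hJ : 0 < J)
    (hβ : 0 < β) (hα : 0 ≤ c.alpha T J β η 1) :
    192 * (c.alpha T J β η 1 * (c.lam1 T J β 1 * β * (c.Lg : ℝ) ^ 2 * T)) ≤ c.μ := by
  have hl := lam1_pos (c := c) hμ hL hT hJ hβ
  have h3 := T_le_C3 (c := c) (J := J) hT
  have hT0 : (0 : ℝ) < T := by exact_mod_cast hT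
  have h4 : 0 < c.C4 T J β 1 := by rw [C4]; have := hT0.trans_le h3; positivity
  have h1 : c.alpha T J β η 1 ≤ c.μ / c.C4 T J β 1 :=
    (min_le_right _ _).trans ((min_le_right _ _).trans ((min_le_right _ _).trans
      ((min_le_right _ _).trans (min_le_left _ _))))
  rw [le_div_iff₀ h4, C4, inv_one, one_mul] at h1
  have h5 : c.alpha T J β η 1 * (192 * c.lam1 T J β 1 * β * (c.Lg : ℝ) ^ 2 * T) ≤
      c.alpha T J β η 1 * (192 * c.lam1 T J β 1 * β * (c.Lg : ℝ) ^ 2 * (1 + c.C3 T J)) := by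
    gcongr
    linarith
  linarith

theorem alpha_mul_le₄ (hμ : 0 < c.μ) (hL : 0 < (c.Lg : ℝ)) (hM1 : 0 < c.M1) (hT : 0 < T)
    (hJ : 0 < J) (hβ : 0 < β) (hη : 0 < η) (hα : 0 ≤ c.alpha T J β η 1) :
    192 * (c.alpha T J β η 1 * (c.lam2 T J β η 1 * η * c.M1 * J)) ≤ c.μ := by
  have hl := lam2_pos (c := c) hμ hL hM1 hT hJ hβ hη
  have hJ0 : (0 : ℝ) < J := by exact_mod_cast hJ
  have h4 : 0 < c.C5 T J β η 1 := by rw [C5]; positivity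
  have h1 : c.alpha T J β η 1 ≤ c.μ / c.C5 T J β η 1 :=
    (min_le_right _ _).trans ((min_le_right _ _).trans ((min_le_right _ _).trans
      ((min_le_right _ _).trans ((min_le_right _ _).trans (min_le_left _ _)))))
  rw [le_div_iff₀ h4, C5, inv_one, one_mul] at h1
  have h5 : c.alpha T J β η 1 * (192 * c.lam2 T J β η 1 * η * c.M1 * J) ≤
      c.alpha T J β η 1 * (192 * c.lam2 T J β η 1 * η * c.M1 * (1 + c.Cy ^ 2 + J)) := by
    gcongr
    linarith [sq_nonneg c.Cy]
  linarith

theorem alpha_mul_le₅ (hL : 0 < (c.Lg : ℝ)) (hM1 : 0 < c.M1) (hT : 0 < T) (hβ : 0 < β)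
    (hη : 0 < η) : 32 * (c.alpha T J β η 1 * (c.M1 * T * β + (c.Lg : ℝ) ^ 2 * η)) ≤ 1 := by
  have hT0 : (0 : ℝ) < T := by exact_mod_cast hT
  have h1 : c.alpha T J β η 1 ≤
      (1 / 2) ^ (2 * (T + J) + 3) * 1 / (c.M1 * T * β + (c.Lg : ℝ) ^ 2 * η) :=
    (min_le_right _ _).trans ((min_le_right _ _).trans ((min_le_right _ _).trans
      ((min_le_right _ _).trans ((min_le_right _ _).trans (min_le_right _ _)))))
  rw [le_div_iff₀ (by positivity)] at h1
  have hp : ((1 : ℝ) / 2) ^ (2 * (T + J) + 3) ≤ (1 / 2) ^ 5 :=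
    pow_le_pow_of_le_one (by norm_num) (by norm_num) (by omega)
  linarith

end Constants

/-- With r = 1 the step sizes do not depend on q₁, which makes the final constant uniform in it. -/
theorem spiderParams_self (c : Constants) (T J S1 : ℕ) {q1 : ℕ} (hq1 : 0 < q1) (β η : ℝ) :
    spiderParams c T J q1 S1 q1 β η =
      { T := T, J := J, q1 := q1, S1 := S1, S2 := q1, lam1 := c.lam1 T J β 1
        lam2 := c.lam2 T J β η 1, α := c.alpha T J β η 1, β := β, η := η
        τx := 0, τy := 0, τv := 0, M := c.M } := by
  have h : (q1 : ℝ) / q1 = 1 := div_self (by exact_mod_cast hq1.ne')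
  simp only [spiderParams, h]

/-! ### The prescribed step sizes are admissible -/

section StepSizes

variable {c : Constants} (hμ : 0 < c.μ) (hμL : c.μ ≤ c.Lg) (hM1 : 0 < c.M1)
  (hLPhi : 0 < c.LPhi) {T J S1 q1 : ℕ} (hT : 0 < T) (hJ : 0 < J) (hq1 : 0 < q1) {β η : ℝ}
  (hβ : 0 < β) (hη : 0 < η)

include hμ hμL hM1 hLPhi hT hJ hq1 hβ hη

theorem isSpider_spiderParams (hS1 : 0 < S1) :
    IsSpider c (spiderParams c T J q1 S1 q1 β η) := by
  have hL : (0 : ℝ) < c.Lg := hμ.trans_le hμL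
  have hT1 : (1 : ℝ) ≤ T := by exact_mod_cast hT
  have hJ1 : (1 : ℝ) ≤ J := by exact_mod_cast hJ
  have p1 := Constants.lam1_pos (c := c) hμ hL hT hJ hβ
  have p2 := Constants.lam2_pos (c := c) hμ hL hM1 hT hJ hβ hη
  have b1 := Constants.lam1_le (c := c) (T := T) (J := J) (β := β) hμ
  have b2 := Constants.lam2_le (c := c) (T := T) (J := J) (β := β) (η := η) hμ
  have d1 := Constants.lam1_mul_le (c := c) hμ hL hT hJ hβ
  have d2 := Constants.lam2_mul_le (c := c) hμ hL hM1 hT hJ hβ hη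
  rw [spiderParams_self c T J S1 hq1]
  refine ⟨rfl, rfl, rfl, rfl, hS1, hq1, hT, hJ, mul_pos p1 hβ, mul_pos p2 hη, ?_, ?_,
    Constants.alpha_pos hμ hL hM1 hLPhi hT hJ hβ hη, Constants.alpha_le hLPhi⟩
  -- The bound λ₁ ≤ 1/(2L_g + 2μ) alone is not enough for the factor 4. The second entry of the
  -- minimum bounds (λ₁βL_g)² by λ₁μ/384, and the first one bounds λ₁μ.
  · show c.lam1 T J β 1 * β * (4 * c.Lg) ≤ 1
    generalize c.lam1 T J β 1 = l at *
    have h1 : l * β * ((c.Lg : ℝ) ^ 2 * β) ≤ l * β * (T * (c.Lg : ℝ) ^ 2 * β) := by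
      gcongr
      exact le_mul_of_one_le_left (sq_nonneg _) hT1
    have h2 : l * (384 * (l * β * ((c.Lg : ℝ) ^ 2 * β))) ≤ l * c.μ := by
      gcongr; linarith
    have h3 : l * c.μ ≤ l * c.Lg := by gcongr
    refine (sq_le_one_iff₀ (by positivity)).1 ?_
    nlinarith
  · show c.lam2 T J β η 1 * η * (4 * c.Lg) ≤ 1
    generalize c.lam2 T J β η 1 = l at *
    have h1 : l * η * ((c.Lg : ℝ) ^ 2 * η) ≤
        l * η * (J * ((c.Lg : ℝ) ^ 2 * η + T * c.M1 * β)) := by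
      refine mul_le_mul_of_nonneg_left ?_ (by positivity)
      have : (0 : ℝ) ≤ T * c.M1 * β := by positivity
      exact (le_add_of_nonneg_right this).trans
        (le_mul_of_one_le_left (add_nonneg (by positivity) this) hJ1)
    have h2 : l * (1024 * (l * η * ((c.Lg : ℝ) ^ 2 * η))) ≤ l * c.μ := by
      gcongr; linarith
    have h3 : l * c.μ ≤ l * c.Lg := by gcongr
    refine (sq_le_one_iff₀ (by positivity)).1 ?_
    nlinarith

theorem isBalanced_spiderParams (hβ1 : β ≤ 1) :
    IsBalanced c (spiderParams c T J q1 S1 q1 β η) := by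
  have hL : (0 : ℝ) < c.Lg := hμ.trans_le hμL
  have hT1 : (1 : ℝ) ≤ T := by exact_mod_cast hT
  have hJ1 : (1 : ℝ) ≤ J := by exact_mod_cast hJ
  have p1 := Constants.lam1_pos (c := c) hμ hL hT hJ hβ
  have p2 := Constants.lam2_pos (c := c) hμ hL hM1 hT hJ hβ hη
  have p3 := Constants.alpha_pos hμ hL hM1 hLPhi hT hJ hβ hη
  have b1 := Constants.lam1_le (c := c) (T := T) (J := J) (β := β) hμ
  have b2 := Constants.lam2_le (c := c) (T := T) (J := J) (β := β) (η := η) hμ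
  have d1 := Constants.lam1_mul_le (c := c) hμ hL hT hJ hβ
  have d2 := Constants.lam2_mul_le (c := c) hμ hL hM1 hT hJ hβ hη
  have d3 := Constants.lam2_coupling_le (c := c) (T := T) (β := β) hM1 hJ hη
  have e1 := Constants.alpha_mul_le₁ (c := c) (T := T) (J := J) (β := β) (η := η) hM1
  have e2 := Constants.alpha_mul_le₂ (c := c) (T := T) (J := J) (β := β) (η := η) hL
  have e3 := Constants.alpha_sq_mul_M1_le (c := c) hM1 p3.le
  have e4 := Constants.alpha_mul_le₃ (c := c) hμ hL hT hJ hβ p3.le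
  have e5 := Constants.alpha_mul_le₄ (c := c) hμ hL hM1 hT hJ hβ hη p3.le
  have e6 := Constants.alpha_mul_le₅ (c := c) (J := J) hL hM1 hT hβ hη
  rw [spiderParams_self c T J S1 hq1]
  generalize c.lam1 T J β 1 = l₁ at *
  generalize c.lam2 T J β η 1 = l₂ at *
  generalize c.alpha T J β η 1 = α at *
  have q1' : l₁ * (2 * (c.Lg : ℝ)) ≤ 1 := by nlinarith
  have q2' : l₂ * (2 * (c.Lg : ℝ)) ≤ 1 := by nlinarith
  -- 8/128 = 1/16. Doubled, this is half of the contraction λ₁βμ/4; the other half is left for αM̄₁.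
  have hcp : 8 * (l₂ * η) / c.μ * J * c.M1 ≤ l₁ * β * c.μ / 16 := by
    rw [div_mul_eq_mul_div, div_mul_eq_mul_div, div_le_iff₀ hμ]
    linarith
  have hs : l₁ * β * c.μ ≤ 1 / 2 := by nlinarith [mul_pos p1 hβ]
  have u1 : α * c.M1 * T * β ≤ 1 / 32 := by
    have : 0 ≤ α * ((c.Lg : ℝ) ^ 2 * η) := by positivity
    linarith
  have u2 : α * (c.Lg : ℝ) ^ 2 * η ≤ 1 / 32 := by
    have : 0 ≤ α * (c.M1 * T * β) := by positivity
    linarith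
  have v1 : l₂ * η * J * T * c.M1 * β / c.μ ≤ 1 / 1024 := by
    rw [div_le_iff₀ hμ]
    have : 0 ≤ l₂ * η * (J * ((c.Lg : ℝ) ^ 2 * η)) := by positivity
    linarith
  have v2 : l₂ * η * J * (c.Lg : ℝ) ^ 2 * η / c.μ ≤ 1 / 1024 := by
    rw [div_le_iff₀ hμ]
    have : 0 ≤ l₂ * η * (J * (T * c.M1 * β)) := by positivity
    linarith
  have w1 : l₁ * β * (T * (c.Lg : ℝ) ^ 2 * β) / c.μ ≤ 1 / 384 := by
    rw [div_le_iff₀ hμ]; linarith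
  constructor <;> dsimp only
  · linarith
  · have : 0 ≤ α * (96 * c.Cy ^ 2) := by positivity
    linarith
  · have : 0 ≤ α * (48 * c.Cv ^ 2) := by positivity
    have : 0 < l₂ * η := mul_pos p2 hη
    have := mul_pos hμ this
    linarith
  · have f1 : c.Cy ^ 2 * α / (l₁ * β * c.μ) ≤ 1 / 96 := by
      rw [div_le_iff₀ (by positivity)]
      have : 0 ≤ α * (8 * c.M1) := by positivity
      linarith
    have f2 : c.Cv ^ 2 * α / (l₂ * η * c.μ) ≤ 1 / 48 := by
      rw [div_le_iff₀ (by positivity)]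
      have : 0 ≤ α * (48 * (c.Lg : ℝ) ^ 2) := by positivity
      linarith
    have f3 : α * (l₁ * β * (c.Lg : ℝ) ^ 2 * T) / c.μ ≤ 1 / 192 := by
      rw [div_le_iff₀ hμ]; linarith
    have f4 : α * (l₂ * η * c.M1 * J) / c.μ ≤ 1 / 192 := by
      rw [div_le_iff₀ hμ]; linarith
    -- The bracket is at most 5/96 + 5/48 + 4/192 + 8/192 + 1/144 < 1/3.
    calc _ = α * (5 * (c.Cy ^ 2 * α / (l₁ * β * c.μ)) + 5 * (c.Cv ^ 2 * α / (l₂ * η * c.μ))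
          + 4 * (α * (l₁ * β * (c.Lg : ℝ) ^ 2 * T) / c.μ) + 8 * (α * (l₂ * η * c.M1 * J) / c.μ)
          + α ^ 2 * c.M1) := by ring
      _ ≤ α * (1 / 3) := mul_le_mul_of_nonneg_left (by linarith) p3.le
      _ = α / 3 := by ring
  -- One factor λ₁ supplies the 1/L_g of the right-hand side; the remaining bracket only has to be
  -- at most 1/2.
  · have hl : l₁ ≤ 1 / (2 * (c.Lg : ℝ)) := by rwa [le_div_iff₀ (by positivity)]
    calc _ = l₁ * β * (l₁ * (4 * (l₁ * β * (T * (c.Lg : ℝ) ^ 2 * β) / c.μ)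
          + 8 * (l₂ * η * J * T * c.M1 * β / c.μ) + α * c.M1 * T * β)) := by ring
      _ ≤ l₁ * β * (1 / (2 * (c.Lg : ℝ)) * (1 / 2)) := by
        refine mul_le_mul_of_nonneg_left (mul_le_mul hl (by linarith) ?_ (by positivity))
          (by positivity)
        positivity
      _ = _ := by ring
  · have hl : l₂ ≤ 1 / (2 * (c.Lg : ℝ)) := by rwa [le_div_iff₀ (by positivity)]
    calc _ = l₂ * η * (l₂ * (16 * (l₂ * η * J * (c.Lg : ℝ) ^ 2 * η / c.μ) + 2 * (α * (c.Lg : ℝ) ^ 2 * η))) := by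
          ring
      _ ≤ l₂ * η * (1 / (2 * (c.Lg : ℝ)) * (1 / 2)) := by
        refine mul_le_mul_of_nonneg_left (mul_le_mul hl (by linarith) ?_ (by positivity))
          (by positivity)
        positivity
      _ = _ := by ring

end StepSizes

/-! ### Initial values, lower bound and conclusion -/

section Initial

variable {p q : ℕ} {Ξ Z Ω : Type*} [MeasurableSpace Ξ] [MeasurableSpace Z]
  [MeasurableSpace Ω] (P : Measure Ξ) (Q : Measure Z)
  (F : Ξ → Joint p q → ℝ) (G : Z → Joint p q → ℝ)
  (Pr : Measure Ω) [IsProbabilityMeasure Pr] (smp : Draw → Ω → Ξ × Z)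
  (a : Params) (x₀ : Vec p) (y₀ v₀ : Vec q)

theorem meanPhi_zero : meanPhi P Q F G Pr smp a x₀ y₀ v₀ 0 =
    valueFun (expected P F) (expected Q G) x₀ := by
  simp [meanPhi, rPath, refresh_x, run]

omit [MeasurableSpace Ξ] in
theorem distY_zero : distY Q F G Pr smp a x₀ y₀ v₀ 0 =
    ‖y₀ - lowerSol (expected Q G) x₀‖ ^ 2 := by
  simp [distY, rPath, refresh_x, refresh_y, run]

theorem distV_zero : distV P Q F G Pr smp a x₀ y₀ v₀ 0 =
    ‖v₀ - auxSol (expected P F) (expected Q G) x₀‖ ^ 2 := by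
  simp [distV, rPath, refresh_x, refresh_v, run]

end Initial

theorem le_meanPhi {p q : ℕ} {Ξ Z Ω : Type*} [MeasurableSpace Ξ] [MeasurableSpace Z]
    [MeasurableSpace Ω] {P : Measure Ξ} [IsProbabilityMeasure P] {Q : Measure Z}
    [IsProbabilityMeasure Q] {F : Ξ → Joint p q → ℝ} {G : Z → Joint p q → ℝ} {c : Constants}
    {Pr : Measure Ω} [IsProbabilityMeasure Pr] {smp : Draw → Ω → Ξ × Z}
    (hA : Assumptions P Q F G c) (hS : IsSampling P Q Pr smp) {a : Params} (ha : IsSpider c a)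
    {x₀ : Vec p} {y₀ v₀ : Vec q} (hv₀ : ‖v₀‖ ≤ c.M) {b : ℝ}
    (hb : ∀ x, b ≤ valueFun (expected P F) (expected Q G) x) (k : ℕ) :
    b ≤ meanPhi P Q F G Pr smp a x₀ y₀ v₀ k := by
  have h := integral_mono (integrable_const b) (integrable_valueFun hA (hist_le hS.meas _)
    (rPath_adapted hA hS ha hv₀ k (x₀ := x₀) (y₀ := y₀)).x) fun ω => hb _
  simpa [meanPhi] using h

/-- Averaging a bound on weighted sums. -/
theorem average_le {w D V S : ℝ} (hw : 0 < w) (hD : 0 ≤ D) (hV : 0 ≤ V) (hS : 0 < S)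
    {K : ℕ} (hK : 0 < K) {g : ℕ → ℝ}
    (h : ∑ k ∈ Finset.range K, w * g k ≤ D + K * (V / S)) :
    1 / (K : ℝ) * ∑ k ∈ Finset.range K, g k ≤ (D + V) / w * (1 / K + 1 / S) := by
  have hK0 : (0 : ℝ) < K := by exact_mod_cast hK
  rw [← Finset.mul_sum] at h
  have h1 : 1 / (K : ℝ) * ∑ k ∈ Finset.range K, g k =
      1 / (K * w) * (w * ∑ k ∈ Finset.range K, g k) := by
    field_simp
  have h2 : 1 / (K * w) * (D + K * (V / S)) = D / w * (1 / K) + V / w * (1 / S) := by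
    field_simp
  have h3 : 0 ≤ D / w * (1 / S) + V / w * (1 / K) := by positivity
  have h4 := mul_le_mul_of_nonneg_left h (show 0 ≤ 1 / (K * w) by positivity)
  rw [h1]
  rw [h2] at h4
  refine h4.trans ?_
  rw [add_div]
  linarith

end ALSSpider

open ALSSpider in
theorem theorem1 {p q : ℕ} (hq : 0 < q)
    {Ξ Z : Type*} [MeasurableSpace Ξ] [MeasurableSpace Z]
    (P : Measure Ξ) [IsProbabilityMeasure P] (Q : Measure Z) [IsProbabilityMeasure Q]
    (F : Ξ → Joint p q → ℝ) (G : Z → Joint p q → ℝ) (c : Constants)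
    (hA : Assumptions P Q F G c) (hLPhi : 0 < c.LPhi)
    (T J : ℕ) (hT : 0 < T) (hJ : 0 < J)
    (β η : ℝ) (hβ : 0 < β) (hβ1 : β < 1) (hη : 0 < η) (hη1 : η < 1)
    (x₀ : Vec p) (y₀ v₀ : Vec q) (hv₀ : ‖v₀‖ ≤ c.M) :
    Differentiable ℝ (valueFun (expected P F) (expected Q G)) ∧
    ∃ C : ℝ, ∀ K S1 S2 q1 : ℕ, 0 < K → 0 < S1 → 0 < q1 → S2 = q1 →
      ∀ {Ω : Type*} [MeasurableSpace Ω] (Pr : Measure Ω) [IsProbabilityMeasure Pr]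
        (smp : Draw → Ω → Ξ × Z), IsSampling P Q Pr smp →
      let x : ℕ → Ω → Vec p := fun k ω =>
        (run (spiderParams c T J q1 S1 S2 β η) F G (fun d => smp d ω) x₀ y₀ v₀ k).x
      let gradPhi : Vec p → Vec p := gradient (valueFun (expected P F) (expected Q G))
      (∀ k < K, Integrable (fun ω => ‖gradPhi (x k ω)‖ ^ 2) Pr) ∧
      1 / (K : ℝ) * ∑ k ∈ Finset.range K, ∫ ω, ‖gradPhi (x k ω)‖ ^ 2 ∂Pr
        ≤ C * (1 / (K : ℝ) + 1 / (S1 : ℝ)) := by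
  have hR := hA.regular
  have hμ := hA.μ_pos
  have hμL := hR.μ_le_Lg hq
  have hL : (0 : ℝ) < c.Lg := hμ.trans_le hμL
  have hM1 := Constants.M1_pos hμ hA.radius hLPhi
  have hl₁ := Constants.lam1_pos (c := c) hμ hL hT hJ hβ
  have hl₂ := Constants.lam2_pos (c := c) hμ hL hM1 hT hJ hβ hη
  have hα := Constants.alpha_pos hμ hL hM1 hLPhi hT hJ hβ hη
  obtain ⟨b, hb⟩ := hA.bddBelow
  replace hb : ∀ x, b ≤ valueFun (expected P F) (expected Q G) x := fun x => hb ⟨x, rfl⟩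
  -- The witness is (initial potential gap + noise level) divided by α/2, with all step sizes taken
  -- at r = 1; the factor 1/S₁ is split off from the noise.
  refine ⟨hR.differentiable_valueFun,
    ((valueFun (expected P F) (expected Q G) x₀ - b + ‖y₀ - lowerSol (expected Q G) x₀‖ ^ 2
      + ‖v₀ - auxSol (expected P F) (expected Q G) x₀‖ ^ 2)
      + (c.alpha T J β η 1 * (2 * c.σf ^ 2 + 2 * c.M ^ 2 * c.σgxy ^ 2)
      + 4 * (c.lam1 T J β 1 * β) / c.μ * T * c.σg ^ 2
      + 8 * (c.lam2 T J β η 1 * η) / c.μ * J * (2 * c.σf ^ 2 + 2 * c.M ^ 2 * c.σgyy ^ 2)))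
      / (c.alpha T J β η 1 / 2), ?_⟩
  intro K S1 S2 q1 hK hS1 hq1 hS2 Ω _ Pr _ smp hS x gradPhi
  subst hS2
  have ha := isSpider_spiderParams (S1 := S1) hμ hμL hM1 hLPhi hT hJ hq1 hβ hη hS1
  have hbal := isBalanced_spiderParams (S1 := S1) hμ hμL hM1 hLPhi hT hJ hq1 hβ hη hβ1.le
  have hx : ∀ k ω, (rPath F G smp (spiderParams c T J S2 S1 S2 β η) x₀ y₀ v₀ k ω).x = x k ω :=
    fun k ω => refresh_x ..
  have hG : ∀ k, sqGrad P Q F G Pr smp (spiderParams c T J S2 S1 S2 β η) x₀ y₀ v₀ k =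
      ∫ ω, ‖gradPhi (x k ω)‖ ^ 2 ∂Pr := fun k => by simp only [sqGrad, hx, gradPhi]
  refine ⟨fun k _ => ?_, ?_⟩
  · have := integrable_sqGrad hA hS ha hq hv₀ k (x₀ := x₀) (y₀ := y₀)
    simpa only [hx] using this
  have hsum := sum_sqGrad_le hq hA hS ha hbal hq1 rfl hv₀ K (x₀ := x₀) (y₀ := y₀)
  have hlow := le_meanPhi hA hS ha hv₀ hb K (x₀ := x₀) (y₀ := y₀)
  rw [meanPhi_zero, distY_zero, distV_zero] at hsum
  simp only [hG] at hsum
  rw [spiderParams_self c T J S1 hq1] at hsum hlow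
  have hb₀ := sub_nonneg.2 (hb x₀)
  refine average_le (half_pos hα) (by positivity) (by positivity) (by exact_mod_cast hS1) hK ?_
  dsimp only at hsum
  linear_combination hsum + hlow
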